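/- Let $G$ be a finite $2$-connected outerplanar graph (at least three vertices) of maximum degree at most $3$. Fix a planar drawing of $G$ in which all vertices lie on the outer face; the boundary of the outer face is then a cycle $C$ through all the vertices, and the edges of $G$ not on $C$ are called chords. A face other than the outer face is called internal if more than two chords lie on its boundary. If exactly $r$ faces are internal, then $$\chi_\rho(G)\le 17\cdot 6^{3r}-2 .$$ Here the packing chromatic number $\chi_\rho(G)$ is the least integer $k$ for which there is a map $c:V(G)\to\{1,\dots,k\}$ such that any two distinct vertices $u,v$ with $c(u)=c(v)=i$ have distance $d_G(u,v)>i$ (and $\chi_\rho(G)=\infty$ if there is no such $k$). -/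

import Mathlib

namespace SimpleGraph

variable {V : Type*}

/-- A packing `k`-colouring: the colours are `1, …, k`, and two distinct vertices of the same
colour `i` are at distance greater than `i`. The distance takes values in `ℕ∞` (vertices in
different components are at distance `∞`). -/
structure IsPackingColoring (G : SimpleGraph V) (k : ℕ) (c : V → ℕ) : Prop where
  color_mem : ∀ v, 1 ≤ c v ∧ c v ≤ k
  lt_dist : ∀ u v, u ≠ v → c u = c v → (c u : ℕ∞) < G.edist u v

/-- The packing chromatic number: the least `k` such that `G` has a packing `k`-colouring, and `∞`
if there is no such `k`. -/
noncomputable def packingChromaticNumber (G : SimpleGraph V) : ℕ∞ :=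
  ⨅ k ∈ {k : ℕ | ∃ c : V → ℕ, G.IsPackingColoring k c}, (k : ℕ∞)

/-- `G` is `2`-connected: it has at least three vertices, it is connected, and it stays connected
when any one vertex is deleted. -/
structure IsTwoConnected (G : SimpleGraph V) : Prop where
  three_le_card : 3 ≤ Nat.card V
  connected : G.Connected
  connected_delete : ∀ v : V, (G.induce {v}ᶜ).Connected

/-- `G` is subcubic: every vertex has degree at most `3`. -/
def IsSubcubic (G : SimpleGraph V) [G.LocallyFinite] : Prop :=
  ∀ v, G.degree v ≤ 3

/-- A rotation system on `G`: a permutation of the darts (oriented edges) whose cycles are exactly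
the sets of darts leaving a common vertex. In a drawing of `G` on an oriented surface, `rot d` is
the dart that follows `d` in the cyclic order of the darts around the vertex `d.fst`. -/
structure RotationSystem (G : SimpleGraph V) where
  rot : Equiv.Perm G.Dart
  sameCycle_iff : ∀ d d' : G.Dart, rot.SameCycle d d' ↔ d.fst = d'.fst

namespace RotationSystem

variable {G : SimpleGraph V} (R : G.RotationSystem)

/-- The face-tracing permutation: walk along the dart `d` from `u` to `v`, then leave `v` along the
dart that follows the dart from `v` to `u` around `v`. -/
def facePerm : Equiv.Perm G.Dart :=
  (Dart.symm_involutive (G := G)).toPerm.trans R.rot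

/-- The faces of the drawing, each given by the closed walk of darts that bounds it. -/
def Face : Type _ := Quotient (Equiv.Perm.SameCycle.setoid R.facePerm)

/-- The face on whose boundary walk the dart `d` lies. -/
def faceOf (d : G.Dart) : R.Face := Quotient.mk (Equiv.Perm.SameCycle.setoid R.facePerm) d

/-- The vertex `v` lies on (the boundary of) the face `f`. -/
def VertexOnFace (v : V) (f : R.Face) : Prop := ∃ d : G.Dart, d.fst = v ∧ R.faceOf d = f

/-- The edge `e` lies on (the boundary of) the face `f`, on at least one of its two sides. -/
def EdgeOnFace (e : Sym2 V) (f : R.Face) : Prop := ∃ d : G.Dart, d.edge = e ∧ R.faceOf d = f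

end RotationSystem

/-- A planar drawing of a (finite, connected, non-trivial) graph, given combinatorially: a rotation
system of genus zero, that is, one that satisfies Euler's formula
`|V| - |E| + |F| = 2` (written without subtraction). -/
structure PlanarDrawing (G : SimpleGraph V) extends RotationSystem G where
  connected : G.Connected
  euler : Nat.card V + Nat.card toRotationSystem.Face = Nat.card G.edgeSet + 2

/-- An outerplanar drawing: a planar drawing with a distinguished face, the outer face, on which
all the vertices lie. A graph is outerplanar if it has such a drawing. -/
structure OuterplanarDrawing (G : SimpleGraph V) extends PlanarDrawing G where
  outer : toRotationSystem.Face
  vertexOnFace_outer : ∀ v : V, toRotationSystem.VertexOnFace v outer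

namespace OuterplanarDrawing

variable {G : SimpleGraph V} (D : G.OuterplanarDrawing)

/-- The chords: the edges of `G` that are not on the boundary of the outer face (for a
`2`-connected graph, this boundary is a cycle through all the vertices). -/
def chords : Set (Sym2 V) :=
  {e | e ∈ G.edgeSet ∧ ¬ D.toRotationSystem.EdgeOnFace e D.outer}

/-- The internal faces: the faces other than the outer face that contain more than two chords. -/
def internalFaces : Set D.toRotationSystem.Face :=
  {f | f ≠ D.outer ∧ 2 < {e | e ∈ D.chords ∧ D.toRotationSystem.EdgeOnFace e f}.ncard}

end OuterplanarDrawing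

end SimpleGraph

/-!
The proof gives a packing colouring with `16 * 64 ^ r - 1` colours.

*The cycle and its chords.* At a vertex of degree at most three, two corners in the outer face would
put the outer face on both sides of an edge, which is impossible in a `2`-connected graph. So the
outer face meets each vertex once and is bounded by a Hamiltonian cycle, and each vertex has at most
one chord. That the chords do not cross is a Jordan curve theorem
(`PlanarDrawing.exists_face_coloring`): Euler's formula says that the coboundaries of sets of faces
fill the cycle space modulo `2`. Number the cycle `0, …, n - 1`, where `0` has no chord. The chords
`a < b`, and the root arc `(0, n)`, are then arcs that are nested or disjoint. Each arc stands for
the inner face just below it, whose boundary consists of the arc, its maximal sub-arcs ("children")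
and edges of the cycle. A branch arc is an arc with at least two children; its face is internal if
the arc is a chord. The cycle can be numbered so that the root arc is not a branch arc. So there are
at most `r` branch arcs (`ncard_branchArcs_le`).

*The skeleton.* Between branch arcs, the arcs form chains, the legs. A leg starts at the root arc or
at a child of a branch arc, and it ends at a branch arc or at an arc without children. Choose a
geodesic along each leg. The skeleton consists of these geodesics and of the faces of the branch
arcs. Each chord has an end in the skeleton, and each vertex of the skeleton has at most one
neighbour outside it. So the rest of the graph consists of paths, which are coloured with
`1, 2, 1, 3, …`. The only conflicts are between vertices of colour `3` whose partners, the other ends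
of their chords, are consecutive on the geodesic of a leg (`exists_three_coloring`). They are removed
by a swap: the vertex on the geodesic gets the colour `1`, and its colour passes to its partner. This
is harmless because the partner is no closer to the start of the leg, by the choice of the geodesic,
and is just one step farther from its end (`isPlace_partner`).

*The colours of the skeleton.* The colours from `16` on are divided into `3 * r` blocks
`16 * 4 ^ j, …, 4 * 16 * 4 ^ j - 1`, three for each branch arc. A block colours the integers so that
equal colours are far apart (`blockColor_lt`), and it is pulled back along a `1`-Lipschitz function on
the vertices, the level with respect to the branch arc (`faceLevel_sub_le_dist`). The three blocks
serve the left half of the face together with the leg that ends there, the right half of the face,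
and the first vertices of the legs that start at the face. The remaining vertices are those on the
legs that end at an arc without children, and they get the colours `4, …, 15`. A vertex with number
`t ≥ 2` on its leg gets a colour of at most `2 * t` (`leafColor_le`), so different legs do not
interfere.
-/

/-! ### Distances in connected graphs -/

namespace SimpleGraph

section SetDist

variable {V : Type*} {G : SimpleGraph V}

/-- The distance from a set `S` of vertices to the vertex `v`; it is meaningful when `S` is
nonempty and `G` is connected. -/
noncomputable def setDist (G : SimpleGraph V) (S : Set V) (v : V) : ℕ :=
  sInf ((fun s => G.dist s v) '' S)

theorem setDist_le {S : Set V} {s : V} (hs : s ∈ S) (v : V) : G.setDist S v ≤ G.dist s v :=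
  Nat.sInf_le ⟨s, hs, rfl⟩

theorem exists_dist_eq_setDist {S : Set V} (hS : S.Nonempty) (v : V) :
    ∃ s ∈ S, G.dist s v = G.setDist S v :=
  Nat.sInf_mem (hS.image fun s => G.dist s v)

theorem setDist_of_mem {S : Set V} {v : V} (hv : v ∈ S) : G.setDist S v = 0 := by
  have := setDist_le (G := G) hv v
  simpa using this

theorem setDist_pos (hc : G.Connected) {S : Set V} (hS : S.Nonempty) {v : V} (hv : v ∉ S) :
    0 < G.setDist S v := by
  obtain ⟨s, hs, h⟩ := exists_dist_eq_setDist (G := G) hS v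
  rw [← h]
  exact hc.pos_dist_of_ne (by rintro rfl; exact hv hs)

theorem setDist_le_add_dist (hc : G.Connected) {S : Set V} (hS : S.Nonempty) (v w : V) :
    G.setDist S v ≤ G.setDist S w + G.dist w v := by
  obtain ⟨s, hs, h⟩ := exists_dist_eq_setDist (G := G) hS w
  rw [← h]
  exact (setDist_le hs v).trans hc.dist_triangle

theorem setDist_le_succ (hc : G.Connected) {S : Set V} (hS : S.Nonempty) {v w : V}
    (h : G.Adj w v) : G.setDist S v ≤ G.setDist S w + 1 := by
  have h1 := setDist_le_add_dist hc hS v w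
  rwa [dist_eq_one_iff_adj.2 h] at h1

/-- The penultimate vertex of a geodesic from `x` to `y`. -/
theorem exists_adj_dist_eq_succ (hc : G.Connected) {x y : V} (hne : x ≠ y) :
    ∃ w, G.Adj w y ∧ G.dist x y = G.dist x w + 1 := by
  obtain ⟨p, hp⟩ := hc.exists_walk_length_eq_dist y x
  cases p with
  | nil => exact absurd rfl hne
  | cons hadj q =>
    rename_i w
    refine ⟨w, hadj.symm, ?_⟩
    have h1 := dist_le q
    have h2 : G.dist x y ≤ G.dist x w + G.dist w y := hc.dist_triangle
    rw [dist_eq_one_iff_adj.2 hadj.symm] at h2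
    rw [Walk.length_cons] at hp
    rw [dist_comm (u := x) (v := w), dist_comm (u := x) (v := y)] at *
    omega

theorem exists_adj_setDist_eq (hc : G.Connected) {S : Set V} (hS : S.Nonempty) {v : V} {k : ℕ}
    (h : G.setDist S v = k + 1) : ∃ w, G.Adj v w ∧ G.setDist S w = k := by
  obtain ⟨s, hs, hd⟩ := exists_dist_eq_setDist (G := G) hS v
  have hne : s ≠ v := by
    rintro rfl
    rw [setDist_of_mem hs] at h
    omega
  obtain ⟨w, hw, hw2⟩ := exists_adj_dist_eq_succ hc hne
  refine ⟨w, hw.symm, ?_⟩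
  have h1 := setDist_le (G := G) hs w
  have h2 := setDist_le_succ hc hS hw
  omega

/-- If every edge that enters `I` enters it at a vertex of `B`, then a geodesic that enters `I`
passes through `B`. -/
theorem exists_dist_eq_add_of_separates (hc : G.Connected) {I B : Set V}
    (hsep : ∀ x y, G.Adj x y → x ∉ I → y ∈ I → y ∈ B) {x : V} (hx : x ∉ I) {e : V} (he : e ∈ I) :
    ∃ s ∈ B, G.dist x e = G.dist x s + G.dist s e := by
  induction hn : G.dist x e using Nat.strong_induction_on generalizing e with
  | _ n ih =>
    have hne : x ≠ e := by rintro rfl; exact hx he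
    obtain ⟨w, hw, hd⟩ := exists_adj_dist_eq_succ hc hne
    by_cases hwI : w ∈ I
    · obtain ⟨s, hs, h⟩ := ih (G.dist x w) (by omega) hwI rfl
      refine ⟨s, hs, ?_⟩
      have h1 : G.dist s e ≤ G.dist s w + G.dist w e := hc.dist_triangle
      have h2 : G.dist x e ≤ G.dist x s + G.dist s e := hc.dist_triangle
      rw [dist_eq_one_iff_adj.2 hw] at h1
      omega
    · exact ⟨e, hsep w e hw hwI he, by simp [hn]⟩

/-- A function that is `1`-Lipschitz along edges is `1`-Lipschitz for the distance. -/
theorem sub_le_dist_of_adj (hc : G.Connected) {u : V → ℤ}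
    (hu : ∀ x y, G.Adj x y → u x ≤ u y + 1) (x y : V) : u x - u y ≤ G.dist x y := by
  obtain ⟨p, hp⟩ := hc.exists_walk_length_eq_dist x y
  rw [← hp]
  clear hp
  induction p with
  | nil => simp
  | cons h q ih =>
    have := hu _ _ h
    rw [Walk.length_cons]
    push_cast
    omega

theorem adj_or_of_dist_le_two (hc : G.Connected) {x y : V} (hne : x ≠ y) (h : G.dist x y ≤ 2) :
    G.Adj x y ∨ ∃ a, G.Adj x a ∧ G.Adj a y := by
  obtain ⟨w, hw, hd⟩ := exists_adj_dist_eq_succ hc hne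
  rcases (show G.dist x w = 0 ∨ G.dist x w = 1 by omega) with h0 | h1
  · rw [hc.dist_eq_zero_iff] at h0
    exact Or.inl (h0 ▸ hw)
  · exact Or.inr ⟨w, dist_eq_one_iff_adj.1 h1, hw⟩

theorem adj_or_of_dist_le_three (hc : G.Connected) {x y : V} (hne : x ≠ y)
    (h : G.dist x y ≤ 3) :
    G.Adj x y ∨ (∃ a, G.Adj x a ∧ G.Adj a y) ∨ ∃ a b, G.Adj x a ∧ G.Adj a b ∧ G.Adj b y := by
  obtain ⟨w, hw, hd⟩ := exists_adj_dist_eq_succ hc hne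
  by_cases hxw : x = w
  · exact Or.inl (hxw ▸ hw)
  · rcases adj_or_of_dist_le_two hc hxw (by omega) with h1 | ⟨a, h1, h2⟩
    · exact Or.inr (Or.inl ⟨w, h1, hw⟩)
    · exact Or.inr (Or.inr ⟨a, w, h1, h2, hw⟩)

/-- A geodesic between two sets `S` and `T` of vertices that is traced from `T` back to `S` and
that uses the partner of a vertex under `m` whenever this brings it closer to `S`. -/
structure IsPreferredGeodesic (G : SimpleGraph V) (m : V → V → Prop) (S T : Set V) (L : ℕ)
    (p : ℕ → V) : Prop where
  setDist_left : ∀ t ≤ L, G.setDist S (p t) = t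
  setDist_right : ∀ t ≤ L, G.setDist T (p t) = L - t
  adj : ∀ t < L, G.Adj (p t) (p (t + 1))
  zero_mem : p 0 ∈ S
  last_mem : p L ∈ T
  preferred : ∀ t < L, ∀ z, m (p (t + 1)) z → G.setDist S z = t → p t = z

theorem IsPreferredGeodesic.ne {m : V → V → Prop} {S T : Set V} {L : ℕ} {p : ℕ → V}
    (hp : G.IsPreferredGeodesic m S T L p) {s t : ℕ} (hs : s ≤ L) (ht : t ≤ L) (hst : s ≠ t) :
    p s ≠ p t := by
  intro h
  have h1 := hp.setDist_left s hs
  rw [h, hp.setDist_left t ht] at h1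
  exact hst h1.symm

theorem IsPreferredGeodesic.notMem_left {m : V → V → Prop} {S T : Set V} {L : ℕ} {p : ℕ → V}
    (hp : G.IsPreferredGeodesic m S T L p) {t : ℕ} (h1 : 1 ≤ t) (ht : t ≤ L) : p t ∉ S := by
  intro h
  have h2 := setDist_of_mem (G := G) h
  rw [hp.setDist_left t ht] at h2
  omega

/-- Preferred geodesics exist for a matching `m` along edges: start at a vertex of `T` that is closest
to `S`, and step repeatedly to a neighbour that is closer to `S`, which is the partner if possible. -/
theorem exists_isPreferredGeodesic (hc : G.Connected) {m : V → V → Prop}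
    (hm : ∀ v z, m v z → G.Adj v z) (hm' : ∀ v z z', m v z → m v z' → z = z')
    {S T : Set V} (hS : S.Nonempty) (hT : T.Nonempty) :
    ∃ L p, G.IsPreferredGeodesic m S T L p := by
  classical
  obtain ⟨y, hy, hmin⟩ : ∃ y ∈ T, ∀ y' ∈ T, G.setDist S y ≤ G.setDist S y' := by
    obtain ⟨y, hy, h⟩ := Nat.sInf_mem (hT.image (G.setDist S))
    exact ⟨y, hy, fun y' hy' => h ▸ Nat.sInf_le ⟨y', hy', rfl⟩⟩
  -- The successor of each vertex on the way to `S`.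
  have hpar : ∀ v, ∃ w, ∀ k, G.setDist S v = k + 1 → (G.Adj v w ∧ G.setDist S w = k) ∧
      ∀ z, m v z → G.setDist S z = k → w = z := by
    intro v
    rcases hv : G.setDist S v with _ | k
    · exact ⟨v, by simp⟩
    · by_cases hz : ∃ z, m v z ∧ G.setDist S z = k
      · obtain ⟨z, hz, hz2⟩ := hz
        refine ⟨z, fun k' hk' => ?_⟩
        obtain rfl : k = k' := by omega
        exact ⟨⟨hm _ _ hz, hz2⟩, fun z' hz' _ => hm' _ _ _ hz hz'⟩
      · obtain ⟨w, hw⟩ := exists_adj_setDist_eq hc hS hv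
        refine ⟨w, fun k' hk' => ?_⟩
        obtain rfl : k = k' := by omega
        exact ⟨hw, fun z' hz' h => absurd ⟨z', hz', h⟩ hz⟩
  choose par hpar using hpar
  set L := G.setDist S y with hL
  have key : ∀ j ≤ L, G.setDist S (par^[j] y) = L - j ∧ G.setDist T (par^[j] y) ≤ j := by
    intro j
    induction j with
    | zero => intro _; exact ⟨by simp [hL], by simp [setDist_of_mem hy]⟩
    | succ j ih =>
      intro hj
      obtain ⟨h1, h2⟩ := ih (by omega)
      obtain ⟨⟨h3, h4⟩, -⟩ := hpar (par^[j] y) (L - (j + 1)) (by omega)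
      rw [Function.iterate_succ_apply']
      refine ⟨h4, ?_⟩
      have := setDist_le_succ hc hT h3
      omega
  have hstep : ∀ t < L, par^[L - t] y = par (par^[L - (t + 1)] y) := by
    intro t ht
    rw [← Function.iterate_succ_apply' par]
    congr 2
    omega
  refine ⟨L, fun t => par^[L - t] y, ⟨?_, ?_, ?_, ?_, ?_, ?_⟩⟩
  · intro t ht
    have := (key (L - t) (by omega)).1
    omega
  · intro t ht
    have h1 := key (L - t) (by omega)
    obtain ⟨e, he, h2⟩ := exists_dist_eq_setDist (G := G) hT (par^[L - t] y)
    have h3 := hmin e he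
    have h4 := setDist_le_add_dist hc hS e (par^[L - t] y)
    rw [dist_comm] at h4
    omega
  · intro t ht
    rw [hstep t ht]
    have := (key (L - (t + 1)) (by omega)).1
    exact ((hpar _ t (by omega)).1.1).symm
  · by_contra h0
    have h1 := setDist_pos hc hS h0
    have := (key L le_rfl).1
    simp only [Nat.sub_zero] at h1
    omega
  · simpa using hy
  · intro t ht z hz h
    rw [hstep t ht]
    have := (key (L - (t + 1)) (by omega)).1
    exact (hpar _ t (by omega)).2 z hz h

end SetDist

end SimpleGraph

/-! ### Colour sequences -/

namespace OuterplanarPacking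

/-- A colouring of the integers with the colours `K, …, 4 * K - 1`: the colours below `2 * K` are
used with period `2 * K` on the even integers, the others with period `4 * K` on the odd ones. -/
def blockColor (K : ℕ) (u : ℤ) : ℕ :=
  if u % 2 = 0 then K + ((u / 2) % K).toNat else 2 * K + ((u / 2) % (2 * K)).toNat

theorem blockColor_bounds {K : ℕ} (hK : 0 < K) (u : ℤ) :
    K ≤ blockColor K u ∧ blockColor K u < 4 * K := by
  have h1 := Int.emod_nonneg (u / 2) (show (K : ℤ) ≠ 0 by omega)
  have h2 := Int.emod_lt_of_pos (u / 2) (show (0 : ℤ) < K by omega)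
  have h3 := Int.emod_nonneg (u / 2) (show (2 * K : ℤ) ≠ 0 by omega)
  have h4 := Int.emod_lt_of_pos (u / 2) (show (0 : ℤ) < 2 * K by omega)
  unfold blockColor
  split_ifs <;> omega

theorem le_abs_sub_of_emod_eq {K x y : ℤ} (h : x % K = y % K) (hne : x ≠ y) :
    K ≤ |x - y| := by
  have h1 : K ∣ x - y :=
    Int.dvd_of_emod_eq_zero (Int.emod_eq_emod_iff_emod_sub_eq_zero.1 h)
  exact Int.le_of_dvd (abs_pos.2 (sub_ne_zero.2 hne)) ((dvd_abs _ _).2 h1)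

theorem blockColor_lt {K : ℕ} (hK : 0 < K) {u v : ℤ} (h : blockColor K u = blockColor K v)
    (hne : u ≠ v) : (blockColor K u : ℤ) < |u - v| := by
  have h1 := Int.emod_nonneg (u / 2) (show (K : ℤ) ≠ 0 by omega)
  have h2 := Int.emod_lt_of_pos (u / 2) (show (0 : ℤ) < K by omega)
  have h3 := Int.emod_nonneg (u / 2) (show (2 * K : ℤ) ≠ 0 by omega)
  have h4 := Int.emod_lt_of_pos (u / 2) (show (0 : ℤ) < 2 * K by omega)
  have h1' := Int.emod_nonneg (v / 2) (show (K : ℤ) ≠ 0 by omega)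
  have h2' := Int.emod_lt_of_pos (v / 2) (show (0 : ℤ) < K by omega)
  have h3' := Int.emod_nonneg (v / 2) (show (2 * K : ℤ) ≠ 0 by omega)
  have h4' := Int.emod_lt_of_pos (v / 2) (show (0 : ℤ) < 2 * K by omega)
  unfold blockColor at h ⊢
  split_ifs at h ⊢ with ha hb hb
  · have := le_abs_sub_of_emod_eq (K := K) (x := u / 2) (y := v / 2) (by omega)
      (by omega)
    rw [le_abs] at this
    rw [lt_abs]
    omega
  · omega
  · omega
  · have := le_abs_sub_of_emod_eq (K := 2 * K) (x := u / 2) (y := v / 2) (by omega)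
      (by omega)
    rw [le_abs] at this
    rw [lt_abs]
    omega

/-- A colouring of the natural numbers with the colours `4, …, 15`: the colours below `8` are used
with period `8`, the others with period `16`, and the phase is chosen so that
`leafColor t ≤ 2 * t` for `2 ≤ t`. -/
def leafColor (t : ℕ) : ℕ :=
  if 2 ≤ t % 8 ∧ t % 8 ≤ 5 then t % 8 + 2
  else if 6 ≤ t % 16 ∧ t % 16 ≤ 9 then t % 16 + 2
  else if 14 ≤ t % 16 then t % 16 - 2
  else t % 16 + 14

theorem leafColor_bounds (t : ℕ) : 4 ≤ leafColor t ∧ leafColor t ≤ 15 := by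
  unfold leafColor
  split_ifs <;> omega

theorem leafColor_le {t : ℕ} (ht : 2 ≤ t) : leafColor t ≤ 2 * t := by
  unfold leafColor
  split_ifs <;> omega

theorem leafColor_lt {s t : ℕ} (h : leafColor s = leafColor t) (hst : s < t) :
    s + leafColor s < t := by
  unfold leafColor at h ⊢
  split_ifs at h ⊢ <;> omega

/-- The number of consecutive integers just below `i`, down to `0`, at which `Z` holds. -/
noncomputable def runBelow (Z : ℕ → Prop) : ℕ → ℕ
  | 0 => 0
  | i + 1 => open Classical in if Z i then runBelow Z i + 1 else 0

/-- A set of integers can be coloured with `1, 2, 3` along each of its runs, following the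
periodic pattern `1, 2, 1, 3`, so that no run has the colour `3` at one of its ends. -/
theorem exists_run_coloring {Z : ℕ → Prop} {n : ℕ} (hZ : ∀ i, Z i → 0 < i ∧ i < n) :
    ∃ c : ℕ → ℕ, (∀ i, c i = 1 ∨ c i = 2 ∨ c i = 3) ∧
      (∀ i, Z i → Z (i + 1) → c i ≠ c (i + 1)) ∧
      (∀ i, Z i → Z (i + 1) → Z (i + 2) → c i = c (i + 2) → c i = 1) ∧
      (∀ i, Z i → Z (i + 1) → Z (i + 2) → Z (i + 3) → c i ≠ c (i + 3)) ∧
      (∀ i, Z i → c i = 3 → Z (i - 1) ∧ Z (i + 1)) := by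
  classical
  set a := runBelow Z with ha
  set b : ℕ → ℕ := fun i => runBelow (fun j => Z (n - j)) (n - i) with hb
  have ha1 : ∀ i, Z i → a (i + 1) = a i + 1 := fun i hi => by
    simp [ha, runBelow, hi]
  have ha0 : ∀ i, 0 < i → ¬ Z (i - 1) → a i = 0 := fun i h0 hi => by
    obtain ⟨j, rfl⟩ : ∃ j, i = j + 1 := ⟨i - 1, by omega⟩
    have : ¬ Z j := hi
    simp [ha, runBelow, this]
  have hb1 : ∀ i, Z i → Z (i + 1) → b i = b (i + 1) + 1 := fun i hi hi' => by
    have h1 := hZ _ hi'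
    have h2 : n - i = (n - (i + 1)) + 1 := by omega
    have h3 : n - (n - (i + 1)) = i + 1 := by omega
    simp only [hb, h2, runBelow, h3, hi', if_true]
  have hb0 : ∀ i, Z i → ¬ Z (i + 1) → b i = 0 := fun i hi hi' => by
    have h1 := hZ _ hi
    have h2 : n - i = (n - (i + 1)) + 1 := by omega
    have h3 : n - (n - (i + 1)) = i + 1 := by omega
    simp only [hb, h2, runBelow, h3, hi', if_false]
  -- A run has `a i + b i + 1` elements, of which `i` is the one with number `a i`. The pattern
  -- starts with `2` instead of `1` if it would otherwise end with `3`.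
  refine ⟨fun i => if (a i + b i) % 4 = 3 then
      (if a i % 4 = 0 then 2 else if a i % 4 = 2 then 3 else 1)
    else (if a i % 4 = 1 then 2 else if a i % 4 = 3 then 3 else 1), ?_, ?_, ?_, ?_, ?_⟩
  · intro i
    simp only
    split_ifs <;> simp
  · intro i h0 h1
    have := ha1 _ h0
    have := hb1 _ h0 h1
    simp only
    split_ifs <;> omega
  · intro i h0 h1 h2
    have := ha1 _ h0
    have := hb1 _ h0 h1
    have := ha1 _ h1
    have := hb1 _ h1 h2
    simp only [show i + 1 + 1 = i + 2 from rfl] at *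
    split_ifs <;> omega
  · intro i h0 h1 h2 h3
    have := ha1 _ h0
    have := hb1 _ h0 h1
    have := ha1 _ h1
    have := hb1 _ h1 h2
    have := ha1 _ h2
    have := hb1 _ h2 h3
    simp only [show i + 1 + 1 = i + 2 from rfl, show i + 2 + 1 = i + 3 from rfl] at *
    split_ifs <;> omega
  · intro i h0 h3
    have hp := hZ _ h0
    constructor
    · by_contra h
      have := ha0 i hp.1 h
      simp only [this] at h3
      split_ifs at h3 <;> omega
    · by_contra h
      have := hb0 i h0 h
      simp only [this] at h3
      split_ifs at h3 <;> omega

/-- Among the positions at which `B` holds, one can select some, no two of them consecutive, such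
that each pair of consecutive positions of `B` has a selected one; the successor of a selected
position is also in `B`. -/
theorem exists_alternating_selection (B : ℕ → Prop) (N : ℕ) :
    ∃ S : ℕ → Prop, (∀ t, S t → t < N ∧ B t ∧ B (t + 1) ∧ ¬ S (t + 1)) ∧
      ∀ t < N, B t → B (t + 1) → S t ∨ S (t + 1) := by
  let R : ℕ → Prop := fun k => Nat.rec False (fun k r => B (N - (k + 1)) ∧ B (N - k) ∧ ¬ r) k
  have hR : ∀ t < N, R (N - t) ↔ B t ∧ B (t + 1) ∧ ¬ R (N - (t + 1)) := by
    intro t ht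
    obtain ⟨k, hk⟩ : ∃ k, N - t = k + 1 := ⟨N - t - 1, by omega⟩
    have h1 : N - (k + 1) = t := by omega
    have h2 : N - k = t + 1 := by omega
    have h3 : N - (t + 1) = k := by omega
    rw [hk, h3]
    change (B (N - (k + 1)) ∧ B (N - k) ∧ ¬ R k) ↔ _
    rw [h1, h2]
  refine ⟨fun t => t < N ∧ R (N - t), ?_, ?_⟩
  · rintro t ⟨ht, h⟩
    obtain ⟨h1, h2, h3⟩ := (hR t ht).1 h
    exact ⟨ht, h1, h2, fun h4 => h3 h4.2⟩
  · intro t ht h1 h2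
    rcases Classical.em (R (N - t)) with h | h
    · exact Or.inl ⟨ht, h⟩
    · have h3 : R (N - (t + 1)) := by
        by_contra h3
        exact h ((hR t ht).2 ⟨h1, h2, h3⟩)
      refine Or.inr ⟨?_, h3⟩
      by_contra h4
      rw [show N - (t + 1) = 0 by omega] at h3
      exact h3

end OuterplanarPacking

/-! ### Laminar families of arcs -/

namespace OuterplanarPacking

/-- A noncrossing matching `M` on the points `1, …, n - 1` of a line, whose pairs `M a b` with
`a < b` are the *chords*. No chord joins consecutive points. The points stand for the vertices of
a Hamiltonian cycle of length `n` other than the vertex `0`. -/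
structure ChordDiagram (n : ℕ) (M : ℕ → ℕ → Prop) : Prop where
  three_le : 3 ≤ n
  bounds : ∀ {a b}, M a b → 0 < a ∧ a + 1 < b ∧ b < n
  matching : ∀ {a b c d}, M a b → M c d → a = c ∨ a = d ∨ b = c ∨ b = d → a = c ∧ b = d
  noncrossing : ∀ {a b c d}, M a b → M c d → a < c → c < b → d < b

/-- An arc is a chord or the root arc `(0, n)`, both of whose ends stand for the vertex `0`. The
arcs correspond to the inner faces: each arc is on top of the face just below it. -/
def IsArc (n : ℕ) (M : ℕ → ℕ → Prop) (α : ℕ × ℕ) : Prop := M α.1 α.2 ∨ α = (0, n)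

/-- The arc `γ` is strictly below the arc `α`. -/
def Inside (γ α : ℕ × ℕ) : Prop := α.1 < γ.1 ∧ γ.2 < α.2

/-- The arc `γ` is below the arc `α` or equal to it. -/
def Within (γ α : ℕ × ℕ) : Prop := α.1 ≤ γ.1 ∧ γ.2 ≤ α.2

/-- No arc is below `α`. -/
def IsLeafArc (n : ℕ) (M : ℕ → ℕ → Prop) (α : ℕ × ℕ) : Prop :=
  IsArc n M α ∧ ∀ γ, IsArc n M γ → ¬ Inside γ α

/-- At least two maximal arcs are below `α`. This is expressed by two arcs below `α` that are not
both within a third one. -/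
def IsBranchArc (n : ℕ) (M : ℕ → ℕ → Prop) (α : ℕ × ℕ) : Prop :=
  IsArc n M α ∧ ∃ γ δ, IsArc n M γ ∧ IsArc n M δ ∧ Inside γ α ∧ Inside δ α ∧ γ.2 < δ.1 ∧
    ∀ ε, IsArc n M ε → Inside ε α → ¬ (ε.1 ≤ γ.1 ∧ δ.2 ≤ ε.2)

/-- `τ` is a maximal arc below `α`. -/
def IsChildArc (n : ℕ) (M : ℕ → ℕ → Prop) (α τ : ℕ × ℕ) : Prop :=
  IsArc n M τ ∧ Inside τ α ∧ ∀ δ, IsArc n M δ → Inside δ α → ¬ Inside τ δ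

/-- A leg is a maximal chain of arcs whose members, except possibly the innermost one `β`, have
exactly one child. It is given by its outermost member `τ` and by `β`. -/
structure IsLeg (n : ℕ) (M : ℕ → ℕ → Prop) (τ β : ℕ × ℕ) : Prop where
  arc_top : IsArc n M τ
  arc_bot : IsArc n M β
  within : Within β τ
  top : τ = (0, n) ∨ ∃ α, IsBranchArc n M α ∧ IsChildArc n M α τ
  chain : ∀ δ, IsArc n M δ → Within δ τ → Within β δ ∨ Inside δ β
  bot : IsLeafArc n M β ∨ IsBranchArc n M β

theorem exists_min_span {P : ℕ × ℕ → Prop} {α : ℕ × ℕ} (h : P α) :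
    ∃ β, P β ∧ ∀ γ, P γ → β.2 - β.1 ≤ γ.2 - γ.1 := by
  obtain ⟨β, hβ, hmin⟩ := (measure fun γ : ℕ × ℕ => γ.2 - γ.1).wf.has_min {γ | P γ} ⟨α, h⟩
  exact ⟨β, hβ, fun γ hγ => not_lt.1 (hmin γ hγ)⟩

namespace ChordDiagram

variable {n : ℕ} {M : ℕ → ℕ → Prop} (hD : ChordDiagram n M)
include hD

theorem arc_bounds {α : ℕ × ℕ} (h : IsArc n M α) : α.1 + 1 < α.2 ∧ α.2 ≤ n := by
  have h3 := hD.three_le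
  rcases h with h | rfl
  · have := hD.bounds h
    omega
  · simp only
    omega

theorem laminar {α γ : ℕ × ℕ} (hα : IsArc n M α) (hγ : IsArc n M γ) :
    (α.1 = γ.1 ∧ α.2 = γ.2) ∨ Inside α γ ∨ Inside γ α ∨ α.2 < γ.1 ∨ γ.2 < α.1 := by
  unfold Inside
  rcases hα with hα | rfl <;> rcases hγ with hγ | rfl
  · have h1 := hD.bounds hα
    have h2 := hD.bounds hγ
    have h3 := hD.matching hα hγ
    have h4 := hD.noncrossing hα hγ
    have h5 := hD.noncrossing hγ hα
    omega
  · have h1 := hD.bounds hα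
    simp only
    omega
  · have h1 := hD.bounds hγ
    simp only
    omega
  · simp

/-- A branch arc that is within the top of a leg is the bottom of the leg or below it. -/
theorem IsLeg.not_isBranchArc {τ β α : ℕ × ℕ} (hl : IsLeg n M τ β) (hα : Within α τ)
    (hβ : Inside β α) : ¬ IsBranchArc n M α := by
  rintro ⟨hα', γ, δ, hγ, hδ, hγα, hδα, hγδ, hno⟩
  have b1 := hD.arc_bounds hl.arc_bot
  have b2 := hD.arc_bounds hγ
  have b3 := hD.arc_bounds hδ
  have h1 := hl.chain γ hγ
  have h2 := hl.chain δ hδ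
  have h3 := hno β hl.arc_bot hβ
  unfold Within Inside at *
  omega

theorem IsLeg.bot_unique {τ β β' : ℕ × ℕ} (h : IsLeg n M τ β) (h' : IsLeg n M τ β') : β = β' := by
  have key : ∀ {β β' : ℕ × ℕ}, IsLeg n M τ β → IsLeg n M τ β' → ¬ Inside β' β := by
    intro β β' h h' hins
    rcases h.bot with hb | hb
    · exact hb.2 _ h'.arc_bot hins
    · exact IsLeg.not_isBranchArc hD h' h.within hins hb
  rcases hD.laminar h.arc_bot h'.arc_bot with h1 | h1 | h1 | h1
  · exact Prod.ext h1.1 h1.2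
  · exact absurd h1 (key h' h)
  · exact absurd h1 (key h h')
  · have b1 := hD.arc_bounds h.arc_bot
    have b2 := hD.arc_bounds h'.arc_bot
    have := h.chain _ h'.arc_bot h'.within
    unfold Within Inside at this
    omega

theorem IsLeg.inside_bot {τ β τ' β' : ℕ × ℕ} (h : IsLeg n M τ β) (h' : IsLeg n M τ' β')
    (hins : Inside τ' τ) : Inside τ' β ∧ IsBranchArc n M β := by
  have b := hD.arc_bounds h.arc_top
  have b' := hD.arc_bounds h'.arc_top
  rcases h'.top with rfl | ⟨α, hα, hτ', hins', hmax⟩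
  · unfold Inside at hins
    simp only at hins
    omega
  have hατ : Within α τ := by
    have h1 := hD.laminar hα.1 h.arc_top
    have h2 := hmax τ h.arc_top
    unfold Within Inside at *
    omega
  have hτβ : Inside τ' β := by
    have h1 := h.chain α hα.1 hατ
    by_contra hcon
    have h2 : Inside β α := by
      have h3 := hD.laminar h.arc_bot hα.1
      have b1 := hD.arc_bounds h.arc_bot
      have b2 := hD.arc_bounds hα.1
      unfold Within Inside at *
      omega
    exact IsLeg.not_isBranchArc hD h hατ h2 hα
  exact ⟨hτβ, h.bot.resolve_left fun hb => hb.2 _ hτ' hτβ⟩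

/-- Two legs with different tops lie below different chords, or one of them lies below the bottom
of the other. -/
theorem IsLeg.trichotomy {τ β τ' β' : ℕ × ℕ} (h : IsLeg n M τ β) (h' : IsLeg n M τ' β') :
    τ = τ' ∨ (Inside τ' β ∧ IsBranchArc n M β) ∨ (Inside τ β' ∧ IsBranchArc n M β') ∨
      τ.2 < τ'.1 ∨ τ'.2 < τ.1 := by
  rcases hD.laminar h.arc_top h'.arc_top with h1 | h1 | h1 | h1 | h1
  · exact Or.inl (Prod.ext h1.1 h1.2)
  · exact Or.inr (Or.inr (Or.inl (IsLeg.inside_bot hD h' h h1)))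
  · exact Or.inr (Or.inl (IsLeg.inside_bot hD h h' h1))
  · exact Or.inr (Or.inr (Or.inr (Or.inl h1)))
  · exact Or.inr (Or.inr (Or.inr (Or.inr h1)))

theorem IsLeg.top_unique {τ β τ' : ℕ × ℕ} (h : IsLeg n M τ β) (h' : IsLeg n M τ' β) : τ = τ' := by
  have b := hD.arc_bounds h.arc_bot
  have b1 := hD.arc_bounds h.arc_top
  have b2 := hD.arc_bounds h'.arc_top
  have h1 := h.within
  have h2 := h'.within
  unfold Within at h1 h2
  rcases IsLeg.trichotomy hD h h' with h3 | ⟨h3, -⟩ | ⟨h3, -⟩ | h3 | h3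
  · exact h3
  all_goals
    try unfold Inside at h3
    omega

/-- If an arc has an arc below it and is not a branch arc, then some arc below it contains all the
others. -/
theorem exists_unique_child {β γ : ℕ × ℕ} (hβ : IsArc n M β) (hγ : IsArc n M γ)
    (hγβ : Inside γ β) (hnb : ¬ IsBranchArc n M β) :
    ∃ β', IsArc n M β' ∧ Inside β' β ∧ ∀ δ, IsArc n M δ → Inside δ β → Within δ β' := by
  obtain ⟨ε, ⟨hε, hεβ⟩, hmax⟩ : ∃ ε, (IsArc n M ε ∧ Inside ε β) ∧
      ∀ δ, (IsArc n M δ ∧ Inside δ β) → n - (ε.2 - ε.1) ≤ n - (δ.2 - δ.1) := by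
    obtain ⟨ε, hε, hmin⟩ := (measure fun γ : ℕ × ℕ => n - (γ.2 - γ.1)).wf.has_min
      {γ | IsArc n M γ ∧ Inside γ β} ⟨γ, hγ, hγβ⟩
    exact ⟨ε, hε, fun δ hδ => not_lt.1 (hmin δ hδ)⟩
  have bβ := hD.arc_bounds hβ
  have bε := hD.arc_bounds hε
  have hmax' : ∀ δ, IsArc n M δ → Inside δ β → ¬ Inside ε δ := by
    intro δ hδ hδβ hin
    have := hmax δ ⟨hδ, hδβ⟩
    have := hD.arc_bounds hδ
    unfold Inside at *
    omega
  refine ⟨ε, hε, hεβ, fun δ hδ hδβ => ?_⟩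
  by_contra hcon
  have bδ := hD.arc_bounds hδ
  have h1 := hD.laminar hε hδ
  have h2 := hmax' δ hδ hδβ
  apply hnb
  rcases (show ε.2 < δ.1 ∨ δ.2 < ε.1 by unfold Within at hcon; unfold Inside at *; omega)
    with h3 | h3
  · refine ⟨hβ, ε, δ, hε, hδ, hεβ, hδβ, h3, fun ζ hζ hζβ h4 => ?_⟩
    have h5 := hmax' ζ hζ hζβ
    have h6 := hD.laminar hζ hε
    unfold Inside at *
    omega
  · refine ⟨hβ, δ, ε, hδ, hε, hδβ, hεβ, h3, fun ζ hζ hζβ h4 => ?_⟩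
    have h5 := hmax' ζ hζ hζβ
    have h6 := hD.laminar hζ hε
    unfold Inside at *
    omega

theorem exists_parent {τ : ℕ × ℕ} (hτ : IsArc n M τ) (hne : τ ≠ (0, n)) :
    ∃ α, IsArc n M α ∧ IsChildArc n M α τ := by
  have hroot : IsArc n M (0, n) ∧ Inside τ (0, n) := by
    refine ⟨Or.inr rfl, ?_⟩
    rcases hτ with h | h
    · have := hD.bounds h
      exact ⟨this.1, this.2.2⟩
    · exact absurd h hne
  obtain ⟨α, ⟨hα, hτα⟩, hmin⟩ := exists_min_span (P := fun α => IsArc n M α ∧ Inside τ α) hroot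
  refine ⟨α, hα, hτ, hτα, fun δ hδ hδα hτδ => ?_⟩
  have h1 := hmin δ ⟨hδ, hτδ⟩
  have h2 := hD.arc_bounds hδ
  have h3 := hD.arc_bounds hα
  unfold Inside at *
  omega

/-- Each arc belongs to a leg. -/
theorem exists_isLeg {γ : ℕ × ℕ} (hγ : IsArc n M γ) :
    ∃ τ β, IsLeg n M τ β ∧ Within γ τ ∧ Within β γ := by
  have bγ := hD.arc_bounds hγ
  -- `τ` is the largest arc above `γ` such that no branch arc lies between the two.
  obtain ⟨τ, ⟨hτ, hγτ, hτb⟩, hmax⟩ : ∃ τ, (IsArc n M τ ∧ Within γ τ ∧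
      ∀ δ, Within δ τ → Inside γ δ → ¬ IsBranchArc n M δ) ∧
      ∀ τ', (IsArc n M τ' ∧ Within γ τ' ∧
      ∀ δ, Within δ τ' → Inside γ δ → ¬ IsBranchArc n M δ) →
      n - (τ.2 - τ.1) ≤ n - (τ'.2 - τ'.1) := by
    obtain ⟨ε, hε, hmin⟩ := (measure fun γ : ℕ × ℕ => n - (γ.2 - γ.1)).wf.has_min
      {τ | IsArc n M τ ∧ Within γ τ ∧ ∀ δ, Within δ τ → Inside γ δ → ¬ IsBranchArc n M δ}
      ⟨γ, hγ, ⟨le_rfl, le_rfl⟩, fun δ h1 h2 => by unfold Within Inside at *; omega⟩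
    exact ⟨ε, hε, fun δ hδ => not_lt.1 (hmin δ hδ)⟩
  have bτ := hD.arc_bounds hτ
  have htop : τ = (0, n) ∨ ∃ α, IsBranchArc n M α ∧ IsChildArc n M α τ := by
    by_cases hne : τ = (0, n)
    · exact Or.inl hne
    obtain ⟨α, hα, hch⟩ := hD.exists_parent hτ hne
    refine Or.inr ⟨α, ?_, hch⟩
    by_contra hnb
    have bα := hD.arc_bounds hα
    have h1 := hmax α ⟨hα, ?_, ?_⟩
    · have := hch.2.1
      unfold Inside at this
      omega
    · have := hch.2.1
      unfold Within Inside at *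
      omega
    · intro δ h2 h3 hb
      have bδ := hD.arc_bounds hb.1
      have h4 := hD.laminar hb.1 hτ
      have h5 := hτb δ
      have h6 := hch.2.2 δ hb.1
      have h7 := hch.2.1
      have h8 : ¬ (δ.1 = α.1 ∧ δ.2 = α.2) := fun h => hnb (Prod.ext h.1 h.2 ▸ hb)
      have h9 := hD.laminar hb.1 hα
      have h10 : ¬ Within δ τ := fun h => h5 h h3 hb
      unfold Within Inside at *
      omega
  -- `β` is the smallest arc with which all arcs within `τ` are comparable.
  obtain ⟨β, ⟨hβ, hβτ, hβc⟩, hmin⟩ := exists_min_span (α := τ)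
    (P := fun β => IsArc n M β ∧ Within β τ ∧
      ∀ δ, IsArc n M δ → Within δ τ → Within β δ ∨ Inside δ β)
    ⟨hτ, ⟨le_rfl, le_rfl⟩, fun δ hδ h => by
      have := hD.laminar hδ hτ
      have := hD.arc_bounds hδ
      unfold Within Inside at *
      omega⟩
  have bβ := hD.arc_bounds hβ
  have hbot : IsLeafArc n M β ∨ IsBranchArc n M β := by
    by_cases hleaf : IsLeafArc n M β
    · exact Or.inl hleaf
    refine Or.inr ?_
    by_contra hnb
    have : ∃ δ, IsArc n M δ ∧ Inside δ β := by
      by_contra hno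
      exact hleaf ⟨hβ, fun δ hδ h => hno ⟨δ, hδ, h⟩⟩
    obtain ⟨δ, hδ, hδβ⟩ := this
    obtain ⟨β', hβ', hβ'β, hall⟩ := hD.exists_unique_child hβ hδ hδβ hnb
    have b' := hD.arc_bounds hβ'
    have h1 := hmin β' ⟨hβ', ?_, ?_⟩
    · unfold Inside at *
      omega
    · unfold Within Inside at *
      omega
    · intro ε hε hετ
      have h2 := hβc ε hε hετ
      have h3 := hall ε hε
      have h4 := hD.laminar hε hβ'
      have bε := hD.arc_bounds hε
      unfold Within Inside at *
      omega
  refine ⟨τ, β, ⟨hτ, hβ, hβτ, htop, hβc, hbot⟩, hγτ, ?_⟩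
  rcases hβc γ hγ hγτ with h | h
  · exact h
  · rcases hbot with hb | hb
    · exact absurd h (hb.2 γ hγ)
    · exact absurd hb (hτb β hβτ h)

end ChordDiagram

end OuterplanarPacking

/-! ### Cycles with noncrossing chords -/

namespace OuterplanarPacking

open SimpleGraph

/-- `G` is the cycle `0, 1, …, n - 1` with the chords of the chord diagram `M`. -/
structure IsChordedCycle (n : ℕ) (M : ℕ → ℕ → Prop) (G : SimpleGraph (Fin n)) : Prop extends
    ChordDiagram n M where
  adj_iff : ∀ i j : Fin n, G.Adj i j ↔ i.val + 1 = j ∨ j.val + 1 = i ∨ (i.val = 0 ∧ j.val + 1 = n) ∨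
    (j.val = 0 ∧ i.val + 1 = n) ∨ M i j ∨ M j i

/-- The vertices `i` and `j` are the ends of a chord. -/
def IsPartner (M : ℕ → ℕ → Prop) {n : ℕ} (i j : Fin n) : Prop := M i j ∨ M j i

theorem IsPartner.symm {M : ℕ → ℕ → Prop} {n : ℕ} {i j : Fin n} (h : IsPartner M i j) :
    IsPartner M j i := Or.symm h

namespace IsChordedCycle

variable {n : ℕ} {M : ℕ → ℕ → Prop} {G : SimpleGraph (Fin n)} (hG : IsChordedCycle n M G)
include hG

theorem adj_of_partner {i j : Fin n} (h : IsPartner M i j) : G.Adj i j := by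
  rw [hG.adj_iff]
  rcases h with h | h
  · exact Or.inr (Or.inr (Or.inr (Or.inr (Or.inl h))))
  · exact Or.inr (Or.inr (Or.inr (Or.inr (Or.inr h))))

theorem partner_unique {i j k : Fin n} (h : IsPartner M i j) (h' : IsPartner M i k) : j = k := by
  apply Fin.ext
  rcases h with h | h <;> rcases h' with h' | h'
  · exact (hG.matching h h' (by simp)).2
  · have := hG.matching h h' (by simp)
    have := hG.bounds h
    have := hG.bounds h'
    omega
  · have := hG.matching h h' (by simp)
    have := hG.bounds h
    have := hG.bounds h'
    omega
  · exact (hG.matching h h' (by simp)).1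

theorem connected : G.Connected := by
  have h3 := hG.three_le
  have key : ∀ k (hk : k < n), G.Reachable ⟨0, by omega⟩ ⟨k, hk⟩ := by
    intro k
    induction k with
    | zero => intro _; exact Reachable.refl _
    | succ k ih =>
      intro hk
      refine (ih (by omega)).trans (Adj.reachable ?_)
      rw [hG.adj_iff]
      exact Or.inl rfl
  have : Nonempty (Fin n) := ⟨⟨0, by omega⟩⟩
  exact ⟨fun u v => (key u u.2).symm.trans (key v v.2)⟩

/-- A neighbour of a vertex strictly below an arc is below the arc or at one of its ends. -/
theorem adj_inside {α : ℕ × ℕ} (hα : IsArc n M α) {i j : Fin n} (h : G.Adj i j)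
    (hi : α.1 < i ∧ i < α.2) : (α.1 ≤ j ∧ j ≤ α.2) := by
  have hj := j.2
  rcases hα with hα | rfl
  · have bα := hG.bounds hα
    rw [hG.adj_iff] at h
    rcases h with h | h | h | h | h | h
    · omega
    · omega
    · omega
    · omega
    · have h1 := hG.noncrossing hα h
      have h2 := hG.bounds h
      omega
    · have h1 := hG.noncrossing h hα
      have h2 := hG.matching h hα
      have h3 := hG.bounds h
      omega
  · simp only
    omega

/-- An edge that enters the closed interval of an arc does so at an end of the arc. -/
theorem adj_outside {α : ℕ × ℕ} (hα : IsArc n M α) {i j : Fin n} (h : G.Adj i j)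
    (hi : ¬ (α.1 ≤ i ∧ i ≤ α.2)) (hj : α.1 ≤ j ∧ j ≤ α.2) : j = α.1 ∨ j = α.2 := by
  by_contra hcon
  exact hi (hG.adj_inside hα h.symm (by omega))

theorem partner_inside {α : ℕ × ℕ} (hα : IsArc n M α) {i j : Fin n} (h : IsPartner M i j)
    (hi : α.1 < i ∧ i < α.2) : α.1 < j ∧ j < α.2 := by
  have h1 := hG.adj_inside hα (hG.adj_of_partner h) hi
  have hj := j.2
  rcases hα with hα | rfl
  · rcases h with h | h
    · have := hG.matching h hα
      omega
    · have := hG.matching h hα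
      omega
  · rcases h with h | h
    · have := hG.bounds h
      simp only at *
      omega
    · have := hG.bounds h
      simp only at *
      omega

/-- Let `W` be a set of vertices outside which there are no chords, such that each vertex of `W`
has at most one neighbour outside `W`. Then the vertices outside `W` can be coloured with
`1, 2, 3` so that the only conflicts are between vertices of colour `3` that are joined, by two
chords, to adjacent vertices of `W`. -/
theorem exists_three_coloring {W : Set (Fin n)} (h0 : ∀ i : Fin n, i.val = 0 → i ∈ W)
    (hW : ∀ w ∈ W, ∀ z z', z ∉ W → z' ∉ W → G.Adj w z → G.Adj w z' → z = z')
    (hM : ∀ z z', z ∉ W → z' ∉ W → ¬ IsPartner M z z') :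
    ∃ c : Fin n → ℕ, (∀ z, c z = 1 ∨ c z = 2 ∨ c z = 3) ∧
      ∀ z z', z ∉ W → z' ∉ W → z ≠ z' → c z = c z' → c z < G.dist z z' ∨
        (c z = 3 ∧ 2 < G.dist z z' ∧
          ∃ w ∈ W, ∃ w' ∈ W, G.Adj w w' ∧ IsPartner M w z ∧ IsPartner M w' z') := by
  have hc := hG.connected
  obtain ⟨c, c1, c2, c3, c4, c5⟩ := exists_run_coloring (Z := fun i => ∃ h : i < n, ⟨i, h⟩ ∉ W)
    (n := n) (by
      rintro i ⟨h, hi⟩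
      refine ⟨?_, h⟩
      by_contra h'
      exact hi (h0 _ (by simp only; omega)))
  have hz : ∀ z : Fin n, z ∉ W → ∃ h : z.val < n, (⟨z.val, h⟩ : Fin n) ∉ W := fun z h => ⟨z.2, h⟩
  have hz' : ∀ (z : Fin n) (i : ℕ), z ∉ W → z.val = i → ∃ h : i < n, (⟨i, h⟩ : Fin n) ∉ W := by
    rintro z i h rfl
    exact ⟨z.2, h⟩
  have hadj : ∀ z z', z ∉ W → z' ∉ W → G.Adj z z' → z.val + 1 = z' ∨ z'.val + 1 = z := by
    intro z z' h h' ha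
    rw [hG.adj_iff] at ha
    have h1 : z.val ≠ 0 := fun h1 => h (h0 _ h1)
    have h2 : z'.val ≠ 0 := fun h2 => h' (h0 _ h2)
    have h3 := hM z z' h h'
    unfold IsPartner at h3
    tauto
  have hnadj : ∀ z z', z ∉ W → z' ∉ W → c z = c z' → ¬ G.Adj z z' := by
    intro z z' h h' he ha
    rcases hadj z z' h h' ha with h1 | h1
    · exact c2 z (hz z h) (hz' z' _ h' h1.symm) (by rw [h1, he])
    · exact c2 z' (hz z' h') (hz' z _ h h1.symm) (by rw [h1, he])
  have hnpath : ∀ z z', z ∉ W → z' ∉ W → z ≠ z' → c z = c z' → c z ≠ 1 →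
      ∀ a, ¬ (G.Adj z a ∧ G.Adj a z') := by
    rintro z z' h h' hne he h1 a ⟨ha, ha'⟩
    by_cases haW : a ∈ W
    · exact hne (hW a haW z z' h h' ha.symm ha')
    · have hv : z.val ≠ z'.val := fun hv => hne (Fin.ext hv)
      rcases hadj z a h haW ha with h2 | h2 <;> rcases hadj a z' haW h' ha' with h3 | h3
      · exact h1 (c3 z (hz z h) (hz' a _ haW (by omega)) (hz' z' _ h' (by omega))
          (by rw [he]; congr 1; omega))
      · omega
      · omega
      · exact h1 (he ▸ c3 z' (hz z' h') (hz' a _ haW (by omega)) (hz' z _ h (by omega))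
          (by rw [← he]; congr 1; omega))
  have hthree : ∀ z a, z ∉ W → a ∈ W → c z = 3 → G.Adj z a → IsPartner M a z := by
    intro z a h haW h3 ha
    obtain ⟨⟨h4, h5⟩, h6, h7⟩ := c5 z (hz z h) h3
    rw [hG.adj_iff] at ha
    have h1 : z.val ≠ 0 := fun h1 => h (h0 _ h1)
    rcases ha with ha | ha | ha | ha | ha | ha
    · exact absurd haW (by convert h7; exact ha.symm)
    · exact absurd haW (by convert h5; omega)
    · omega
    · omega
    · exact Or.inr ha
    · exact Or.inl ha
  refine ⟨fun z => c z, fun z => c1 z, fun z z' h h' hne he => ?_⟩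
  change c z.val = c z'.val at he
  by_contra hcon
  push Not at hcon
  obtain ⟨hle, hcon⟩ := hcon
  rcases c1 z with h1 | h1 | h1
  · rw [h1] at hle
    rcases (show G.dist z z' = 0 ∨ G.dist z z' = 1 by omega) with h2 | h2
    · exact hne (hc.dist_eq_zero_iff.1 h2)
    · exact hnadj z z' h h' he (dist_eq_one_iff_adj.1 h2)
  · rcases adj_or_of_dist_le_two hc hne (by omega) with h2 | ⟨a, h2⟩
    · exact hnadj z z' h h' he h2
    · exact hnpath z z' h h' hne he (by omega) a h2
  · have hgt : 2 < G.dist z z' := by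
      by_contra hle
      rcases adj_or_of_dist_le_two hc hne (by omega) with h2 | ⟨a, h2⟩
      · exact hnadj z z' h h' he h2
      · exact hnpath z z' h h' hne he (by omega) a h2
    rcases adj_or_of_dist_le_three hc hne (by omega) with h2 | ⟨a, h2⟩ | ⟨a, b, ha, hab, hb⟩
    · exact hnadj z z' h h' he h2
    · exact hnpath z z' h h' hne he (by omega) a h2
    have hzb : z ≠ b := by
      rintro rfl
      exact hnadj _ _ h h' he hb
    have hza : z' ≠ a := by
      rintro rfl
      exact hnadj _ _ h h' he ha
    by_cases haW : a ∈ W <;> by_cases hbW : b ∈ W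
    · exact hcon h1 hgt a haW b hbW hab (hthree z a h haW h1 ha)
        (hthree z' b h' hbW (he ▸ h1) hb.symm)
    · exact hzb (hW a haW z b h hbW ha.symm hab)
    · exact hza (hW b hbW z' a h' haW hb hab.symm)
    · have hv : z.val ≠ b.val := fun hv => hzb (Fin.ext hv)
      have hv' : z'.val ≠ a.val := fun hv => hza (Fin.ext hv)
      rcases hadj z a h haW ha with h2 | h2 <;> rcases hadj a b haW hbW hab with h3 | h3 <;>
        rcases hadj b z' hbW h' hb with h4 | h4
      · exact c4 z (hz z h) (hz' a _ haW (by omega)) (hz' b _ hbW (by omega))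
          (hz' z' _ h' (by omega)) (by rw [he]; congr 1; omega)
      · omega
      · omega
      · omega
      · omega
      · omega
      · omega
      · exact c4 z' (hz z' h') (hz' b _ hbW (by omega)) (hz' a _ haW (by omega))
          (hz' z _ h (by omega)) (by rw [← he]; congr 1; omega)

end IsChordedCycle

end OuterplanarPacking

/-! ### The levels around a face -/

namespace OuterplanarPacking

open SimpleGraph

/-- The point `v` is on the boundary of the inner face below the arc `β`. -/
def OnFace (n : ℕ) (M : ℕ → ℕ → Prop) (β : ℕ × ℕ) (v : ℕ) : Prop :=
  β.1 ≤ v ∧ v ≤ β.2 ∧ ∀ γ, IsArc n M γ → Inside γ β → ¬ (γ.1 < v ∧ v < γ.2)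

open Classical in
/-- The position of `v` along the boundary of the face below `β`, from the left end of `β`. A point
strictly below a child of `β` has the position of the left end of this child. -/
noncomputable def facePos (n : ℕ) (M : ℕ → ℕ → Prop) (β : ℕ × ℕ) (v : ℕ) : ℕ :=
  ((Finset.Ioc β.1 v).filter (OnFace n M β)).card

/-- The common level of the points strictly below a child of an arc, where `i` and `i + 1` are the
positions of the ends of the child and `k` is the largest position. The levels of these two
ends differ from it by at most one; different children have different such levels, which are even
on the left half of the face and odd on the right half. -/
def gapLevel (k i : ℕ) : ℤ :=
  if 2 * i + 1 ≤ k then 2 * ((i + 1) / 2) else 2 * (((k : ℤ) - i - 1) / 2) + 1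

theorem gapLevel_ne {k i j : ℕ} (hij : i + 2 ≤ j) :
    gapLevel k i ≠ gapLevel k j := by
  unfold gapLevel
  split_ifs <;> omega

open Classical in
/-- The level of a point weakly below `β`: on the face, the distance to the ends of `β` along the
boundary of the face. -/
noncomputable def innerLevel (n : ℕ) (M : ℕ → ℕ → Prop) (β : ℕ × ℕ) (v : ℕ) : ℤ :=
  if OnFace n M β v then
    min (facePos n M β v : ℤ) (facePos n M β β.2 - facePos n M β v)
  else gapLevel (facePos n M β β.2) (facePos n M β v)

/-- The vertices at the ends of an arc; the root arc has the single end `0`. -/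
def arcEnds {n : ℕ} (β : ℕ × ℕ) : Set (Fin n) := {v | v.val = β.1 ∨ v.val = β.2}

open Classical in
/-- A `1`-Lipschitz level function on the vertices that is nonnegative weakly below `β` and
negative elsewhere. -/
noncomputable def faceLevel {n : ℕ} (M : ℕ → ℕ → Prop) (G : SimpleGraph (Fin n)) (β : ℕ × ℕ)
    (v : Fin n) : ℤ :=
  if β.1 ≤ v.val ∧ v.val ≤ β.2 then innerLevel n M β v else - (G.setDist (arcEnds β) v : ℤ)

section FacePos

variable {n : ℕ} {M : ℕ → ℕ → Prop} {β : ℕ × ℕ}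

theorem facePos_left : facePos n M β β.1 = 0 := by
  simp [facePos]

theorem facePos_succ_of_onFace {v : ℕ} (hv : β.1 ≤ v) (h : OnFace n M β (v + 1)) :
    facePos n M β (v + 1) = facePos n M β v + 1 := by
  classical
  unfold facePos
  have h1 : Finset.Ioc β.1 (v + 1) = insert (v + 1) (Finset.Ioc β.1 v) := by
    ext x; simp only [Finset.mem_Ioc, Finset.mem_insert]; omega
  rw [h1, Finset.filter_insert, if_pos h, Finset.card_insert_of_notMem (by simp)]

theorem facePos_succ_of_not_onFace {v : ℕ} (hv : β.1 ≤ v) (h : ¬ OnFace n M β (v + 1)) :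
    facePos n M β (v + 1) = facePos n M β v := by
  classical
  unfold facePos
  have h1 : Finset.Ioc β.1 (v + 1) = insert (v + 1) (Finset.Ioc β.1 v) := by
    ext x; simp only [Finset.mem_Ioc, Finset.mem_insert]; omega
  rw [h1, Finset.filter_insert, if_neg h]

theorem facePos_mono {v w : ℕ} (h : v ≤ w) : facePos n M β v ≤ facePos n M β w := by
  classical
  exact Finset.card_le_card
    (Finset.filter_subset_filter _ (Finset.Ioc_subset_Ioc_right h))

theorem facePos_lt {v w : ℕ} (hv : β.1 ≤ v) (h : v < w) (hw : OnFace n M β w) :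
    facePos n M β v < facePos n M β w := by
  obtain ⟨w, rfl⟩ : ∃ w', w = w' + 1 := ⟨w - 1, by omega⟩
  rw [facePos_succ_of_onFace (by omega) hw]
  have := facePos_mono (n := n) (M := M) (β := β) (show v ≤ w by omega)
  omega

theorem facePos_of_below_child {τ : ℕ × ℕ} (hτ : IsArc n M τ) (hin : Inside τ β) {v : ℕ}
    (h1 : τ.1 ≤ v) (h2 : v < τ.2) : facePos n M β v = facePos n M β τ.1 := by
  induction v, h1 using Nat.le_induction with
  | base => rfl
  | succ v hv ih =>
    have := hin.1
    rw [facePos_succ_of_not_onFace (by omega), ih (by omega)]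
    exact fun h => h.2.2 τ hτ hin (by omega)

theorem innerLevel_of_below_child {β τ : ℕ × ℕ} (h : IsChildArc n M β τ) {v : ℕ} (h1 : τ.1 < v)
    (h2 : v < τ.2) :
    innerLevel n M β v = gapLevel (facePos n M β β.2) (facePos n M β τ.1) := by
  unfold innerLevel
  rw [if_neg fun hv => hv.2.2 τ h.1 h.2.1 ⟨h1, h2⟩,
    facePos_of_below_child h.1 h.2.1 h1.le h2]

end FacePos

namespace ChordDiagram

variable {n : ℕ} {M : ℕ → ℕ → Prop} (hD : ChordDiagram n M)
include hD

theorem onFace_left {β : ℕ × ℕ} (hβ : IsArc n M β) : OnFace n M β β.1 := by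
  have := hD.arc_bounds hβ
  refine ⟨by omega, by omega, fun γ _ hγ h => ?_⟩
  have := hγ.1
  omega

theorem onFace_right {β : ℕ × ℕ} (hβ : IsArc n M β) : OnFace n M β β.2 := by
  have := hD.arc_bounds hβ
  refine ⟨by omega, by omega, fun γ _ hγ h => ?_⟩
  have := hγ.2
  omega

theorem IsChildArc.onFace_left {β τ : ℕ × ℕ} (h : IsChildArc n M β τ) : OnFace n M β τ.1 := by
  obtain ⟨hτ, hin, hmax⟩ := h
  have b := hD.arc_bounds hτ
  refine ⟨by have := hin.1; omega, by have := hin.2; omega, fun γ hγ hγβ h => ?_⟩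
  have h1 := hmax γ hγ hγβ
  have h2 := hD.laminar hτ hγ
  unfold Inside at *
  omega

theorem IsChildArc.onFace_right {β τ : ℕ × ℕ} (h : IsChildArc n M β τ) : OnFace n M β τ.2 := by
  obtain ⟨hτ, hin, hmax⟩ := h
  have b := hD.arc_bounds hτ
  refine ⟨by have := hin.1; omega, by have := hin.2; omega, fun γ hγ hγβ h => ?_⟩
  have h1 := hmax γ hγ hγβ
  have h2 := hD.laminar hτ hγ
  unfold Inside at *
  omega

theorem IsChildArc.facePos_right {β τ : ℕ × ℕ} (h : IsChildArc n M β τ) :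
    facePos n M β τ.2 = facePos n M β τ.1 + 1 := by
  have h1 := IsChildArc.onFace_right hD h
  obtain ⟨hτ, hin, hmax⟩ := h
  have b := hD.arc_bounds hτ
  have h2 := facePos_of_below_child hτ hin (v := τ.2 - 1) (by omega) (by omega)
  obtain ⟨w, hw⟩ : ∃ w, τ.2 = w + 1 := ⟨τ.2 - 1, by omega⟩
  have := hin.1
  rw [hw] at h1 h2 ⊢
  rw [facePos_succ_of_onFace (by omega) h1, ← h2, Nat.add_sub_cancel]

theorem exists_isChildArc {β γ : ℕ × ℕ} (hγ : IsArc n M γ) (hin : Inside γ β) :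
    ∃ τ, IsChildArc n M β τ ∧ Within γ τ := by
  obtain ⟨τ, ⟨hτ, hτβ, hγτ⟩, hmax⟩ := (measure fun γ : ℕ × ℕ => n - (γ.2 - γ.1)).wf.has_min
      {τ | IsArc n M τ ∧ Inside τ β ∧ Within γ τ} ⟨γ, hγ, hin, le_rfl, le_rfl⟩
  refine ⟨τ, ⟨hτ, hτβ, fun δ hδ hδβ hτδ => hmax δ ⟨hδ, hδβ, ?_⟩ ?_⟩, hγτ⟩
  · unfold Within Inside at *
    omega
  · have := hD.arc_bounds hδ
    have := hD.arc_bounds hτ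
    change n - (δ.2 - δ.1) < n - (τ.2 - τ.1)
    unfold Inside at *
    omega

/-- A point weakly below `β` that is not on the face below `β` is strictly below a child. -/
theorem exists_isChildArc_of_not_onFace {β : ℕ × ℕ} {v : ℕ} (h1 : β.1 ≤ v) (h2 : v ≤ β.2)
    (hv : ¬ OnFace n M β v) : ∃ τ, IsChildArc n M β τ ∧ τ.1 < v ∧ v < τ.2 := by
  unfold OnFace at hv
  push Not at hv
  obtain ⟨γ, hγ, hγβ, h3, h4⟩ := hv h1 h2
  obtain ⟨τ, hτ, hγτ⟩ := hD.exists_isChildArc hγ hγβ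
  unfold Within at hγτ
  exact ⟨τ, hτ, by omega, by omega⟩

theorem IsChildArc.facePos_succ_le {β τ : ℕ × ℕ} (h : IsChildArc n M β τ) :
    facePos n M β τ.1 + 1 ≤ facePos n M β β.2 := by
  rw [← IsChildArc.facePos_right hD h]
  exact facePos_mono h.2.1.2.le

theorem innerLevel_succ {β : ℕ × ℕ} {v : ℕ} (h1 : β.1 ≤ v) (h2 : v + 1 ≤ β.2) :
    innerLevel n M β v ≤ innerLevel n M β (v + 1) + 1 ∧
      innerLevel n M β (v + 1) ≤ innerLevel n M β v + 1 := by
  have hmono := facePos_mono (n := n) (M := M) (β := β) h2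
  by_cases hv : OnFace n M β v <;> by_cases hv' : OnFace n M β (v + 1)
  · have := facePos_succ_of_onFace h1 hv'
    unfold innerLevel
    rw [if_pos hv, if_pos hv']
    omega
  · obtain ⟨τ, hτ, h3, h4⟩ := hD.exists_isChildArc_of_not_onFace (by omega) h2 hv'
    have h5 : τ.1 = v := by
      have := hv.2.2 τ hτ.1 hτ.2.1
      omega
    rw [innerLevel_of_below_child hτ h3 h4, h5]
    have h6 := IsChildArc.facePos_succ_le hD hτ
    rw [h5] at h6
    unfold innerLevel gapLevel
    rw [if_pos hv]
    split_ifs <;> omega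
  · obtain ⟨τ, hτ, h3, h4⟩ := hD.exists_isChildArc_of_not_onFace h1 (by omega) hv
    have h5 : τ.2 = v + 1 := by
      have := hv'.2.2 τ hτ.1 hτ.2.1
      omega
    rw [innerLevel_of_below_child hτ h3 h4]
    have h6 := IsChildArc.facePos_succ_le hD hτ
    have h7 := IsChildArc.facePos_right hD hτ
    rw [h5] at h7
    unfold innerLevel gapLevel
    rw [if_pos hv']
    split_ifs <;> omega
  · have := facePos_succ_of_not_onFace h1 hv'
    unfold innerLevel
    rw [if_neg hv, if_neg hv', this]
    omega

theorem innerLevel_left {β : ℕ × ℕ} (hβ : IsArc n M β) : innerLevel n M β β.1 = 0 := by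
  unfold innerLevel
  rw [if_pos (hD.onFace_left hβ), facePos_left]
  omega

theorem innerLevel_right {β : ℕ × ℕ} (hβ : IsArc n M β) : innerLevel n M β β.2 = 0 := by
  unfold innerLevel
  rw [if_pos (hD.onFace_right hβ)]
  omega

theorem innerLevel_chord {β : ℕ × ℕ} (hβ : IsArc n M β) {a b : ℕ} (hab : M a b) (h1 : β.1 ≤ a)
    (h2 : b ≤ β.2) :
    innerLevel n M β a ≤ innerLevel n M β b + 1 ∧
      innerLevel n M β b ≤ innerLevel n M β a + 1 := by
  have hab' : IsArc n M (a, b) := Or.inl hab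
  have ba := hD.bounds hab
  rcases hD.laminar hab' hβ with h | h | h | h | h
  · simp only at h
    rw [h.1, h.2, hD.innerLevel_left hβ, hD.innerLevel_right hβ]
    omega
  · by_cases ha : OnFace n M β a
    · have hch : IsChildArc n M β (a, b) :=
        ⟨hab', h, fun δ hδ hδβ hin => ha.2.2 δ hδ hδβ (by
          unfold Inside at hin
          simp only at hin
          omega)⟩
      have h3 := IsChildArc.facePos_right hD hch
      have h4 := IsChildArc.facePos_succ_le hD hch
      have h5 := IsChildArc.onFace_right hD hch
      simp only at h3 h4 h5
      unfold innerLevel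
      rw [if_pos ha, if_pos h5]
      omega
    · obtain ⟨τ, hτ, h3, h4⟩ := hD.exists_isChildArc_of_not_onFace h1 (by omega) ha
      have h5 : τ.1 < b ∧ b < τ.2 := by
        have := hD.laminar hab' hτ.1
        unfold Inside at this
        simp only at this
        omega
      rw [innerLevel_of_below_child hτ h3 h4, innerLevel_of_below_child hτ h5.1 h5.2]
      omega
  all_goals
    try unfold Inside at h
    simp only at h
    omega

end ChordDiagram

namespace IsChordedCycle

variable {n : ℕ} {M : ℕ → ℕ → Prop} {G : SimpleGraph (Fin n)} (hG : IsChordedCycle n M G)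
include hG

theorem arcEnds_nonempty {β : ℕ × ℕ} (hβ : IsArc n M β) : (arcEnds β : Set (Fin n)).Nonempty := by
  have := hG.arc_bounds hβ
  exact ⟨⟨β.1, by omega⟩, Or.inl rfl⟩

theorem faceLevel_le_succ {β : ℕ × ℕ} (hβ : M β.1 β.2) {x y : Fin n} (h : G.Adj x y) :
    faceLevel M G β x ≤ faceLevel M G β y + 1 := by
  have hβ' : IsArc n M β := Or.inl hβ
  have b := hG.bounds hβ
  have hne := hG.arcEnds_nonempty hβ'
  unfold faceLevel
  have hend : ∀ z : Fin n, z.val = β.1 ∨ z.val = β.2 → innerLevel n M β z = 0 := by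
    rintro z (hz | hz)
    · rw [hz, hG.innerLevel_left hβ']
    · rw [hz, hG.innerLevel_right hβ']
  split_ifs with hx hy hy
  · rcases (hG.adj_iff x y).1 h with h1 | h1 | h1 | h1 | h1 | h1
    · have := hG.innerLevel_succ (β := β) (v := x) (by omega) (by omega)
      rw [h1] at this
      exact this.1
    · have := hG.innerLevel_succ (β := β) (v := y) (by omega) (by omega)
      rw [h1] at this
      exact this.2
    · omega
    · omega
    · exact (hG.innerLevel_chord hβ' h1 hx.1 hy.2).1
    · exact (hG.innerLevel_chord hβ' h1 hy.1 hx.2).2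
  · have h1 := hG.adj_outside hβ' h.symm hy hx
    rw [hend x h1]
    have h2 := setDist_le_succ hG.connected hne h
    rw [setDist_of_mem (show x ∈ arcEnds β from h1)] at h2
    omega
  · have h1 := hG.adj_outside hβ' h hx hy
    rw [hend y h1]
    omega
  · have := setDist_le_succ hG.connected hne h
    omega

theorem faceLevel_sub_le_dist {β : ℕ × ℕ} (hβ : M β.1 β.2) (x y : Fin n) :
    faceLevel M G β x - faceLevel M G β y ≤ G.dist x y :=
  sub_le_dist_of_adj hG.connected (fun _ _ h => hG.faceLevel_le_succ hβ h) x y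

end IsChordedCycle

end OuterplanarPacking

/-! ### Geodesics along the legs -/

namespace OuterplanarPacking

open SimpleGraph

open Classical in
/-- The set of vertices at which the geodesic of a leg with bottom `β` ends: the ends of `β` if `β`
is a branch arc, and otherwise a vertex of degree two on the face below `β`. -/
def legTarget (n : ℕ) (M : ℕ → ℕ → Prop) (β : ℕ × ℕ) : Set (Fin n) :=
  if IsBranchArc n M β then arcEnds β else {v | v.val = β.1 + 1}

/-- A vertex `v` that may receive the colour meant for the vertex `p t` of a geodesic of length `L`
from `S` to `T`: either `p t` itself, or a vertex at distance at least `t` from `S` and exactly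
`L - t + 1` from `T`. -/
def IsPlace {V : Type*} (G : SimpleGraph V) (S T : Set V) (L : ℕ) (p : ℕ → V) (t : ℕ) (v : V) :
    Prop :=
  v = p t ∨ (t ≤ G.setDist S v ∧ G.setDist T v = L - t + 1)

theorem IsPlace.sub_le_dist {V : Type*} {G : SimpleGraph V} (hc : G.Connected)
    {m : V → V → Prop} {S T : Set V} (hS : S.Nonempty) (hT : T.Nonempty) {L : ℕ} {p : ℕ → V}
    (hp : G.IsPreferredGeodesic m S T L p) {s t : ℕ} {v w : V} (ht : t ≤ L) (hst : s < t)
    (hv : IsPlace G S T L p s v) (hw : IsPlace G S T L p t w) : t - s ≤ G.dist v w := by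
  rcases hv with rfl | ⟨-, hv⟩
  · have h1 := hp.setDist_left s (by omega)
    have h2 := setDist_le_add_dist hc hS w (p s)
    rcases hw with rfl | ⟨hw, -⟩
    · have := hp.setDist_left t ht
      omega
    · omega
  · have h2 := setDist_le_add_dist hc hT v w
    rw [dist_comm] at h2
    rcases hw with rfl | ⟨-, hw⟩
    · have := hp.setDist_right t ht
      omega
    · omega

namespace IsChordedCycle

variable {n : ℕ} {M : ℕ → ℕ → Prop} {G : SimpleGraph (Fin n)} (hG : IsChordedCycle n M G)
include hG

theorem legTarget_nonempty {β : ℕ × ℕ} (hβ : IsArc n M β) : (legTarget n M β).Nonempty := by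
  unfold legTarget
  split_ifs
  · exact hG.arcEnds_nonempty hβ
  · have := hG.arc_bounds hβ
    exact ⟨⟨β.1 + 1, by omega⟩, rfl⟩

theorem legTarget_within {β : ℕ × ℕ} (hβ : IsArc n M β) {v : Fin n} (hv : v ∈ legTarget n M β) :
    β.1 ≤ v ∧ v ≤ β.2 := by
  have b := hG.arc_bounds hβ
  unfold legTarget at hv
  split_ifs at hv
  · rcases hv with hv | hv <;> omega
  · change v.val = β.1 + 1 at hv
    omega

theorem exists_leg_geodesic {τ β : ℕ × ℕ} (h : IsLeg n M τ β) :
    ∃ L p, G.IsPreferredGeodesic (IsPartner M) (arcEnds τ) (legTarget n M β) L p :=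
  exists_isPreferredGeodesic hG.connected (fun _ _ => hG.adj_of_partner)
    (fun _ _ _ => hG.partner_unique) (hG.arcEnds_nonempty h.arc_top)
    (hG.legTarget_nonempty h.arc_bot)

theorem exists_arc_of_partner {i j : Fin n} (h : IsPartner M i j) :
    ∃ γ : ℕ × ℕ, IsArc n M γ ∧ 0 < γ.1 ∧ γ.2 < n ∧
      ((i.val = γ.1 ∧ j.val = γ.2) ∨ (j.val = γ.1 ∧ i.val = γ.2)) := by
  rcases h with h | h
  · have := hG.bounds h
    exact ⟨(i, j), Or.inl h, by omega, by omega, Or.inl ⟨rfl, rfl⟩⟩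
  · have := hG.bounds h
    exact ⟨(j, i), Or.inl h, by omega, by omega, Or.inr ⟨rfl, rfl⟩⟩

theorem partner_outside {α : ℕ × ℕ} (hα : IsArc n M α) {i j : Fin n} (h : IsPartner M i j)
    (hi : ¬ (α.1 ≤ i ∧ i ≤ α.2)) : ¬ (α.1 ≤ j ∧ j ≤ α.2) := by
  intro hj
  obtain ⟨γ, hγ, h1, h2, h3⟩ := hG.exists_arc_of_partner h
  have h4 := hG.laminar hα hγ
  have h5 := hG.arc_bounds hα
  have h6 := hG.arc_bounds hγ
  unfold Inside at h4
  omega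

section Leg

variable {τ β : ℕ × ℕ} {L : ℕ} {p : ℕ → Fin n} (hl : IsLeg n M τ β)
  (hp : G.IsPreferredGeodesic (IsPartner M) (arcEnds τ) (legTarget n M β) L p)
include hl hp

theorem path_inside {t : ℕ} (h1 : 1 ≤ t) (ht : t ≤ L) : τ.1 < p t ∧ p t < τ.2 := by
  have key : ∀ k, k < L → τ.1 < p (L - k) ∧ p (L - k) < τ.2 := by
    intro k
    induction k with
    | zero =>
      intro hk
      have h2 : ¬ ((p L).val = τ.1 ∨ (p L).val = τ.2) := hp.notMem_left (by omega) le_rfl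
      have h3 := hG.legTarget_within hl.arc_bot hp.last_mem
      have h4 := hl.within
      unfold Within at h4
      rw [Nat.sub_zero]
      omega
    | succ k ih =>
      intro hk
      have h2 : ¬ ((p (L - (k + 1))).val = τ.1 ∨ (p (L - (k + 1))).val = τ.2) :=
        hp.notMem_left (by omega) (by omega)
      have h3 := hp.adj (L - (k + 1)) (by omega)
      rw [show L - (k + 1) + 1 = L - k by omega] at h3
      have h4 := hG.adj_inside hl.arc_top h3.symm (ih (by omega))
      omega
  have := key (L - t) (by omega)
  rwa [show L - (L - t) = t by omega] at this

theorem path_outside (hb : IsBranchArc n M β) {t : ℕ} (ht : t < L) :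
    ¬ (β.1 ≤ p t ∧ p t ≤ β.2) := by
  have hnot : ∀ s < L, ¬ ((p s).val = β.1 ∨ (p s).val = β.2) := by
    intro s hs h
    have h1 : p s ∈ legTarget n M β := by
      unfold legTarget
      rw [if_pos hb]
      exact h
    have h2 := setDist_of_mem (G := G) h1
    rw [hp.setDist_right s hs.le] at h2
    omega
  have b := hG.arc_bounds hl.arc_bot
  induction t with
  | zero =>
    have h1 := hnot 0 ht
    have h2 := hp.zero_mem
    have h3 := hl.within
    unfold Within at h3
    rcases h2 with h2 | h2 <;> omega
  | succ t ih =>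
    intro hcon
    exact hnot (t + 1) ht (hG.adj_outside hl.arc_bot (hp.adj t (by omega)) (ih (by omega)) hcon)

/-- The geodesic of a leg meets each chord of the leg. -/
theorem exists_path_mem_ends {γ : ℕ × ℕ} (hγ : IsArc n M γ) (h1 : Within γ τ) (h2 : Within β γ) :
    ∃ t ≤ L, (p t).val = γ.1 ∨ (p t).val = γ.2 := by
  classical
  have hex : ∃ t, t ≤ L ∧ γ.1 ≤ p t ∧ p t ≤ γ.2 := by
    have h3 := hG.legTarget_within hl.arc_bot hp.last_mem
    unfold Within at h2
    exact ⟨L, le_rfl, by omega, by omega⟩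
  obtain ⟨h3, h4⟩ := Nat.find_spec hex
  refine ⟨_, h3, ?_⟩
  rcases ht : Nat.find hex with _ | t
  · rw [ht] at h4
    have h5 := hp.zero_mem
    have := (p 0).2
    unfold Within at h1
    rcases h5 with h5 | h5 <;> omega
  · rw [ht] at h3 h4
    have h5 : ¬ (γ.1 ≤ p t ∧ p t ≤ γ.2) := fun h =>
      Nat.find_min hex (m := t) (by omega) ⟨by omega, h⟩
    exact hG.adj_outside hγ (hp.adj t (by omega)) h5 h4

/-- Let `w` and `w'` be consecutive vertices on the geodesic of a leg that are joined by chords to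
the vertices `z` and `z'` off the geodesic. If `z` and `z'` are at distance at least three, then `z`
is farther from the target of the geodesic than `w`, because the chord `w' z'` separates the two
from the target. -/
theorem isPlace_partner {t : ℕ} (h1 : 1 ≤ t) (ht : t + 1 ≤ L)
    (hb : IsBranchArc n M β → t + 1 < L) {z z' : Fin n}
    (hz : IsPartner M (p t) z) (hz' : IsPartner M (p (t + 1)) z') (hzp : ∀ s ≤ L, p s ≠ z)
    (hzp' : ∀ s ≤ L, p s ≠ z') (hna : ¬ G.Adj (p (t + 1)) z) (hd : 2 < G.dist z z') :
    IsPlace G (arcEnds τ) (legTarget n M β) L p t z := by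
  have hc := hG.connected
  have hS := hG.arcEnds_nonempty hl.arc_top
  have hT := hG.legTarget_nonempty hl.arc_bot
  have hadj := hG.adj_of_partner hz
  have hgp := hp.setDist_right t (by omega)
  refine Or.inr ⟨?_, ?_⟩
  · have h2 := setDist_le_succ hc hS hadj.symm
    rw [hp.setDist_left t (by omega)] at h2
    by_contra hlt
    obtain ⟨s, rfl⟩ : ∃ s, t = s + 1 := ⟨t - 1, by omega⟩
    exact hzp s (by omega) (hp.preferred s (by omega) z hz (by omega))
  obtain ⟨γ, hγ, -, -, hγe⟩ := hG.exists_arc_of_partner hz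
  obtain ⟨δ, hδ, -, -, hδe⟩ := hG.exists_arc_of_partner hz'
  have bγ := hG.arc_bounds hγ
  have bδ := hG.arc_bounds hδ
  have bβ := hG.arc_bounds hl.arc_bot
  have hwin := hG.path_inside hl hp h1 (by omega)
  have hwin' := hG.path_inside hl hp (t := t + 1) (by omega) ht
  have hzin := hG.partner_inside hl.arc_top hz hwin
  have hzin' := hG.partner_inside hl.arc_top hz' hwin'
  have hβγ : Within β γ := by
    refine (hl.chain γ hγ (by unfold Within; omega)).resolve_right fun hin => ?_
    rcases hl.bot with hb' | hb'
    · exact hb'.2 γ hγ hin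
    · have := hG.path_outside hl hp hb' (t := t) (by omega)
      unfold Inside at hin
      omega
  have hβδ : Within β δ := by
    refine (hl.chain δ hδ (by unfold Within; omega)).resolve_right fun hin => ?_
    rcases hl.bot with hb' | hb'
    · exact hb'.2 δ hδ hin
    · have := hG.path_outside hl hp hb' (t := t + 1) (hb hb')
      unfold Inside at hin
      omega
  -- Up to `p t`, the geodesic stays outside the chord at `p (t + 1)`.
  have hout : ∀ s ≤ t, ¬ (δ.1 ≤ p s ∧ p s ≤ δ.2) := by
    have hne : ∀ s ≤ t, ¬ ((p s).val = δ.1 ∨ (p s).val = δ.2) := by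
      intro s hs h
      have h2 := hp.ne (s := s) (t := t + 1) (by omega) ht (by omega)
      have h3 := hzp' s (by omega)
      rw [ne_eq, Fin.ext_iff] at h2 h3
      omega
    intro s
    induction s with
    | zero =>
      intro hs
      have h2 := hne 0 hs
      have h3 := hp.zero_mem
      rcases h3 with h3 | h3 <;> omega
    | succ s ih =>
      intro hs hcon
      exact hne (s + 1) hs (hG.adj_outside hδ (hp.adj s (by omega)) (ih (by omega)) hcon)
  have hwout := hout t le_rfl
  have hzout := hG.partner_outside hδ hz hwout
  have hle := setDist_le_succ hc hT hadj
  obtain ⟨e, he, hde⟩ := exists_dist_eq_setDist (G := G) hT z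
  have hew := hG.legTarget_within hl.arc_bot he
  unfold Within at hβδ
  obtain ⟨s, hs, hs2⟩ := exists_dist_eq_add_of_separates hc
    (I := {v : Fin n | δ.1 ≤ v ∧ v ≤ δ.2}) (B := arcEnds δ)
    (fun x y hxy hx hy => hG.adj_outside hδ hxy hx hy) (x := z) hzout (e := e)
    (show δ.1 ≤ e.val ∧ e.val ≤ δ.2 by omega)
  have hg' := hp.setDist_right (t + 1) ht
  have hes := setDist_le (G := G) he s
  rw [dist_comm (u := e) (v := s)] at hes
  rw [dist_comm (u := e) (v := z)] at hde
  have hs' : s = p (t + 1) ∨ s = z' := by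
    rcases hs with hs | hs <;> rcases hδe with h | h
    · exact Or.inl (Fin.ext (by omega))
    · exact Or.inr (Fin.ext (by omega))
    · exact Or.inr (Fin.ext (by omega))
    · exact Or.inl (Fin.ext (by omega))
  rcases hs' with rfl | rfl
  · have h2 : 1 < G.dist z (p (t + 1)) :=
      hc.one_lt_dist_of_ne_of_not_adj (hzp _ ht).symm fun h => hna h.symm
    omega
  · have h2 := setDist_le_succ hc hT (hG.adj_of_partner hz').symm
    omega

theorem path_or_partner_inside {t : ℕ} (h1 : 1 ≤ t) (ht : t ≤ L) {v : Fin n}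
    (hv : v = p t ∨ IsPartner M (p t) v) : τ.1 < v ∧ v < τ.2 := by
  have h := hG.path_inside hl hp h1 ht
  rcases hv with rfl | hv
  · exact h
  · exact hG.partner_inside hl.arc_top hv h

end Leg

end IsChordedCycle

end OuterplanarPacking

/-! ### The skeleton of faces and legs -/

namespace OuterplanarPacking

open SimpleGraph

/-- A choice of a geodesic `P τ β` of length `L τ β` for each leg `(τ, β)`. -/
def IsLegFamily {n : ℕ} (M : ℕ → ℕ → Prop) (G : SimpleGraph (Fin n)) (L : ℕ × ℕ → ℕ × ℕ → ℕ)
    (P : ℕ × ℕ → ℕ × ℕ → ℕ → Fin n) : Prop :=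
  ∀ τ β, IsLeg n M τ β →
    G.IsPreferredGeodesic (IsPartner M) (arcEnds τ) (legTarget n M β) (L τ β) (P τ β)

/-- The vertices on the faces of the branch arcs and on the chosen geodesics of the legs. -/
def skeleton {n : ℕ} (M : ℕ → ℕ → Prop) (L : ℕ × ℕ → ℕ × ℕ → ℕ)
    (P : ℕ × ℕ → ℕ × ℕ → ℕ → Fin n) : Set (Fin n) :=
  {w | (∃ β, IsBranchArc n M β ∧ OnFace n M β w) ∨
    ∃ τ β t, IsLeg n M τ β ∧ t ≤ L τ β ∧ w = P τ β t}

/-- The vertex `w` is the vertex number `t` of the geodesic of the leg `(τ, β)`, and it is not an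
end of this geodesic that lies on the face of a branch arc. -/
structure IsLegVertex {n : ℕ} (M : ℕ → ℕ → Prop) (L : ℕ × ℕ → ℕ × ℕ → ℕ)
    (P : ℕ × ℕ → ℕ × ℕ → ℕ → Fin n) (τ β : ℕ × ℕ) (t : ℕ) (w : Fin n) : Prop where
  leg : IsLeg n M τ β
  le : t ≤ L τ β
  eq : w = P τ β t
  zero : t = 0 → τ = (0, n)
  lt : IsBranchArc n M β → t < L τ β

theorem IsBranchArc.chord {n : ℕ} {M : ℕ → ℕ → Prop} (hroot : ¬ IsBranchArc n M (0, n)) {β : ℕ × ℕ}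
    (hβ : IsBranchArc n M β) : M β.1 β.2 := by
  rcases hβ.1 with h | rfl
  · exact h
  · exact absurd hβ hroot

namespace IsChordedCycle

variable {n : ℕ} {M : ℕ → ℕ → Prop} {G : SimpleGraph (Fin n)} (hG : IsChordedCycle n M G)
include hG

theorem adj_cases {w v : Fin n} (h : G.Adj w v) :
    v.val = (if w.val + 1 = n then 0 else w.val + 1) ∨
      v.val = (if w.val = 0 then n - 1 else w.val - 1) ∨ IsPartner M w v := by
  have := v.2
  have := w.2
  unfold IsPartner
  rcases (hG.adj_iff w v).1 h with h | h | h | h | h | h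
  · left; split_ifs <;> omega
  · right; left; split_ifs <;> omega
  · right; left; split_ifs <;> omega
  · left; split_ifs <;> omega
  · exact Or.inr (Or.inr (Or.inl h))
  · exact Or.inr (Or.inr (Or.inr h))

/-- A vertex has at most three neighbours. -/
theorem eq_of_adj {w x y z z' : Fin n} (hx : G.Adj w x) (hy : G.Adj w y) (hz : G.Adj w z)
    (hz' : G.Adj w z') (hxy : x ≠ y) (hxz : x ≠ z) (hyz : y ≠ z) (hxz' : x ≠ z') (hyz' : y ≠ z') :
    z = z' := by
  have key : ∀ a b : Fin n, IsPartner M w a → IsPartner M w b → a.val = b.val := fun a b ha hb => by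
    rw [hG.partner_unique ha hb]
  have h1 := key x y
  have h2 := key x z
  have h3 := key x z'
  have h4 := key y z
  have h5 := key y z'
  have h6 := key z z'
  have hx' := hG.adj_cases hx
  have hy' := hG.adj_cases hy
  have hz1 := hG.adj_cases hz
  have hz2 := hG.adj_cases hz'
  generalize (if w.val + 1 = n then 0 else w.val + 1) = a at *
  generalize (if w.val = 0 then n - 1 else w.val - 1) = b at *
  rw [ne_eq, Fin.ext_iff] at hxy hxz hyz hxz' hyz'
  rw [Fin.ext_iff]
  grind

/-- A vertex without a chord has at most two neighbours. -/
theorem eq_of_adj_of_no_partner {w x z z' : Fin n} (hw : ∀ v, ¬ IsPartner M w v) (hx : G.Adj w x)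
    (hz : G.Adj w z) (hz' : G.Adj w z') (hxz : x ≠ z) (hxz' : x ≠ z') : z = z' := by
  have hx' := (hG.adj_cases hx)
  have hz1 := (hG.adj_cases hz)
  have hz2 := (hG.adj_cases hz')
  have h1 := hw x
  have h2 := hw z
  have h3 := hw z'
  generalize (if w.val + 1 = n then 0 else w.val + 1) = a at *
  generalize (if w.val = 0 then n - 1 else w.val - 1) = b at *
  rw [ne_eq, Fin.ext_iff] at hxz hxz'
  rw [Fin.ext_iff]
  grind

/-- A vertex on the face of a chord has two neighbours on this face. -/
theorem exists_adj_onFace {β : ℕ × ℕ} (hβ : M β.1 β.2) {w : Fin n} (hw : OnFace n M β w) :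
    ∃ x y : Fin n, x ≠ y ∧ OnFace n M β x ∧ OnFace n M β y ∧ G.Adj w x ∧ G.Adj w y := by
  have hβ' : IsArc n M β := Or.inl hβ
  have b := hG.bounds hβ
  obtain ⟨hw1, hw2, hw3⟩ := id hw
  have hright : w.val < β.2 → ∃ x : Fin n, OnFace n M β x ∧ G.Adj w x ∧ w < x ∧
      (w.val = β.1 → x.val < β.2) := by
    intro hlt
    by_cases hγ : ∃ γ, IsArc n M γ ∧ Inside γ β ∧ γ.1 = w.val
    · obtain ⟨γ, hγ, hin, he⟩ := hγ
      have bγ := hG.arc_bounds hγ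
      have hch : IsChildArc n M β γ := ⟨hγ, hin, fun δ hδ hδβ h => hw3 δ hδ hδβ (by
        unfold Inside at h; omega)⟩
      have hin' := hin
      unfold Inside at hin'
      refine ⟨⟨γ.2, by omega⟩, ChordDiagram.IsChildArc.onFace_right hG.toChordDiagram hch, ?_, ?_, ?_⟩
      · rw [hG.adj_iff]
        rcases hγ with hγ | rfl
        · exact Or.inr (Or.inr (Or.inr (Or.inr (Or.inl (he ▸ hγ)))))
        · simp only at hin'
          omega
      · rw [Fin.lt_def]
        simp only
        omega
      · intro _
        simp only
        omega
    · refine ⟨⟨w.val + 1, by omega⟩, ⟨by simp only; omega, by simp only; omega, ?_⟩, ?_, ?_, ?_⟩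
      · intro γ hγ' hin h
        simp only at h
        have := hw3 γ hγ' hin
        exact hγ ⟨γ, hγ', hin, by omega⟩
      · rw [hG.adj_iff]
        exact Or.inl rfl
      · rw [Fin.lt_def]
        simp only
        omega
      · intro _
        simp only
        omega
  have hleft : β.1 < w.val → ∃ x : Fin n, OnFace n M β x ∧ G.Adj w x ∧ x < w ∧
      (w.val = β.2 → β.1 < x.val) := by
    intro hlt
    by_cases hγ : ∃ γ, IsArc n M γ ∧ Inside γ β ∧ γ.2 = w.val
    · obtain ⟨γ, hγ, hin, he⟩ := hγ
      have bγ := hG.arc_bounds hγ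
      have hch : IsChildArc n M β γ := ⟨hγ, hin, fun δ hδ hδβ h => hw3 δ hδ hδβ (by
        unfold Inside at h; omega)⟩
      have hin' := hin
      unfold Inside at hin'
      refine ⟨⟨γ.1, by omega⟩, ChordDiagram.IsChildArc.onFace_left hG.toChordDiagram hch, ?_, ?_, ?_⟩
      · rw [hG.adj_iff]
        rcases hγ with hγ | rfl
        · exact Or.inr (Or.inr (Or.inr (Or.inr (Or.inr (he ▸ hγ)))))
        · simp only at hin'
          omega
      · rw [Fin.lt_def]
        simp only
        omega
      · intro _
        simp only
        omega
    · refine ⟨⟨w.val - 1, by omega⟩, ⟨by simp only; omega, by simp only; omega, ?_⟩, ?_, ?_, ?_⟩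
      · intro γ hγ' hin h
        simp only at h
        have := hw3 γ hγ' hin
        exact hγ ⟨γ, hγ', hin, by omega⟩
      · rw [hG.adj_iff]
        right
        left
        simp only
        omega
      · rw [Fin.lt_def]
        simp only
        omega
      · intro _
        simp only
        omega
  have hends : G.Adj ⟨β.1, by omega⟩ ⟨β.2, by omega⟩ := by
    rw [hG.adj_iff]
    exact Or.inr (Or.inr (Or.inr (Or.inr (Or.inl hβ))))
  by_cases h1 : w.val = β.1
  · obtain ⟨x, hx1, hx2, hx3, hx4⟩ := hright (by omega)
    refine ⟨x, ⟨β.2, by omega⟩, ?_, hx1, hG.onFace_right hβ', hx2, ?_⟩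
    · rw [ne_eq, Fin.ext_iff]
      simp only
      have := hx4 h1
      omega
    · convert hends
  · by_cases h2 : w.val = β.2
    · obtain ⟨x, hx1, hx2, hx3, hx4⟩ := hleft (by omega)
      refine ⟨x, ⟨β.1, by omega⟩, ?_, hx1, hG.onFace_left hβ', hx2, ?_⟩
      · rw [ne_eq, Fin.ext_iff]
        simp only
        have := hx4 h2
        omega
      · convert hends.symm
    · obtain ⟨x, hx1, hx2, hx3, hx4⟩ := hright (by omega)
      obtain ⟨y, hy1, hy2, hy3, hy4⟩ := hleft (by omega)
      exact ⟨x, y, (hy3.trans hx3).ne', hx1, hy1, hx2, hy2⟩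

/-- The chord at a vertex on a face has its other end on this face as well. -/
theorem partner_onFace {β : ℕ × ℕ} (hβ : M β.1 β.2) {w z : Fin n} (hw : OnFace n M β w)
    (hz : IsPartner M w z) : OnFace n M β z := by
  have hβ' : IsArc n M β := Or.inl hβ
  obtain ⟨hw1, hw2, hw3⟩ := id hw
  obtain ⟨γ, hγ, h1, h2, h3⟩ := hG.exists_arc_of_partner hz
  have bγ := hG.arc_bounds hγ
  have bβ := hG.arc_bounds hβ'
  rcases hG.laminar hγ hβ' with h | h | h | h | h
  · rcases h3 with h3 | h3
    · rw [h3.2, h.2]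
      exact hG.onFace_right hβ'
    · rw [h3.1, h.1]
      exact hG.onFace_left hβ'
  · have hch : IsChildArc n M β γ := ⟨hγ, h, fun δ hδ hδβ h => hw3 δ hδ hδβ (by
      unfold Inside at h; omega)⟩
    rcases h3 with h3 | h3
    · rw [h3.2]
      exact ChordDiagram.IsChildArc.onFace_right hG.toChordDiagram hch
    · rw [h3.1]
      exact ChordDiagram.IsChildArc.onFace_left hG.toChordDiagram hch
  all_goals
    try unfold Inside at h
    omega

/-- The vertex after the left end of a leaf arc has no chord. -/
theorem no_partner_of_isLeafArc {β : ℕ × ℕ} (hβ : IsLeafArc n M β) {w z : Fin n}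
    (hw : w.val = β.1 + 1) : ¬ IsPartner M w z := by
  intro hz
  have bβ := hG.arc_bounds hβ.1
  have h1 := hG.partner_inside hβ.1 hz (by omega)
  obtain ⟨γ, hγ, h2, h3, h4⟩ := hG.exists_arc_of_partner hz
  exact hβ.2 γ hγ (by unfold Inside; omega)

theorem no_partner_zero {w z : Fin n} (hw : w.val = 0) : ¬ IsPartner M w z := by
  rintro (h | h)
  · have := hG.bounds h
    omega
  · have := hG.bounds h
    omega

theorem not_onFace_of_partner (hroot : ¬ IsBranchArc n M (0, n)) {L : ℕ × ℕ → ℕ × ℕ → ℕ}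
    {P : ℕ × ℕ → ℕ × ℕ → ℕ → Fin n} {β : ℕ × ℕ} (hβ : IsBranchArc n M β) {w z : Fin n}
    (hz : z ∉ skeleton M L P) (hwz : IsPartner M w z) : ¬ OnFace n M β w := fun hw =>
  hz (Or.inl ⟨β, hβ, hG.partner_onFace (hβ.chord hroot) hw hwz⟩)

variable {L : ℕ × ℕ → ℕ × ℕ → ℕ} {P : ℕ × ℕ → ℕ × ℕ → ℕ → Fin n} (hP : IsLegFamily M G L P)
include hP

/-- An end of a geodesic at which the leg meets the face of a branch arc lies on this face, so the
vertices of the skeleton are those of the faces and the remaining vertices of the geodesics. -/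
theorem mem_skeleton_cases {w : Fin n} (hw : w ∈ skeleton M L P) :
    (∃ β, IsBranchArc n M β ∧ OnFace n M β w) ∨ ∃ τ β t, IsLegVertex M L P τ β t w := by
  rcases hw with hw | ⟨τ, β, t, hl, ht, rfl⟩
  · exact Or.inl hw
  have hp := hP τ β hl
  by_cases h0 : t = 0 ∧ τ ≠ (0, n)
  · obtain ⟨α, hα, hch⟩ := hl.top.resolve_left h0.2
    refine Or.inl ⟨α, hα, ?_⟩
    rw [h0.1]
    rcases hp.zero_mem with h | h
    · rw [h]
      exact ChordDiagram.IsChildArc.onFace_left hG.toChordDiagram hch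
    · rw [h]
      exact ChordDiagram.IsChildArc.onFace_right hG.toChordDiagram hch
  by_cases h1 : IsBranchArc n M β ∧ t = L τ β
  · refine Or.inl ⟨β, h1.1, ?_⟩
    have h2 := hp.last_mem
    unfold legTarget at h2
    rw [if_pos h1.1] at h2
    rw [h1.2]
    rcases h2 with h | h
    · rw [h]
      exact hG.onFace_left h1.1.1
    · rw [h]
      exact hG.onFace_right h1.1.1
  refine Or.inr ⟨τ, β, t, hl, ht, rfl, fun h => ?_, fun h => ?_⟩
  · by_contra h'
    exact h0 ⟨h, h'⟩
  · by_contra h'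
    exact h1 ⟨h, by omega⟩

/-- Each chord has an end in the skeleton. -/
theorem not_partner_of_notMem_skeleton {z z' : Fin n} (hz : z ∉ skeleton M L P)
    (hz' : z' ∉ skeleton M L P) : ¬ IsPartner M z z' := by
  intro h
  obtain ⟨γ, hγ, h1, h2, h3⟩ := hG.exists_arc_of_partner h
  obtain ⟨τ, β, hl, h4, h5⟩ := hG.exists_isLeg hγ
  obtain ⟨t, ht, h6⟩ := hG.exists_path_mem_ends hl (hP τ β hl) hγ h4 h5
  have : P τ β t = z ∨ P τ β t = z' := by
    rw [Fin.ext_iff, Fin.ext_iff]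
    omega
  rcases this with rfl | rfl
  · exact hz (Or.inr ⟨τ, β, t, hl, ht, rfl⟩)
  · exact hz' (Or.inr ⟨τ, β, t, hl, ht, rfl⟩)

/-- Adjacent vertices on the geodesics of legs, away from the faces of the branch arcs, belong to
the same leg. -/
theorem IsLegVertex.leg_eq {τ β τ' β' : ℕ × ℕ} {t t' : ℕ} {w w' : Fin n}
    (h : IsLegVertex M L P τ β t w) (h' : IsLegVertex M L P τ' β' t' w') (h1 : 1 ≤ t)
    (h1' : 1 ≤ t') (hadj : G.Adj w w') : τ = τ' ∧ β = β' ∧ (t' = t + 1 ∨ t = t' + 1) := by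
  have hp := hP _ _ h.leg
  have hp' := hP _ _ h'.leg
  have hin := hG.path_inside h.leg hp h1 h.le
  have hin' := hG.path_inside h'.leg hp' h1' h'.le
  rw [← h.eq] at hin
  rw [← h'.eq] at hin'
  have ha := hG.adj_inside h.leg.arc_top hadj hin
  rcases ChordDiagram.IsLeg.trichotomy hG.toChordDiagram h.leg h'.leg with
    he | ⟨he, hb⟩ | ⟨he, hb⟩ | he | he
  · subst he
    have hβ := ChordDiagram.IsLeg.bot_unique hG.toChordDiagram h.leg h'.leg
    subst hβ
    refine ⟨rfl, rfl, ?_⟩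
    have hS := hG.arcEnds_nonempty h.leg.arc_top
    have h2 := setDist_le_succ hG.connected hS hadj
    have h3 := setDist_le_succ hG.connected hS hadj.symm
    rw [h.eq, h'.eq, hp.setDist_left t h.le, hp.setDist_left t' h'.le] at h2 h3
    have : t ≠ t' := by
      rintro rfl
      exact hadj.ne (h.eq.trans h'.eq.symm)
    omega
  · have h2 := hG.path_outside h.leg hp hb (h.lt hb)
    rw [← h.eq] at h2
    unfold Inside at he
    have h3 := hG.adj_inside h.leg.arc_bot hadj.symm (by omega)
    omega
  · have h2 := hG.path_outside h'.leg hp' hb (h'.lt hb)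
    rw [← h'.eq] at h2
    unfold Inside at he
    have h3 := hG.adj_inside h'.leg.arc_bot hadj (by omega)
    omega
  · omega
  · omega

variable (hroot : ¬ IsBranchArc n M (0, n))
include hroot

theorem root_path {β : ℕ × ℕ} (hl : IsLeg n M (0, n) β) :
    (P (0, n) β 0).val = 0 ∧ 1 ≤ L (0, n) β := by
  have hp := hP _ β hl
  have h0 : (P (0, n) β 0).val = 0 := by
    have := (P (0, n) β 0).2
    rcases hp.zero_mem with h | h
    · exact h
    · simp only at h
      omega
  refine ⟨h0, ?_⟩
  by_contra hL
  have h1 := hp.last_mem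
  rw [show L (0, n) β = 0 by omega] at h1
  unfold legTarget at h1
  split_ifs at h1 with hb
  · have := hG.bounds (hb.chord hroot)
    rcases h1 with h1 | h1 <;> omega
  · change (P (0, n) β 0).val = β.1 + 1 at h1
    omega

theorem zero_mem_skeleton {w : Fin n} (hw : w.val = 0) : w ∈ skeleton M L P := by
  have h3 := hG.three_le
  obtain ⟨τ, β, hl, h1, -⟩ := hG.exists_isLeg (γ := (0, n)) (Or.inr rfl)
  have b := hG.arc_bounds hl.arc_top
  have hτ : τ = (0, n) := by
    unfold Within at h1
    simp only at h1
    exact Prod.ext (by simp only; omega) (by simp only; omega)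
  subst hτ
  refine Or.inr ⟨_, β, 0, hl, Nat.zero_le _, Fin.ext ?_⟩
  rw [hw, (hG.root_path hP hroot hl).1]

/-- A vertex of the skeleton has at most one neighbour outside the skeleton. -/
theorem eq_of_adj_skeleton {w z z' : Fin n} (hw : w ∈ skeleton M L P) (hz : z ∉ skeleton M L P)
    (hz' : z' ∉ skeleton M L P) (h : G.Adj w z) (h' : G.Adj w z') : z = z' := by
  have hne : ∀ x ∈ skeleton M L P, x ≠ z ∧ x ≠ z' := fun x hx =>
    ⟨by rintro rfl; exact hz hx, by rintro rfl; exact hz' hx⟩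
  rcases hG.mem_skeleton_cases hP hw with ⟨β, hβ, hf⟩ | ⟨τ, β, t, hl, ht, rfl, h0, hb⟩
  · obtain ⟨x, y, hxy, hx, hy, hwx, hwy⟩ :=
      hG.exists_adj_onFace (hβ.chord hroot) hf
    have hx' := hne x (Or.inl ⟨β, hβ, hx⟩)
    have hy' := hne y (Or.inl ⟨β, hβ, hy⟩)
    exact hG.eq_of_adj hwx hwy h h' hxy hx'.1 hy'.1 hx'.2 hy'.2
  have hp := hP τ β hl
  have hmem : ∀ s ≤ L τ β, P τ β s ∈ skeleton M L P := fun s hs => Or.inr ⟨τ, β, s, hl, hs, rfl⟩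
  rcases Nat.eq_zero_or_pos t with rfl | htpos
  · obtain rfl := h0 rfl
    obtain ⟨h1, h2⟩ := hG.root_path hP hroot hl
    have h3 := hne _ (hmem 1 h2)
    exact hG.eq_of_adj_of_no_partner (fun v => hG.no_partner_zero h1) (hp.adj 0 h2) h h' h3.1 h3.2
  have hprev := hp.adj (t - 1) (by omega)
  rw [show t - 1 + 1 = t by omega] at hprev
  have h3 := hne _ (hmem (t - 1) (by omega))
  by_cases htL : t < L τ β
  · have h4 := hne _ (hmem (t + 1) (by omega))
    exact hG.eq_of_adj hprev.symm (hp.adj t htL) h h'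
      (hp.ne (by omega) (by omega) (by omega)) h3.1 h4.1 h3.2 h4.2
  · have hnb : ¬ IsBranchArc n M β := fun hb' => htL (hb hb')
    have h4 := hp.last_mem
    unfold legTarget at h4
    rw [if_neg hnb] at h4
    obtain rfl : t = L τ β := by omega
    exact hG.eq_of_adj_of_no_partner
      (fun v => hG.no_partner_of_isLeafArc (hl.bot.resolve_right hnb) h4) hprev.symm h h' h3.1 h3.2

theorem IsLegVertex.pos_of_partner {τ β : ℕ × ℕ} {t : ℕ} {w z : Fin n}
    (h : IsLegVertex M L P τ β t w) (hwz : IsPartner M w z) : 1 ≤ t := by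
  by_contra h0
  obtain rfl : t = 0 := by omega
  obtain rfl := h.zero rfl
  exact hG.no_partner_zero (by rw [h.eq]; exact (hG.root_path hP hroot h.leg).1) hwz

end IsChordedCycle

end OuterplanarPacking

/-! ### The colours of the skeleton -/

namespace OuterplanarPacking

open SimpleGraph

section Places

variable {n : ℕ} (M : ℕ → ℕ → Prop) (G : SimpleGraph (Fin n)) (L : ℕ × ℕ → ℕ × ℕ → ℕ)
  (P : ℕ × ℕ → ℕ × ℕ → ℕ → Fin n)

/-- The vertex `v` may receive the colour meant for the vertex `w` with number `t` on the geodesic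
of the leg `(τ, β)`: it is `w` or the other end of the chord at `w`. -/
def IsLegPlace (τ β : ℕ × ℕ) (t : ℕ) (w v : Fin n) : Prop :=
  v = w ∨ (IsPartner M w v ∧ 1 ≤ t ∧
    IsPlace G (arcEnds τ) (legTarget n M β) (L τ β) (P τ β) t v)

/-- The colour meant for the vertex `w` of the skeleton is given to `v`, and it is the colour with
index `u` in the block number `j`. Each branch arc `β` has three blocks, where `ix β` is its number:
one for the left half of the face below `β` and for the leg that ends at `β`, one for the right
half of this face, and one for the first vertices of the legs that start at this face. -/
inductive IsBlockPlace (ix : ℕ × ℕ → ℕ) (w v : Fin n) : ℕ → ℤ → Prop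
  | left (β : ℕ × ℕ) (hβ : IsBranchArc n M β) (hw : OnFace n M β w)
      (hpos : 2 * facePos n M β w ≤ facePos n M β β.2) (hv : v = w) :
      IsBlockPlace ix w v (3 * ix β) (facePos n M β w)
  | right (β : ℕ × ℕ) (hβ : IsBranchArc n M β) (hw : OnFace n M β w)
      (hpos : facePos n M β β.2 < 2 * facePos n M β w) (hv : v = w) :
      IsBlockPlace ix w v (3 * ix β + 1) (facePos n M β β.2 - facePos n M β w)
  | leg (τ β : ℕ × ℕ) (t : ℕ) (hβ : IsBranchArc n M β) (hw : IsLegVertex M L P τ β t w)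
      (hv : IsLegPlace M G L P τ β t w v) :
      IsBlockPlace ix w v (3 * ix β) (t - L τ β)
  | first (α τ β : ℕ × ℕ) (hα : IsBranchArc n M α) (hτ : IsChildArc n M α τ)
      (hw : IsLegVertex M L P τ β 1 w) (hv : IsLegPlace M G L P τ β 1 w v) :
      IsBlockPlace ix w v (3 * ix α + 2) (gapLevel (facePos n M α α.2) (facePos n M α τ.1))

/-- The colour meant for the vertex `w` with number `t` on a leg that ends at a leaf arc is given
to `v`. The vertices with numbers `0` and `1` are excluded, because the bound `leafColor_le`, which
keeps different legs apart, fails for them. A leg from the root arc to a leaf arc is the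
only leg, so it needs no such bound. -/
inductive IsLeafPlace (w v : Fin n) (t : ℕ) : Prop
  | mk (τ β : ℕ × ℕ) (hβ : ¬ IsBranchArc n M β) (ht : 2 ≤ t ∨ τ = (0, n))
      (hw : IsLegVertex M L P τ β t w) (hv : IsLegPlace M G L P τ β t w v)

/-- The colour `k` is meant for the vertex `w` of the skeleton and is given to `v`. -/
def HasColor (ix : ℕ × ℕ → ℕ) (r : ℕ) (w v : Fin n) (k : ℕ) : Prop :=
  (∃ j u, j < 3 * r ∧ IsBlockPlace M G L P ix w v j u ∧ k = blockColor (16 * 4 ^ j) u) ∨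
    ∃ t, IsLeafPlace M G L P w v t ∧ k = leafColor t

end Places

section

variable {n : ℕ} {M : ℕ → ℕ → Prop} {G : SimpleGraph (Fin n)}

theorem faceLevel_of_below_child {β τ : ℕ × ℕ} (h : IsChildArc n M β τ) {v : Fin n}
    (h1 : τ.1 < v) (h2 : v < τ.2) :
    faceLevel M G β v = gapLevel (facePos n M β β.2) (facePos n M β τ.1) := by
  have := h.2.1
  unfold Inside at this
  unfold faceLevel
  rw [if_pos (by omega), innerLevel_of_below_child h h1 h2]

theorem faceLevel_of_onFace {β : ℕ × ℕ} {v : Fin n} (h : OnFace n M β v) :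
    faceLevel M G β v =
      min (facePos n M β v : ℤ) (facePos n M β β.2 - facePos n M β v) := by
  unfold faceLevel innerLevel
  rw [if_pos ⟨h.1, h.2.1⟩, if_pos h]

theorem facePos_ne {β : ℕ × ℕ} {v w : Fin n} (hv : OnFace n M β v) (hw : OnFace n M β w)
    (hne : v ≠ w) : facePos n M β v ≠ facePos n M β w := by
  rcases lt_or_gt_of_ne hne with h | h
  · exact (facePos_lt hv.1 h hw).ne
  · exact (facePos_lt hw.1 h hv).ne'

theorem IsLegPlace.isPlace {L : ℕ × ℕ → ℕ × ℕ → ℕ}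
    {P : ℕ × ℕ → ℕ × ℕ → ℕ → Fin n} {τ β : ℕ × ℕ} {t : ℕ} {w v : Fin n}
    (hw : IsLegVertex M L P τ β t w) (hv : IsLegPlace M G L P τ β t w v) :
    IsPlace G (arcEnds τ) (legTarget n M β) (L τ β) (P τ β) t v := by
  rcases hv with rfl | ⟨-, -, hv⟩
  · exact Or.inl hw.eq
  · exact hv

end

namespace IsChordedCycle

variable {n : ℕ} {M : ℕ → ℕ → Prop} {G : SimpleGraph (Fin n)} (hG : IsChordedCycle n M G)
include hG

theorem gapLevel_ne_of_isChildArc {α τ τ' : ℕ × ℕ} (h : IsChildArc n M α τ)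
    (h' : IsChildArc n M α τ') (hne : τ ≠ τ') :
    gapLevel (facePos n M α α.2) (facePos n M α τ.1) ≠
      gapLevel (facePos n M α α.2) (facePos n M α τ'.1) := by
  have key : ∀ {τ τ' : ℕ × ℕ}, IsChildArc n M α τ → IsChildArc n M α τ' → τ.2 < τ'.1 →
      gapLevel (facePos n M α α.2) (facePos n M α τ.1) ≠
        gapLevel (facePos n M α α.2) (facePos n M α τ'.1) := by
    intro τ τ' h h' hlt
    have h1 := ChordDiagram.IsChildArc.facePos_right hG.toChordDiagram h
    have h2 := ChordDiagram.IsChildArc.onFace_left hG.toChordDiagram h'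
    have h3 := ChordDiagram.IsChildArc.onFace_right hG.toChordDiagram h
    have h4 := facePos_lt h3.1 hlt h2
    exact gapLevel_ne (by omega)
  rcases hG.laminar h.1 h'.1 with h1 | h1 | h1 | h1 | h1
  · exact absurd (Prod.ext h1.1 h1.2) hne
  · exact absurd h1 (h.2.2 τ' h'.1 h'.2.1)
  · exact absurd h1 (h'.2.2 τ h.1 h.2.1)
  · exact key h h' h1
  · exact (key h' h h1).symm

variable {L : ℕ × ℕ → ℕ × ℕ → ℕ} {P : ℕ × ℕ → ℕ × ℕ → ℕ → Fin n} (hP : IsLegFamily M G L P)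
include hP

theorem IsLegPlace.faceLevel_le {τ β : ℕ × ℕ} {t : ℕ} {w v : Fin n} (hβ : IsBranchArc n M β)
    (hw : IsLegVertex M L P τ β t w) (hv : IsLegPlace M G L P τ β t w v) :
    faceLevel M G β v ≤ t - L τ β := by
  have hp := hP τ β hw.leg
  have hle := hw.le
  have hout := hG.path_outside hw.leg hp hβ (hw.lt hβ)
  have ht : legTarget n M β = arcEnds β := by
    unfold legTarget
    rw [if_pos hβ]
  have hr := hp.setDist_right t hw.le
  rw [← hw.eq] at hout hr
  unfold faceLevel
  rcases hv with rfl | ⟨hv, h1, hv'⟩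
  · rw [if_neg hout, ← ht, hr]
    omega
  · rw [if_neg (hG.partner_outside hβ.1 hv hout), ← ht]
    rcases hv' with rfl | ⟨-, hv'⟩
    · rw [← hw.eq, hr]
      omega
    · rw [hv']
      omega

theorem IsLegPlace.inside {τ β : ℕ × ℕ} {t : ℕ} {w v : Fin n} (h1 : 1 ≤ t)
    (hw : IsLegVertex M L P τ β t w) (hv : IsLegPlace M G L P τ β t w v) :
    τ.1 < v ∧ v < τ.2 := by
  refine hG.path_or_partner_inside hw.leg (hP τ β hw.leg) h1 hw.le ?_
  rw [← hw.eq]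
  rcases hv with rfl | ⟨hv, -⟩
  · exact Or.inl rfl
  · exact Or.inr hv

omit hG in
theorem IsLegPlace.le_setDist {τ β : ℕ × ℕ} {t : ℕ} {w v : Fin n}
    (hw : IsLegVertex M L P τ β t w) (hv : IsLegPlace M G L P τ β t w v) :
    t ≤ G.setDist (arcEnds τ) v := by
  rcases IsLegPlace.isPlace hw hv with rfl | ⟨h, -⟩
  · exact ((hP τ β hw.leg).setDist_left t hw.le).ge
  · exact h

theorem IsLegPlace.sub_le_dist {τ β : ℕ × ℕ} {t t' : ℕ} {w w' v v' : Fin n}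
    (hw : IsLegVertex M L P τ β t w) (hv : IsLegPlace M G L P τ β t w v)
    (hw' : IsLegVertex M L P τ β t' w') (hv' : IsLegPlace M G L P τ β t' w' v') (hlt : t < t') :
    t' - t ≤ G.dist v v' :=
  IsPlace.sub_le_dist hG.connected (hG.arcEnds_nonempty hw.leg.arc_top)
    (hG.legTarget_nonempty hw.leg.arc_bot) (hP τ β hw.leg) hw'.le hlt (IsLegPlace.isPlace hw hv)
    (IsLegPlace.isPlace hw' hv')

/-- Different positions of the same block get different indices, and their distance is at least
the difference of the indices. -/
theorem IsBlockPlace.sub_le_dist (hroot : ¬ IsBranchArc n M (0, n)) {ix : ℕ × ℕ → ℕ}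
    (hix : Set.InjOn ix {β | IsBranchArc n M β})
    {w v w' v' : Fin n} {j : ℕ} {u u' : ℤ} (h : IsBlockPlace M G L P ix w v j u)
    (h' : IsBlockPlace M G L P ix w' v' j u') (hne : w ≠ w') :
    u ≠ u' ∧ u - u' ≤ G.dist v v' := by
  obtain ⟨j', hj⟩ : ∃ j', j' = j := ⟨j, rfl⟩
  rw [← hj] at h'
  rcases h with ⟨β, hβ, hw, hpos, rfl⟩ | ⟨β, hβ, hw, hpos, rfl⟩ | ⟨τ, β, t, hβ, hw, hv⟩ |
    ⟨α, τ, β, hα, hτ, hw, hv⟩ <;>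
  rcases h' with ⟨β', hβ', hw', hpos', rfl⟩ | ⟨β', hβ', hw', hpos', rfl⟩ |
    ⟨τ', β', t', hβ', hw', hv'⟩ | ⟨α', τ', β', hα', hτ', hw', hv'⟩
  · obtain rfl := hix hβ hβ' (by omega)
    have h1 := hG.faceLevel_sub_le_dist (hβ.chord hroot) v v'
    have h2 := facePos_ne hw hw' hne
    rw [faceLevel_of_onFace hw, faceLevel_of_onFace hw'] at h1
    omega
  · omega
  · obtain rfl := hix hβ hβ' (by omega)
    have h1 := hG.faceLevel_sub_le_dist (hβ.chord hroot) v v'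
    have h2 := IsLegPlace.faceLevel_le hG hP hβ hw' hv'
    have h3 := hw'.lt hβ
    rw [faceLevel_of_onFace hw] at h1
    omega
  · omega
  · omega
  · obtain rfl := hix hβ hβ' (by omega)
    have h1 := hG.faceLevel_sub_le_dist (hβ.chord hroot) v v'
    have h2 := facePos_ne hw hw' hne
    have h3 := facePos_mono (n := n) (M := M) (β := β) hw.2.1
    have h4 := facePos_mono (n := n) (M := M) (β := β) hw'.2.1
    rw [faceLevel_of_onFace hw, faceLevel_of_onFace hw'] at h1
    omega
  · omega
  · omega
  · obtain rfl := hix hβ hβ' (by omega)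
    have h3 := hw.lt hβ
    omega
  · omega
  · obtain rfl := hix hβ hβ' (by omega)
    obtain rfl := ChordDiagram.IsLeg.top_unique hG.toChordDiagram hw.leg hw'.leg
    have h1 : t ≠ t' := by
      rintro rfl
      exact hne (hw.eq.trans hw'.eq.symm)
    have h2 := hw.le
    have h3 := hw'.le
    rcases lt_or_gt_of_ne h1 with h4 | h4
    · omega
    · have h5 := IsLegPlace.sub_le_dist hG hP hw' hv' hw hv h4
      rw [dist_comm] at h5
      omega
  · omega
  · omega
  · omega
  · omega
  · obtain rfl := hix hα hα' (by omega)
    have h1 : τ ≠ τ' := by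
      rintro rfl
      obtain rfl := ChordDiagram.IsLeg.bot_unique hG.toChordDiagram hw.leg hw'.leg
      exact hne (hw.eq.trans hw'.eq.symm)
    have h2 := hG.faceLevel_sub_le_dist (hα.chord hroot) v v'
    have h3 := IsLegPlace.inside hG hP le_rfl hw hv
    have h4 := IsLegPlace.inside hG hP le_rfl hw' hv'
    rw [faceLevel_of_below_child hτ h3.1 h3.2, faceLevel_of_below_child hτ' h4.1 h4.2] at h2
    exact ⟨hG.gapLevel_ne_of_isChildArc hτ hτ' h1, h2⟩

omit hP in
/-- Vertices below different chords are far apart if they are far from the ends of the chords. -/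
theorem add_setDist_lt_dist {τ τ' : ℕ × ℕ} (hτ : IsArc n M τ) (hτ' : IsArc n M τ')
    (hlt : τ.2 < τ'.1 ∨ τ'.2 < τ.1) {v v' : Fin n} (hv : τ.1 < v ∧ v < τ.2)
    (hv' : τ'.1 < v' ∧ v' < τ'.2) :
    G.setDist (arcEnds τ) v + G.setDist (arcEnds τ') v' < G.dist v v' := by
  have hc := hG.connected
  have b := hG.arc_bounds hτ
  have b' := hG.arc_bounds hτ'
  obtain ⟨s', hs', h1⟩ := exists_dist_eq_add_of_separates hc
    (I := {v : Fin n | τ'.1 ≤ v ∧ v ≤ τ'.2}) (B := arcEnds τ')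
    (fun x y hxy hx hy => hG.adj_outside hτ' hxy hx hy) (x := v)
    (show ¬ (τ'.1 ≤ v.val ∧ v.val ≤ τ'.2) by omega) (e := v')
    (show τ'.1 ≤ v'.val ∧ v'.val ≤ τ'.2 by omega)
  have hs'' : s'.val = τ'.1 ∨ s'.val = τ'.2 := hs'
  obtain ⟨s, hs, h2⟩ := exists_dist_eq_add_of_separates hc
    (I := {v : Fin n | τ.1 ≤ v ∧ v ≤ τ.2}) (B := arcEnds τ)
    (fun x y hxy hx hy => hG.adj_outside hτ hxy hx hy) (x := s')
    (show ¬ (τ.1 ≤ s'.val ∧ s'.val ≤ τ.2) by omega) (e := v)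
    (show τ.1 ≤ v.val ∧ v.val ≤ τ.2 by omega)
  have hs''' : s.val = τ.1 ∨ s.val = τ.2 := hs
  have h3 := setDist_le (G := G) hs v
  have h4 := setDist_le (G := G) hs' v'
  have h5 : 0 < G.dist s' s := hc.pos_dist_of_ne (by rw [ne_eq, Fin.ext_iff]; omega)
  rw [dist_comm (u := v) (v := s')] at h1
  omega

/-- On a single leg, equal leaf colours are far apart along the geodesic. Different legs that end at
leaf arcs lie below different chords, and there the bound `leafColor t ≤ 2 * t` suffices. -/
theorem IsLeafPlace.lt_dist {w v w' v' : Fin n} {t t' : ℕ} (h : IsLeafPlace M G L P w v t)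
    (h' : IsLeafPlace M G L P w' v' t') (hne : w ≠ w') (hcol : leafColor t = leafColor t') :
    leafColor t < G.dist v v' := by
  obtain ⟨τ, β, hβ, ht, hw, hv⟩ := h
  obtain ⟨τ', β', hβ', ht', hw', hv'⟩ := h'
  have b := hG.arc_bounds hw.leg.arc_top
  have b' := hG.arc_bounds hw'.leg.arc_top
  have far : τ.2 < τ'.1 ∨ τ'.2 < τ.1 → leafColor t < G.dist v v' := by
    intro hlt
    have h1 : 2 ≤ t := by
      refine ht.resolve_right ?_
      rintro rfl
      simp only at hlt
      omega
    have h2 : 2 ≤ t' := by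
      refine ht'.resolve_right ?_
      rintro rfl
      simp only at hlt
      omega
    have h3 := hG.add_setDist_lt_dist hw.leg.arc_top hw'.leg.arc_top hlt
      (IsLegPlace.inside hG hP (by omega) hw hv) (IsLegPlace.inside hG hP (by omega) hw' hv')
    have h4 := IsLegPlace.le_setDist hP hw hv
    have h5 := IsLegPlace.le_setDist hP hw' hv'
    rcases lt_trichotomy t t' with h6 | rfl | h6
    · have := leafColor_lt hcol h6
      omega
    · have := leafColor_le h1
      omega
    · have := leafColor_lt hcol.symm h6
      omega
  rcases ChordDiagram.IsLeg.trichotomy hG.toChordDiagram hw.leg hw'.leg with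
    rfl | ⟨-, hb⟩ | ⟨-, hb⟩ | he | he
  · obtain rfl := ChordDiagram.IsLeg.bot_unique hG.toChordDiagram hw.leg hw'.leg
    have h1 : t ≠ t' := by
      rintro rfl
      exact hne (hw.eq.trans hw'.eq.symm)
    rcases lt_or_gt_of_ne h1 with h2 | h2
    · have h3 := IsLegPlace.sub_le_dist hG hP hw hv hw' hv' h2
      have := leafColor_lt hcol h2
      omega
    · have h3 := IsLegPlace.sub_le_dist hG hP hw' hv' hw hv h2
      rw [dist_comm] at h3
      have := leafColor_lt hcol.symm h2
      omega
  · exact absurd hb hβ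
  · exact absurd hb hβ'
  · exact far (Or.inl he)
  · exact far (Or.inr he)

end IsChordedCycle

theorem HasColor.bounds {n : ℕ} {M : ℕ → ℕ → Prop} {G : SimpleGraph (Fin n)}
    {L : ℕ × ℕ → ℕ × ℕ → ℕ} {P : ℕ × ℕ → ℕ × ℕ → ℕ → Fin n} {ix : ℕ × ℕ → ℕ} {r : ℕ}
    {w v : Fin n} {k : ℕ} (h : HasColor M G L P ix r w v k) : 4 ≤ k ∧ k ≤ 16 * 64 ^ r - 1 := by
  have h64 : (64 : ℕ) ^ r = 4 ^ (3 * r) := by rw [pow_mul]; norm_num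
  rw [h64]
  rcases h with ⟨j, u, hj, -, rfl⟩ | ⟨t, -, rfl⟩
  · have h1 := blockColor_bounds (K := 16 * 4 ^ j) (by positivity) u
    have h2 : (4 : ℕ) ^ (j + 1) ≤ 4 ^ (3 * r) := Nat.pow_le_pow_right (by norm_num) hj
    have h3 : 1 ≤ (4 : ℕ) ^ j := Nat.one_le_pow _ _ (by norm_num)
    rw [pow_succ] at h2
    omega
  · have h1 := leafColor_bounds t
    have h3 : 1 ≤ (4 : ℕ) ^ (3 * r) := Nat.one_le_pow _ _ (by norm_num)
    omega

theorem blockColor_pow_injective {j j' : ℕ} {u u' : ℤ}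
    (h : blockColor (16 * 4 ^ j) u = blockColor (16 * 4 ^ j') u') : j = j' := by
  have key : ∀ {j j' : ℕ} {u u' : ℤ}, j < j' →
      blockColor (16 * 4 ^ j) u < blockColor (16 * 4 ^ j') u' := by
    intro j j' u u' hlt
    have h1 := blockColor_bounds (K := 16 * 4 ^ j) (by positivity) u
    have h2 := blockColor_bounds (K := 16 * 4 ^ j') (by positivity) u'
    have h3 : (4 : ℕ) ^ (j + 1) ≤ 4 ^ j' := Nat.pow_le_pow_right (by norm_num) hlt
    rw [pow_succ] at h3
    omega
  rcases lt_trichotomy j j' with h1 | h1 | h1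
  · exact absurd h (key h1).ne
  · exact h1
  · exact absurd h (key h1).ne'

theorem blockColor_ne_leafColor {j : ℕ} {u : ℤ} {t : ℕ} :
    blockColor (16 * 4 ^ j) u ≠ leafColor t := by
  have h1 := blockColor_bounds (K := 16 * 4 ^ j) (by positivity) u
  have h2 := leafColor_bounds t
  have h3 : 1 ≤ (4 : ℕ) ^ j := Nat.one_le_pow _ _ (by norm_num)
  omega

/-- The colours of the skeleton are in conflict neither at their own vertices nor at the other
places that they may be given to. -/
theorem HasColor.lt_dist {n : ℕ} {M : ℕ → ℕ → Prop} {G : SimpleGraph (Fin n)}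
    (hG : IsChordedCycle n M G) {L : ℕ × ℕ → ℕ × ℕ → ℕ} {P : ℕ × ℕ → ℕ × ℕ → ℕ → Fin n}
    (hP : IsLegFamily M G L P) (hroot : ¬ IsBranchArc n M (0, n)) {ix : ℕ × ℕ → ℕ}
    (hix : Set.InjOn ix {β | IsBranchArc n M β}) {r : ℕ} {w v w' v' : Fin n} {k : ℕ}
    (h : HasColor M G L P ix r w v k) (h' : HasColor M G L P ix r w' v' k) (hne : w ≠ w') :
    k < G.dist v v' := by
  rcases h with ⟨j, u, hj, hb, rfl⟩ | ⟨t, hl, rfl⟩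
  · rcases h' with ⟨j', u', hj', hb', he⟩ | ⟨t', hl', he⟩
    · obtain rfl := blockColor_pow_injective he
      obtain ⟨h1, h2⟩ := IsChordedCycle.IsBlockPlace.sub_le_dist hG hP hroot hix hb hb' hne
      obtain ⟨-, h3⟩ := IsChordedCycle.IsBlockPlace.sub_le_dist hG hP hroot hix hb' hb hne.symm
      have h4 := blockColor_lt (by positivity) he h1
      rw [dist_comm] at h3
      rw [lt_abs] at h4
      omega
    · exact absurd he blockColor_ne_leafColor
  · rcases h' with ⟨j', u', hj', hb', he⟩ | ⟨t', hl', he⟩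
    · exact absurd he.symm blockColor_ne_leafColor
    · exact IsChordedCycle.IsLeafPlace.lt_dist hG hP hl hl' hne he

end OuterplanarPacking

/-! ### Colouring a cycle with noncrossing chords -/

namespace OuterplanarPacking

open SimpleGraph

namespace IsChordedCycle

variable {n : ℕ} {M : ℕ → ℕ → Prop} {G : SimpleGraph (Fin n)} (hG : IsChordedCycle n M G)
include hG

theorem finite_branchArcs : {β | IsBranchArc n M β}.Finite := by
  refine ((Set.finite_Iic n).prod (Set.finite_Iic n)).subset fun β hβ => ?_
  have := hG.arc_bounds hβ.1
  exact ⟨by simp only [Set.mem_Iic]; omega, by simp only [Set.mem_Iic]; omega⟩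

theorem exists_branchArc_numbering {r : ℕ} (hr : {β | IsBranchArc n M β}.ncard ≤ r) :
    ∃ ix : ℕ × ℕ → ℕ, Set.InjOn ix {β | IsBranchArc n M β} ∧
      ∀ β, IsBranchArc n M β → ix β < r := by
  classical
  have hfin := hG.finite_branchArcs
  rw [Set.ncard_eq_toFinset_card _ hfin] at hr
  let e := hfin.toFinset.equivFin
  have hmem : ∀ β, IsBranchArc n M β → β ∈ hfin.toFinset := fun β hβ => by simpa using hβ
  refine ⟨fun β => if h : β ∈ hfin.toFinset then e ⟨β, h⟩ else 0, ?_, ?_⟩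
  · intro β hβ γ hγ h
    simp only [dif_pos (hmem β hβ), dif_pos (hmem γ hγ)] at h
    have := e.injective (Fin.ext h)
    simpa using this
  · intro β hβ
    simp only [dif_pos (hmem β hβ)]
    exact (e ⟨β, hmem β hβ⟩).2.trans_le hr

variable {L : ℕ × ℕ → ℕ × ℕ → ℕ} {P : ℕ × ℕ → ℕ × ℕ → ℕ → Fin n}

omit hG in
theorem IsLegVertex.exists_hasColor {ix : ℕ × ℕ → ℕ} {r : ℕ}
    (hix : ∀ β, IsBranchArc n M β → ix β < r) {τ β : ℕ × ℕ} {t : ℕ} {w v : Fin n}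
    (hw : IsLegVertex M L P τ β t w) (hv : IsLegPlace M G L P τ β t w v) :
    ∃ k, HasColor M G L P ix r w v k := by
  by_cases hβ : IsBranchArc n M β
  · have := hix β hβ
    exact ⟨_, Or.inl ⟨_, _, by omega, .leg τ β t hβ hw hv, rfl⟩⟩
  by_cases ht : 2 ≤ t ∨ τ = (0, n)
  · exact ⟨_, Or.inr ⟨t, ⟨τ, β, hβ, ht, hw, hv⟩, rfl⟩⟩
  obtain rfl : t = 1 := by
    by_contra h1
    exact ht (Or.inr (hw.zero (by omega)))
  obtain ⟨α, hα, hτ⟩ := hw.leg.top.resolve_left fun h => ht (Or.inr h)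
  have := hix α hα
  exact ⟨_, Or.inl ⟨_, _, by omega, .first α τ β hα hτ hw hv, rfl⟩⟩

theorem exists_hasColor (hP : IsLegFamily M G L P) {ix : ℕ × ℕ → ℕ} {r : ℕ}
    (hix : ∀ β, IsBranchArc n M β → ix β < r) {w : Fin n} (hw : w ∈ skeleton M L P) :
    ∃ k, HasColor M G L P ix r w w k := by
  rcases hG.mem_skeleton_cases hP hw with ⟨β, hβ, hf⟩ | ⟨τ, β, t, h⟩
  · have := hix β hβ
    by_cases hpos : 2 * facePos n M β w ≤ facePos n M β β.2
    · exact ⟨_, Or.inl ⟨_, _, by omega, .left β hβ hf hpos rfl, rfl⟩⟩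
    · exact ⟨_, Or.inl ⟨_, _, by omega, .right β hβ hf (by omega) rfl, rfl⟩⟩
  · exact IsLegVertex.exists_hasColor hix h (Or.inl rfl)

/-- A Hamiltonian cycle with noncrossing, pairwise disjoint chords and with `r` branch arcs has a
packing colouring with `16 * 64 ^ r - 1` colours. -/
theorem exists_isPackingColoring (hroot : ¬ IsBranchArc n M (0, n)) {r : ℕ}
    (hr : {β | IsBranchArc n M β}.ncard ≤ r) :
    ∃ c, G.IsPackingColoring (16 * 64 ^ r - 1) c := by
  have hc := hG.connected
  obtain ⟨ix, hinj, hix⟩ := hG.exists_branchArc_numbering hr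
  obtain ⟨L, P, hP⟩ : ∃ L P, IsLegFamily M G L P := by
    have : ∀ τ β, ∃ L p, IsLeg n M τ β →
        G.IsPreferredGeodesic (IsPartner M) (arcEnds τ) (legTarget n M β) L p := by
      intro τ β
      by_cases h : IsLeg n M τ β
      · obtain ⟨L, p, hp⟩ := hG.exists_leg_geodesic h
        exact ⟨L, p, fun _ => hp⟩
      · have h3 := hG.three_le
        exact ⟨0, fun _ => ⟨0, by omega⟩, fun h' => absurd h' h⟩
    choose L P hP using this
    exact ⟨L, P, hP⟩
  set W := skeleton M L P with hW
  obtain ⟨c₃, hc3, hconf⟩ := hG.exists_three_coloring (W := W)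
    (fun i hi => hG.zero_mem_skeleton hP hroot hi)
    (fun w hw z z' hz hz' h h' => hG.eq_of_adj_skeleton hP hroot hw hz hz' h h')
    (fun z z' hz hz' => hG.not_partner_of_notMem_skeleton hP hz hz')
  let B : ℕ × ℕ → ℕ × ℕ → ℕ → Prop := fun τ β t =>
    ∃ z, z ∉ W ∧ IsPartner M (P τ β t) z ∧ c₃ z = 3
  choose S hS hS' using fun τ β => exists_alternating_selection (B τ β) (L τ β)
  -- The selected vertices of the legs pass their colours on to their partners.
  let sw : Fin n → Fin n → Prop := fun w z =>
    ∃ τ β t, IsLegVertex M L P τ β t w ∧ S τ β t ∧ IsPartner M w z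
  -- A vertex of the skeleton whose chord leaves the skeleton is an interior vertex of a geodesic.
  have hleg : ∀ w z, w ∈ W → z ∉ W → IsPartner M w z →
      ∃ τ β t, IsLegVertex M L P τ β t w ∧ 1 ≤ t := by
    intro w z hw hz hwz
    rcases hG.mem_skeleton_cases hP hw with ⟨β, hβ, hf⟩ | ⟨τ, β, t, h⟩
    · exact absurd hf (hG.not_onFace_of_partner hroot hβ hz hwz)
    · exact ⟨τ, β, t, h, IsLegVertex.pos_of_partner hG hP hroot h hwz⟩
  have hsw : ∀ w z, sw w z → w ∈ W ∧ z ∉ W := by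
    rintro w z ⟨τ, β, t, hw, hSt, hz⟩
    obtain ⟨-, ⟨z', hz', hp, -⟩, -, -⟩ := hS τ β t hSt
    rw [← hw.eq] at hp
    obtain rfl := hG.partner_unique hz hp
    exact ⟨Or.inr ⟨τ, β, t, hw.leg, hw.le, hw.eq⟩, hz'⟩
  have hswcol : ∀ w z, sw w z → ∃ k, HasColor M G L P ix r w z k := by
    rintro w z ⟨τ, β, t, hw, hSt, hz⟩
    obtain ⟨htL, ⟨z₁, hz₁, hp₁, hc₁⟩, ⟨z₂, hz₂, hp₂, hc₂⟩, -⟩ := hS τ β t hSt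
    have hp := hP τ β hw.leg
    obtain rfl := hG.partner_unique hz (hw.eq ▸ hp₁)
    have ht : 1 ≤ t := IsLegVertex.pos_of_partner hG hP hroot hw hz
    have hmem : ∀ s ≤ L τ β, P τ β s ∈ W := fun s hs => Or.inr ⟨τ, β, s, hw.leg, hs, rfl⟩
    have hne : z ≠ z₂ := by
      rintro rfl
      exact hp.ne (by omega) (by omega) (show t ≠ t + 1 by omega)
        (hG.partner_unique hp₁.symm hp₂.symm)
    refine IsLegVertex.exists_hasColor hix hw (Or.inr ⟨hz, ht, ?_⟩)
    refine hG.isPlace_partner hw.leg hp ht htL ?_ hp₁ hp₂ ?_ ?_ ?_ ?_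
    · intro hb
      by_contra hlt
      have h1 := hp.last_mem
      unfold legTarget at h1
      rw [if_pos hb, show L τ β = t + 1 by omega] at h1
      refine hG.not_onFace_of_partner hroot hb hz₂ hp₂ ?_
      rcases h1 with h1 | h1
      · rw [h1]
        exact hG.onFace_left hb.1
      · rw [h1]
        exact hG.onFace_right hb.1
    · rintro s hs rfl
      exact hz₁ (hmem s hs)
    · rintro s hs rfl
      exact hz₂ (hmem s hs)
    · intro hadj
      exact hne (hG.eq_of_adj_skeleton hP hroot (hmem (t + 1) htL) hz₁ hz₂ hadj
        (hG.adj_of_partner hp₂))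
    · rcases hconf z z₂ hz₁ hz₂ hne (hc₁.trans hc₂.symm) with h | ⟨-, h, -⟩ <;> omega
  -- The vertices that pass their colour on receive the colour `1`, so they must not be adjacent.
  have hswadj : ∀ w z w' z', sw w z → sw w' z' → ¬ G.Adj w w' := by
    rintro w z w' z' ⟨τ, β, t, hw, hSt, hz⟩ ⟨τ', β', t', hw', hSt', hz'⟩ hadj
    obtain ⟨rfl, rfl, h⟩ := IsLegVertex.leg_eq hG hP hw hw'
      (IsLegVertex.pos_of_partner hG hP hroot hw hz)
      (IsLegVertex.pos_of_partner hG hP hroot hw' hz') hadj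
    rcases h with rfl | rfl
    · exact (hS _ _ _ hSt).2.2.2 hSt'
    · exact (hS _ _ _ hSt').2.2.2 hSt
  -- The vertex `pl w` receives the colour `col w` that is meant for `w`.
  have hpl : ∀ w, ∃ v k, w ∈ W → HasColor M G L P ix r w v k ∧
      ((∃ z, sw w z) → sw w v) ∧ ((¬ ∃ z, sw w z) → v = w) := by
    intro w
    by_cases hs : ∃ z, sw w z
    · obtain ⟨z, hz⟩ := hs
      obtain ⟨k, hk⟩ := hswcol w z hz
      exact ⟨z, k, fun _ => ⟨hk, fun _ => hz, fun h => absurd ⟨z, hz⟩ h⟩⟩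
    · by_cases hw : w ∈ W
      · obtain ⟨k, hk⟩ := hG.exists_hasColor hP hix hw
        exact ⟨w, k, fun _ => ⟨hk, fun h => absurd h hs, fun _ => rfl⟩⟩
      · exact ⟨w, 0, fun h => absurd h hw⟩
  choose pl col hpl using hpl
  -- A vertex gets a colour of the skeleton, or `1` if it has passed its colour on, or its colour on
  -- a run outside the skeleton.
  have hall : ∀ x, ∃ k, (∃ w ∈ W, pl w = x ∧ k = col w) ∨ ((∃ z, sw x z) ∧ k = 1) ∨
      (x ∉ W ∧ (∀ w, ¬ sw w x) ∧ k = c₃ x) := by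
    intro x
    by_cases hs : ∃ z, sw x z
    · exact ⟨1, Or.inr (Or.inl ⟨hs, rfl⟩)⟩
    by_cases hx : x ∈ W
    · exact ⟨col x, Or.inl ⟨x, hx, (hpl x hx).2.2 hs, rfl⟩⟩
    by_cases hw : ∃ w, sw w x
    · obtain ⟨w, hw⟩ := hw
      have hwW := (hsw w x hw).1
      have h1 := (hpl w hwW).2.1 ⟨x, hw⟩
      refine ⟨col w, Or.inl ⟨w, hwW, ?_, rfl⟩⟩
      obtain ⟨_, _, _, _, _, h2⟩ := h1
      obtain ⟨_, _, _, _, _, h3⟩ := hw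
      exact hG.partner_unique h2 h3
    · exact ⟨c₃ x, Or.inr (Or.inr ⟨hx, fun w h => hw ⟨w, h⟩, rfl⟩)⟩
  choose c hcx using hall
  have h64 : 1 ≤ 64 ^ r := Nat.one_le_pow _ _ (by norm_num)
  have hcol4 : ∀ w ∈ W, 4 ≤ col w := fun w hw => (HasColor.bounds (hpl w hw).1).1
  have hc3' : ∀ x, 1 ≤ c₃ x ∧ c₃ x ≤ 3 := fun x => by
    rcases hc3 x with h | h | h <;> omega
  have hone : ∀ x y, x ≠ y → ¬ G.Adj x y → 1 < G.dist x y := fun x y hne hna =>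
    hc.one_lt_dist_of_ne_of_not_adj hne hna
  have h23 : ∀ x y, (∃ z, sw x z) → y ∉ W → (∀ w, ¬ sw w y) → ¬ G.Adj x y := by
    rintro x y ⟨z, hz⟩ hy hny hadj
    obtain ⟨hx, hzW⟩ := hsw x z hz
    have hadj' : G.Adj x z := by
      obtain ⟨_, _, _, _, _, h2⟩ := hz
      exact hG.adj_of_partner h2
    obtain rfl := hG.eq_of_adj_skeleton hP hroot hx hzW hy hadj' hadj
    exact hny x hz
  -- In each remaining pair in conflict, one of the two vertices has received another colour.
  have h33 : ∀ x y, x ∉ W → y ∉ W → (∀ w, ¬ sw w x) → (∀ w, ¬ sw w y) → x ≠ y → c₃ x = c₃ y →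
      c₃ x < G.dist x y := by
    intro x y hx hy hsx hsy hne he
    rcases hconf x y hx hy hne he with h | ⟨h3, -, w, hw, w', hw', hadj, hp, hp'⟩
    · exact h
    exfalso
    obtain ⟨τ, β, t, hl, ht⟩ := hleg w x hw hx hp
    obtain ⟨τ', β', t', hl', ht'⟩ := hleg w' y hw' hy hp'
    obtain ⟨rfl, rfl, h⟩ := IsLegVertex.leg_eq hG hP hl hl' ht ht' hadj
    have hBw : B τ β t := ⟨x, hx, hl.eq ▸ hp, h3⟩
    have hBw' : B τ β t' := ⟨y, hy, hl'.eq ▸ hp', he ▸ h3⟩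
    have hS1 : ¬ S τ β t := fun h => hsx w ⟨τ, β, t, hl, h, hp⟩
    have hS2 : ¬ S τ β t' := fun h => hsy w' ⟨τ, β, t', hl', h, hp'⟩
    rcases h with rfl | rfl
    · rcases hS' τ β t hl'.le hBw hBw' with h | h
      · exact hS1 h
      · exact hS2 h
    · rcases hS' τ β t' hl.le hBw' hBw with h | h
      · exact hS2 h
      · exact hS1 h
  refine ⟨c, fun x => ?_, fun x y hne he => ?_⟩
  · rcases hcx x with ⟨w, hw, -, h⟩ | ⟨-, h⟩ | ⟨-, -, h⟩
    · have := HasColor.bounds (hpl w hw).1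
      omega
    · omega
    · have := hc3' x
      omega
  · rw [← (hc.preconnected x y).coe_dist_eq_edist, Nat.cast_lt]
    rcases hcx x with ⟨w, hw, hwx, h⟩ | ⟨hs, h⟩ | ⟨hx, hs, h⟩ <;>
      rcases hcx y with ⟨w', hw', hwy, h'⟩ | ⟨hs', h'⟩ | ⟨hy, hs', h'⟩
    · subst hwx
      subst hwy
      have h1 := (hpl w hw).1
      have h2 := (hpl w' hw').1
      rw [← h', ← he, h] at h2
      rw [h]
      exact HasColor.lt_dist hG hP hroot hinj h1 h2 fun h => hne (by rw [h])
    · have := hcol4 w hw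
      omega
    · have := hcol4 w hw
      have := hc3' y
      omega
    · have := hcol4 w' hw'
      omega
    · rw [h]
      obtain ⟨z, hz⟩ := hs
      obtain ⟨z', hz'⟩ := hs'
      exact hone x y hne (hswadj x z y z' hz hz')
    · rw [h]
      exact hone x y hne (h23 x y hs hy hs')
    · have := hcol4 w' hw'
      have := hc3' x
      omega
    · rw [he, h', dist_comm]
      exact hone y x hne.symm (h23 y x hs' hx hs)
    · rw [h]
      exact h33 x y hx hy hs hs' hne (by omega)

end IsChordedCycle

end OuterplanarPacking

/-! ### A Jordan curve theorem for planar drawings -/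

namespace SimpleGraph

theorem eq_of_sameCycle {α β : Type*} {σ : Equiv.Perm α} {φ : α → β} (h : ∀ x, φ (σ x) = φ x)
    {x y : α} (hxy : σ.SameCycle x y) : φ x = φ y := by
  obtain ⟨k, rfl⟩ := hxy
  induction k with
  | zero => rfl
  | succ k ih => rw [add_comm, zpow_add, zpow_one, Equiv.Perm.mul_apply, h, ih]
  | pred k ih =>
    rw [ih, ← h ((σ ^ (-(k : ℤ) - 1)) x), ← Equiv.Perm.mul_apply, ← zpow_one_add]
    congr 3
    ring

namespace RotationSystem

variable {V : Type*} {G : SimpleGraph V} (R : G.RotationSystem)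

theorem fst_rot (d : G.Dart) : (R.rot d).fst = d.fst :=
  ((R.sameCycle_iff d (R.rot d)).1 (Equiv.Perm.SameCycle.refl _ _ |>.apply_right)).symm

theorem facePerm_apply (d : G.Dart) : R.facePerm d = R.rot d.symm := rfl

theorem faceOf_eq_iff (d d' : G.Dart) :
    R.faceOf d = R.faceOf d' ↔ R.facePerm.SameCycle d d' := Quotient.eq

theorem faceOf_facePerm (d : G.Dart) : R.faceOf (R.facePerm d) = R.faceOf d := by
  rw [faceOf_eq_iff]
  exact (Equiv.Perm.SameCycle.refl _ _).apply_left

theorem faceOf_rot (d : G.Dart) : R.faceOf (R.rot d) = R.faceOf d.symm := by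
  rw [← faceOf_facePerm R d.symm, facePerm_apply, Dart.symm_symm]

theorem exists_faceOf_eq (f : R.Face) : ∃ d, R.faceOf d = f := Quotient.exists_rep f

/-- A function of the faces that has the same value on both sides of each edge is constant. -/
theorem eq_of_faceOf_symm {α : Type*} (hc : G.Connected) {ψ : R.Face → α}
    (h : ∀ d : G.Dart, ψ (R.faceOf d) = ψ (R.faceOf d.symm)) (f f' : R.Face) : ψ f = ψ f' := by
  have hfst : ∀ d d' : G.Dart, d.fst = d'.fst → ψ (R.faceOf d) = ψ (R.faceOf d') :=
    fun d d' hd => eq_of_sameCycle (φ := fun d => ψ (R.faceOf d))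
      (fun d => by simp only [faceOf_rot]; rw [← h]) ((R.sameCycle_iff d d').2 hd)
  have hwalk : ∀ {u v : V} (p : G.Walk u v) (d d' : G.Dart), d.fst = u → d'.fst = v →
      ψ (R.faceOf d) = ψ (R.faceOf d') := by
    intro u v p
    induction p with
    | nil => exact fun d d' h1 h2 => hfst d d' (h1.trans h2.symm)
    | cons hadj p ih =>
      intro d d' h1 h2
      rw [hfst d ⟨(_, _), hadj⟩ h1, h]
      exact ih _ d' rfl h2
  obtain ⟨d, rfl⟩ := exists_faceOf_eq R f
  obtain ⟨d', rfl⟩ := exists_faceOf_eq R f'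
  obtain ⟨p⟩ := hc.preconnected d.fst d'.fst
  exact hwalk p d d' rfl rfl

theorem finite_face [Finite V] : Finite R.Face := by
  have : Finite G.Dart := Finite.of_injective (fun d => d.toProd) Dart.toProd_injective
  exact Quotient.finite _

end RotationSystem

/-- In a planar drawing, a set of edges with an even number of edges at each vertex is the set of
edges at which some two-colouring of the faces changes. The set of edges is given by its indicator
function `κ` modulo `2`. -/
theorem PlanarDrawing.exists_face_coloring {V : Type*} {G : SimpleGraph V} [Fintype V]
    [DecidableEq V] [Fintype G.Dart] (D : G.PlanarDrawing) {κ : Sym2 V → ZMod 2}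
    (hκ : ∀ v, ∑ d : G.Dart with d.fst = v, κ d.edge = 0) :
    ∃ ψ : D.Face → ZMod 2, ∀ d : G.Dart, ψ (D.faceOf d) + ψ (D.faceOf d.symm) = κ d.edge := by
  classical
  have := Fintype.ofFinite G.edgeSet
  have := D.toRotationSystem.finite_face
  have := Fintype.ofFinite D.Face
  -- The coboundary `δ` from the faces to the edges and the boundary `b` from the edges to the
  -- vertices.
  let δ : (D.Face → ZMod 2) →ₗ[ZMod 2] (G.edgeSet → ZMod 2) :=
    { toFun := fun ψ e => ∑ d : G.Dart with d.edge = e.1, ψ (D.faceOf d)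
      map_add' := fun ψ φ => by
        ext e
        simp [Finset.sum_add_distrib]
      map_smul' := fun c ψ => by
        ext e
        simp [Finset.mul_sum] }
  let b : (G.edgeSet → ZMod 2) →ₗ[ZMod 2] (V → ZMod 2) :=
    { toFun := fun κ v => ∑ d : G.Dart with d.fst = v, κ ⟨d.edge, d.edge_mem⟩
      map_add' := fun ψ φ => by
        ext e
        simp [Finset.sum_add_distrib]
      map_smul' := fun c ψ => by
        ext e
        simp [Finset.mul_sum] }
  have hfib : ∀ d : G.Dart, (Finset.univ.filter fun d' : G.Dart => d'.edge = d.edge) = {d, d.symm} :=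
    fun d => by
      ext d'
      simp [dart_edge_eq_iff]
  have hδ : ∀ ψ (d : G.Dart), δ ψ ⟨d.edge, d.edge_mem⟩ = ψ (D.faceOf d) + ψ (D.faceOf d.symm) := by
    intro ψ d
    change ∑ d' : G.Dart with d'.edge = d.edge, ψ (D.faceOf d') = _
    rw [hfib, Finset.sum_pair d.symm_ne.symm]
  have hbδ : ∀ ψ, b (δ ψ) = 0 := by
    intro ψ
    ext v
    change ∑ d : G.Dart with d.fst = v, δ ψ ⟨d.edge, d.edge_mem⟩ = 0
    simp only [hδ, Finset.sum_add_distrib]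
    have h1 : ∑ d : G.Dart with d.fst = v, ψ (D.faceOf d.symm) =
        ∑ d : G.Dart with d.fst = v, ψ (D.faceOf d) := by
      refine Finset.sum_equiv D.rot (fun d => ?_) fun d _ => ?_
      · simp [RotationSystem.fst_rot]
      · rw [RotationSystem.faceOf_rot]
    rw [h1, CharTwo.add_self_eq_zero]
  have hker : Module.finrank (ZMod 2) (LinearMap.ker δ) ≤ 1 := by
    have h1 : LinearMap.ker δ ≤ Submodule.span (ZMod 2) {fun _ => 1} := by
      intro ψ hψ
      rw [LinearMap.mem_ker] at hψ
      have h2 : ∀ d : G.Dart, ψ (D.faceOf d) = ψ (D.faceOf d.symm) := fun d => by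
        rw [← CharTwo.add_eq_zero, ← hδ, hψ]
        rfl
      have h3 := RotationSystem.eq_of_faceOf_symm D.toRotationSystem D.connected h2
      rw [Submodule.mem_span_singleton]
      rcases isEmpty_or_nonempty D.Face with h4 | ⟨⟨f⟩⟩
      · exact ⟨0, Subsingleton.elim _ _⟩
      · refine ⟨ψ f, ?_⟩
        ext f'
        simp [h3 f f']
    refine (Submodule.finrank_mono h1).trans ?_
    exact (finrank_span_le_card _).trans (by simp)
  have hb : Fintype.card V ≤ Module.finrank (ZMod 2) (LinearMap.range b) + 1 := by
    obtain ⟨v₀⟩ := D.connected.nonempty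
    have hedge : ∀ d : G.Dart,
        b (Pi.single ⟨d.edge, d.edge_mem⟩ 1) = Pi.single d.fst 1 + Pi.single d.snd 1 := by
      intro d
      ext v
      change ∑ d' : G.Dart with d'.fst = v,
        (Pi.single ⟨d.edge, d.edge_mem⟩ 1 : G.edgeSet → ZMod 2) ⟨d'.edge, d'.edge_mem⟩ = _
      have h1 : ∀ d' : G.Dart,
          (if d'.fst = v then
            (Pi.single ⟨d.edge, d.edge_mem⟩ 1 : G.edgeSet → ZMod 2) ⟨d'.edge, d'.edge_mem⟩ else 0) =
          if d'.edge = d.edge then (if d'.fst = v then 1 else 0) else 0 := by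
        intro d'
        rw [Pi.single_apply]
        simp only [Subtype.mk.injEq]
        split_ifs <;> rfl
      rw [Finset.sum_filter, Finset.sum_congr rfl fun d' _ => h1 d', ← Finset.sum_filter, hfib,
        Finset.sum_pair d.symm_ne.symm]
      simp [Pi.single_apply, eq_comm]
    have htop : LinearMap.range b ⊔ Submodule.span (ZMod 2) {Pi.single v₀ 1} = ⊤ := by
      have hs : ∀ v, (Pi.single v 1 : V → ZMod 2) ∈
          LinearMap.range b ⊔ Submodule.span (ZMod 2) {Pi.single v₀ 1} := by
        intro v
        obtain ⟨p⟩ := D.connected.preconnected v v₀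
        induction p with
        | nil => exact Submodule.mem_sup_right (Submodule.mem_span_singleton_self _)
        | @cons u w x hadj p ih =>
          have h1 : (Pi.single u 1 : V → ZMod 2) =
              b (Pi.single ⟨s(u, w), hadj⟩ 1) + Pi.single w 1 := by
            rw [show b (Pi.single ⟨s(u, w), hadj⟩ 1) = Pi.single u 1 + Pi.single w 1 from
              hedge ⟨(u, w), hadj⟩]
            ext x
            simp [add_assoc, CharTwo.add_self_eq_zero]
          rw [h1]
          exact Submodule.add_mem _ (Submodule.mem_sup_left ⟨_, rfl⟩) ih
      rw [eq_top_iff, ← (Pi.basisFun (ZMod 2) V).span_eq, Submodule.span_le]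
      rintro _ ⟨v, rfl⟩
      rw [Pi.basisFun_apply]
      exact hs v
    have h2 := Submodule.finrank_add_le_finrank_add_finrank (LinearMap.range b)
      (Submodule.span (ZMod 2) {(Pi.single v₀ 1 : V → ZMod 2)})
    rw [htop, finrank_top, Module.finrank_fintype_fun_eq_card] at h2
    have h3 : Module.finrank (ZMod 2)
        (Submodule.span (ZMod 2) {(Pi.single v₀ 1 : V → ZMod 2)}) ≤ 1 :=
      (finrank_span_le_card _).trans (by simp)
    omega
  have heq : LinearMap.range δ = LinearMap.ker b := by
    refine Submodule.eq_of_le_of_finrank_le ?_ ?_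
    · rintro _ ⟨ψ, rfl⟩
      exact hbδ ψ
    · have h1 := δ.finrank_range_add_finrank_ker
      have h2 := b.finrank_range_add_finrank_ker
      have h3 := D.euler
      rw [Module.finrank_fintype_fun_eq_card] at h1 h2
      simp only [Nat.card_eq_fintype_card] at h3
      omega
  have hmem : (fun e : G.edgeSet => κ e.1) ∈ LinearMap.range δ := by
    rw [heq, LinearMap.mem_ker]
    ext v
    exact hκ v
  obtain ⟨ψ, hψ⟩ := hmem
  exact ⟨ψ, fun d => by rw [← hδ, hψ]⟩

end SimpleGraph

/-! ### The outer cycle -/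

namespace SimpleGraph

theorem RotationSystem.rot_ne {V : Type*} {G : SimpleGraph V} (R : G.RotationSystem) {y : V}
    {d d' : G.Dart} (h : d.fst = y) (h' : d'.fst = y) (hne : d ≠ d') :
    R.rot d ≠ d := by
  intro hd
  obtain ⟨k, hk⟩ := (R.sameCycle_iff d d').2 (h.trans h'.symm)
  rw [Equiv.Perm.zpow_apply_eq_self_of_apply_eq_self hd] at hk
  exact hne hk

section Boundary

variable {V : Type*} {G : SimpleGraph V} [DecidableEq V] [Fintype G.Dart]

/-- The boundary of a single edge, modulo `2`. -/
theorem sum_indicator_edge (d : G.Dart) (v : V) :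
    (∑ d' : G.Dart with d'.fst = v, if d'.edge = d.edge then (1 : ZMod 2) else 0) =
      (if d.fst = v then 1 else 0) + if d.snd = v then 1 else 0 := by
  classical
  have hfib : (Finset.univ.filter fun d' : G.Dart => d'.edge = d.edge) = {d, d.symm} := by
    ext d'
    simp [dart_edge_eq_iff]
  rw [Finset.sum_filter, Finset.sum_congr rfl fun d' _ => show _ =
    if d'.edge = d.edge then (if d'.fst = v then (1 : ZMod 2) else 0) else 0 by split_ifs <;> rfl,
    ← Finset.sum_filter, hfib, Finset.sum_pair d.symm_ne.symm]
  rfl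

/-- The boundary of a walk, modulo `2`: its edges are counted with multiplicity, and only its ends
remain. -/
theorem sum_count_edges {u w : V} (p : G.Walk u w) (v : V) :
    ∑ d : G.Dart with d.fst = v, (p.edges.count d.edge : ZMod 2) =
      (if u = v then 1 else 0) + if w = v then 1 else 0 := by
  induction p with
  | nil => simp [CharTwo.add_self_eq_zero]
  | @cons u x w hadj p ih =>
    have h1 := sum_indicator_edge (⟨(u, x), hadj⟩ : G.Dart) v
    have h2 : ∀ d : G.Dart, ((Walk.cons hadj p).edges.count d.edge : ZMod 2) =
        p.edges.count d.edge + if d.edge = (⟨(u, x), hadj⟩ : G.Dart).edge then 1 else 0 := by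
      intro d
      have h3 : (s(u, x) == d.edge) = true ↔ d.edge = (⟨(u, x), hadj⟩ : G.Dart).edge := by
        rw [beq_iff_eq, eq_comm]
        rfl
      rw [Walk.edges_cons, List.count_cons, Nat.cast_add]
      simp only [h3, Nat.cast_ite, Nat.cast_one, Nat.cast_zero]
    simp only [h2, Finset.sum_add_distrib, h1, ih]
    have h3 : (if x = v then (1 : ZMod 2) else 0) + (if x = v then (1 : ZMod 2) else 0) = 0 :=
      CharTwo.add_self_eq_zero _
    linear_combination h3

end Boundary

section TwoConnected

variable {V : Type*} {G : SimpleGraph V}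

/-- In a `2`-connected graph, the ends of an edge are joined by a walk that does not use it. -/
theorem IsTwoConnected.exists_walk_avoiding [Finite V] (h2 : G.IsTwoConnected) (d : G.Dart) :
    ∃ p : G.Walk d.snd d.fst, d.edge ∉ p.edges := by
  classical
  obtain ⟨w, hw1, hw2⟩ : ∃ w, w ≠ d.fst ∧ w ≠ d.snd := by
    have := Fintype.ofFinite V
    by_contra hcon
    push Not at hcon
    have h3 := h2.three_le_card
    rw [Nat.card_eq_fintype_card] at h3
    have h4 : (Finset.univ : Finset V) ⊆ {d.fst, d.snd} := by
      intro w _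
      simp only [Finset.mem_insert, Finset.mem_singleton]
      by_cases h : w = d.fst
      · exact Or.inl h
      · exact Or.inr (hcon w h)
    have h5 := (Finset.card_le_card h4).trans Finset.card_le_two
    rw [Finset.card_univ] at h5
    omega
  -- A walk from one end to a third vertex `w` that avoids the other end, and back likewise.
  have key : ∀ x u w : V, u ≠ x → w ≠ x → ∃ p : G.Walk u w, x ∉ p.support := by
    intro x u w hu hw
    have hu' : u ∈ ({x}ᶜ : Set V) := hu
    have hw' : w ∈ ({x}ᶜ : Set V) := hw
    obtain ⟨p⟩ := (h2.connected_delete x).preconnected ⟨u, hu'⟩ ⟨w, hw'⟩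
    have h : x ∉ (p.map (Embedding.induce _).toHom).support := by
      rw [Walk.support_map]
      simp only [List.mem_map, not_exists, not_and]
      exact fun y _ h => y.2 h
    exact ⟨_, h⟩
  have hne : d.fst ≠ d.snd := d.adj.ne
  obtain ⟨p, hp⟩ := key d.fst d.snd w hne.symm hw1
  obtain ⟨q, hq⟩ := key d.snd w d.fst hw2 hne
  refine ⟨p.append q, fun h => ?_⟩
  rw [Walk.edges_append, List.mem_append] at h
  rcases h with h | h
  · exact hp (p.fst_mem_support_of_mem_edges h)
  · exact hq (q.snd_mem_support_of_mem_edges h)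

/-- In a planar drawing of a `2`-connected graph, the two sides of an edge are different faces. -/
theorem PlanarDrawing.faceOf_ne_faceOf_symm [Finite V] (h2 : G.IsTwoConnected)
    (D : G.PlanarDrawing) (d : G.Dart) : D.faceOf d ≠ D.faceOf d.symm := by
  classical
  have := Fintype.ofFinite V
  have : Finite G.Dart := Finite.of_injective (fun d => d.toProd) Dart.toProd_injective
  have := Fintype.ofFinite G.Dart
  obtain ⟨p, hp⟩ := h2.exists_walk_avoiding d
  obtain ⟨ψ, hψ⟩ := D.exists_face_coloring
    (κ := fun e => ((Walk.cons d.adj p).edges.count e : ZMod 2)) fun v => by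
      have h1 := sum_count_edges (Walk.cons d.adj p) v
      rw [CharTwo.add_self_eq_zero] at h1
      convert h1
  intro h
  have h1 := hψ d
  rw [← h, CharTwo.add_self_eq_zero, Walk.edges_cons, List.count_cons,
    List.count_eq_zero_of_not_mem hp] at h1
  have h2 : (s(d.fst, d.snd) == d.edge) = true := by
    rw [beq_iff_eq]
    rfl
  rw [if_pos h2] at h1
  simp at h1

/-- In a subcubic graph, at most three darts leave a vertex. -/
theorem IsSubcubic.eq_of_fst_eq [G.LocallyFinite] (h3 : G.IsSubcubic) {v : V} {a b c d : G.Dart}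
    (ha : a.fst = v) (hb : b.fst = v) (hc : c.fst = v) (hd : d.fst = v) (hab : a ≠ b)
    (hac : a ≠ c) (hbc : b ≠ c) (had : a ≠ d) (hbd : b ≠ d) : c = d := by
  classical
  by_contra hcd
  have hs : ∀ {x y : G.Dart}, x.fst = v → y.fst = v → x ≠ y → x.snd ≠ y.snd := by
    intro x y hx hy hne h
    exact hne (Dart.ext _ _ (Prod.ext (hx.trans hy.symm) h))
  have hm : ∀ {x : G.Dart}, x.fst = v → x.snd ∈ G.neighborFinset v := by
    rintro x rfl
    rw [mem_neighborFinset]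
    exact x.adj
  have h1 : ({a.snd, b.snd, c.snd, d.snd} : Finset V) ⊆ G.neighborFinset v := by
    intro x hx
    simp only [Finset.mem_insert, Finset.mem_singleton] at hx
    rcases hx with rfl | rfl | rfl | rfl
    · exact hm ha
    · exact hm hb
    · exact hm hc
    · exact hm hd
  have h4 := Finset.card_le_card h1
  rw [card_neighborFinset_eq_degree, Finset.card_insert_of_notMem, Finset.card_insert_of_notMem,
    Finset.card_pair (hs hc hd hcd)] at h4
  · have := h3 v
    omega
  · simp only [Finset.mem_insert, Finset.mem_singleton, not_or]
    exact ⟨hs hb hc hbc, hs hb hd hbd⟩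
  · simp only [Finset.mem_insert, Finset.mem_singleton, not_or]
    exact ⟨hs ha hb hab, hs ha hc hac, hs ha hd had⟩

end TwoConnected

/-- The dart of the outer face that leaves each vertex. -/
structure OuterplanarDrawing.IsOuterDart {V : Type*} {G : SimpleGraph V}
    (D : G.OuterplanarDrawing) (o : V → G.Dart) : Prop where
  fst : ∀ x, (o x).fst = x
  faceOf : ∀ x, D.faceOf (o x) = D.outer
  eq_of_faceOf : ∀ d, D.faceOf d = D.outer → d = o d.fst

namespace OuterplanarDrawing

variable {V : Type*} {G : SimpleGraph V} (D : G.OuterplanarDrawing)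

/-- Each vertex has exactly one corner in the outer face: with two such corners at a vertex of degree
at most three, the outer face would be on both sides of an edge. -/
theorem exists_isOuterDart [Finite V] [G.LocallyFinite] (h2 : G.IsTwoConnected)
    (h3 : G.IsSubcubic) : ∃ o, D.IsOuterDart o := by
  choose o ho ho' using D.vertexOnFace_outer
  refine ⟨o, ho, ho', fun d hd => ?_⟩
  by_contra hne
  have hrot : ∀ a b : G.Dart, D.faceOf a = D.outer → D.faceOf b = D.outer → D.rot a ≠ b := by
    rintro a b ha hb rfl
    rw [RotationSystem.faceOf_rot] at hb
    exact D.faceOf_ne_faceOf_symm h2 a (ha.trans hb.symm)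
  have hf := ho d.fst
  have hfa := ho' d.fst
  have h4 := D.toRotationSystem.fst_rot d
  have h5 := D.toRotationSystem.fst_rot (o d.fst)
  exact hne (D.rot.injective (h3.eq_of_fst_eq (v := d.fst) rfl hf h4 (h5.trans hf) hne
    (hrot d d hd hd).symm (hrot d _ hd hfa).symm (hrot _ d hfa hd).symm (hrot _ _ hfa hfa).symm))

/-- The dart `d` runs along a chord. -/
def IsChordDart (d : G.Dart) : Prop := D.faceOf d ≠ D.outer ∧ D.faceOf d.symm ≠ D.outer

variable {D}

theorem IsChordDart.symm {d : G.Dart} (h : D.IsChordDart d) : D.IsChordDart d.symm :=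
  ⟨h.2, by rw [Dart.symm_symm]; exact h.1⟩

theorem IsChordDart.edge_mem_chords {d : G.Dart} (h : D.IsChordDart d) : d.edge ∈ D.chords := by
  refine ⟨d.edge_mem, ?_⟩
  rintro ⟨d', he, hf⟩
  rcases (dart_edge_eq_iff _ _).1 he with rfl | rfl
  · exact h.1 hf
  · exact h.2 hf

namespace IsOuterDart

variable {o : V → G.Dart} (ho : D.IsOuterDart o)
include ho

theorem rot_symm (x : V) : D.rot (o x).symm = o (o x).snd := by
  have h1 : D.faceOf (D.rot (o x).symm) = D.outer := by
    rw [RotationSystem.faceOf_rot, Dart.symm_symm, ho.faceOf]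
  have h2 := ho.eq_of_faceOf _ h1
  rwa [RotationSystem.fst_rot] at h2

theorem snd_injective : Function.Injective fun x => (o x).snd := by
  intro x y h
  have h1 := ho.rot_symm x
  have h2 := ho.rot_symm y
  simp only at h
  rw [h, ← h2] at h1
  have h3 := Dart.symm_involutive.injective (D.rot.injective h1)
  rw [← ho.fst x, h3, ho.fst]

/-- The darts that leave the vertex after `x` on the outer cycle: the next outer dart, the reverse of
the outer dart at `x`, and darts along chords. -/
theorem cases_of_fst {d : G.Dart} {x : V} (hd : d.fst = (o x).snd) :
    d = o (o x).snd ∨ d = (o x).symm ∨ D.IsChordDart d := by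
  by_cases h1 : D.faceOf d = D.outer
  · left
    rw [← hd]
    exact ho.eq_of_faceOf d h1
  by_cases h2 : D.faceOf d.symm = D.outer
  · right
    left
    have h3 := ho.eq_of_faceOf _ h2
    have h4 : d.symm.fst = x := by
      apply ho.snd_injective
      simp only
      rw [← hd, ← h3]
      rfl
    rw [h4] at h3
    rw [← h3, Dart.symm_symm]
  · exact Or.inr (Or.inr ⟨h1, h2⟩)

theorem exists_snd_eq [Finite V] (y : V) : ∃ x, (o x).snd = y :=
  Finite.surjective_of_injective ho.snd_injective y

variable [Finite V] (h2 : G.IsTwoConnected)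
include h2

theorem symm_ne (x : V) : (o x).symm ≠ o (o x).snd := by
  intro h
  refine D.faceOf_ne_faceOf_symm h2 (o x) ?_
  rw [h, ho.faceOf, ho.faceOf]

/-- At a vertex without a chord, the outer dart is followed by the reverse of the preceding outer
dart. -/
theorem rot_of_no_chord {x : V} (hx : ∀ d : G.Dart, d.fst = (o x).snd → ¬ D.IsChordDart d) :
    D.rot (o (o x).snd) = (o x).symm := by
  have h1 : (o (o x).snd).fst = (o x).snd := ho.fst _
  rcases ho.cases_of_fst (d := D.rot (o (o x).snd)) (x := x)
    (by rw [RotationSystem.fst_rot, h1]) with h | h | h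
  · exact absurd h (D.rot_ne (d' := (o x).symm) h1 rfl (ho.symm_ne h2 x).symm)
  · exact h
  · exact absurd h (hx _ (by rw [RotationSystem.fst_rot, h1]))

variable [G.LocallyFinite] (h3 : G.IsSubcubic)
include h3

theorem chordDart_unique {d d' : G.Dart} (hd : D.IsChordDart d) (hd' : D.IsChordDart d')
    (h : d.fst = d'.fst) : d = d' := by
  obtain ⟨x, hx⟩ := ho.exists_snd_eq d.fst
  have h1 : ∀ {d}, D.IsChordDart d → o (o x).snd ≠ d := by
    rintro d hd rfl
    exact hd.1 (ho.faceOf _)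
  have h4 : ∀ {d}, D.IsChordDart d → (o x).symm ≠ d := by
    rintro d hd rfl
    exact hd.2 (by rw [Dart.symm_symm, ho.faceOf])
  exact h3.eq_of_fst_eq (v := d.fst) ((ho.fst _).trans hx) hx rfl h.symm (ho.symm_ne h2 x).symm
    (h1 hd) (h4 hd) (h1 hd') (h4 hd')

/-- A chord follows the outer dart, and it is followed by the reverse of the preceding outer
dart. -/
theorem rot_chordDart {d : G.Dart} {x : V} (hd : D.IsChordDart d) (hx : d.fst = (o x).snd) :
    D.rot d = (o x).symm ∧ D.rot (o (o x).snd) = d := by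
  have h1 : (o (o x).snd).fst = (o x).snd := ho.fst _
  have hds : (o x).symm ≠ d := by
    rintro rfl
    exact hd.2 (by rw [Dart.symm_symm, ho.faceOf])
  have hdo : o (o x).snd ≠ d := by
    rintro rfl
    exact hd.1 (ho.faceOf _)
  have h4 : D.rot d = (o x).symm := by
    rcases ho.cases_of_fst (d := D.rot d) (x := x) (by rw [RotationSystem.fst_rot, hx])
      with h | h | h
    · rw [← ho.rot_symm] at h
      exact absurd (D.rot.injective h).symm hds
    · exact h
    · exact absurd (ho.chordDart_unique h2 h3 h hd (RotationSystem.fst_rot _ _))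
        (D.rot_ne hx h1 hdo.symm)
  refine ⟨h4, ?_⟩
  rcases ho.cases_of_fst (d := D.rot (o (o x).snd)) (x := x)
    (by rw [RotationSystem.fst_rot, h1]) with h | h | h
  · exact absurd h (D.rot_ne (d' := (o x).symm) h1 rfl (ho.symm_ne h2 x).symm)
  · rw [← h4] at h
    exact absurd (D.rot.injective h) hdo
  · exact ho.chordDart_unique h2 h3 h hd (by rw [RotationSystem.fst_rot, h1, hx])

end IsOuterDart

end OuterplanarDrawing

end SimpleGraph

/-! ### The chords as a noncrossing matching -/

namespace SimpleGraph

namespace OuterplanarDrawing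

open OuterplanarPacking

variable {V : Type*} {G : SimpleGraph V} {D : G.OuterplanarDrawing}

/-- The outer cycle is `v 0, v 1, …, v (n - 1), v n = v 0`. The map `v` is periodic with period
`n`, so all of its values are on the cycle. -/
structure IsOuterCycle (D : G.OuterplanarDrawing) (o : V → G.Dart) (n : ℕ) (v : ℕ → V) : Prop
    extends D.IsOuterDart o where
  three_le : 3 ≤ n
  snd : ∀ i, (o (v i)).snd = v (i + 1)
  eq_of_eq : ∀ i j, i < n → j < n → v i = v j → i = j
  apply_period : v n = v 0
  exists_eq : ∀ x, ∃ i < n, v i = x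

/-- The positions of the chords along the outer cycle `v`. -/
def ChordAt (D : G.OuterplanarDrawing) (n : ℕ) (v : ℕ → V) (a b : ℕ) : Prop :=
  a < b ∧ b < n ∧ ∃ d : G.Dart, D.IsChordDart d ∧ d.fst = v a ∧ d.snd = v b

/-- The outer darts form a single face, so the outer cycle passes through all vertices. -/
theorem IsOuterDart.exists_iterate_eq [Finite V] {o : V → G.Dart} (ho : D.IsOuterDart o)
    (x y : V) : ∃ k : ℕ, (fun x => (o x).snd)^[k] x = y := by
  have : Finite G.Dart := Finite.of_injective (fun d => d.toProd) Dart.toProd_injective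
  have h1 : D.facePerm.SameCycle (o x) (o y) :=
    (D.faceOf_eq_iff _ _).1 ((ho.faceOf x).trans (ho.faceOf y).symm)
  obtain ⟨k, hk⟩ := h1.exists_nat_pow_eq
  have h2 : ∀ k : ℕ, (D.facePerm ^ k) (o x) = o ((fun x => (o x).snd)^[k] x) := by
    intro k
    induction k with
    | zero => rfl
    | succ k ih =>
      rw [pow_succ', Equiv.Perm.mul_apply, ih, Function.iterate_succ_apply',
        RotationSystem.facePerm_apply, ho.rot_symm]
  refine ⟨k, ?_⟩
  rw [← ho.fst y, ← hk, h2, ho.fst]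

theorem IsOuterDart.exists_isOuterCycle [Finite V] {o : V → G.Dart} (ho : D.IsOuterDart o)
    (h2 : G.IsTwoConnected) (x : V) :
    ∃ n, D.IsOuterCycle o n fun i => (fun x => (o x).snd)^[i] x := by
  set f : V → V := fun x => (o x).snd with hf
  have hper : x ∈ Function.periodicPts f := by
    obtain ⟨k, hk⟩ := ho.exists_iterate_eq (f x) x
    exact Function.mk_mem_periodicPts k.succ_pos hk
  have hpos := Function.minimalPeriod_pos_of_mem_periodicPts hper
  have hinj := Function.iterate_injOn_Iio_minimalPeriod (f := f) (x := x)
  have hsurj : ∀ y, ∃ i < Function.minimalPeriod f x, f^[i] x = y := by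
    intro y
    obtain ⟨k, hk⟩ := ho.exists_iterate_eq x y
    exact ⟨k % Function.minimalPeriod f x, Nat.mod_lt _ hpos,
      (Function.iterate_mod_minimalPeriod_eq).trans hk⟩
  have hthree : 3 ≤ Function.minimalPeriod f x := by
    refine h2.three_le_card.trans ?_
    have h : Function.Surjective fun i : Fin (Function.minimalPeriod f x) => f^[i] x := fun y => by
      obtain ⟨i, hi, h⟩ := hsurj y
      exact ⟨⟨i, hi⟩, h⟩
    simpa using Nat.card_le_card_of_surjective _ h
  exact ⟨Function.minimalPeriod f x,
    { ho with
      three_le := hthree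
      snd := fun i => (Function.iterate_succ_apply' f i x).symm
      eq_of_eq := fun i j hi hj h => hinj hi hj h
      apply_period := Function.iterate_minimalPeriod
      exists_eq := hsurj }⟩

namespace IsOuterCycle

variable {o : V → G.Dart} {n : ℕ} {v : ℕ → V} (hv : D.IsOuterCycle o n v)
include hv

theorem exists_snd_eq (i : ℕ) : ∃ x, (o x).snd = v i := by
  obtain ⟨j, -, hj⟩ := hv.exists_eq (v i)
  rcases j with _ | j
  · refine ⟨v (n - 1), ?_⟩
    have := hv.three_le
    rw [hv.snd, Nat.sub_add_cancel (by omega), hv.apply_period, hj]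
  · exact ⟨v j, by rw [hv.snd, hj]⟩

theorem succ_lt {a b : ℕ} (h : D.ChordAt n v a b) : a + 1 < b := by
  obtain ⟨hab, hb, d, hd, h1, h2⟩ := h
  by_contra hcon
  obtain rfl : b = a + 1 := by omega
  refine hd.1 ?_
  have h3 : d = o (v a) :=
    Dart.ext _ _ (Prod.ext (h1.trans (hv.fst _).symm) (h2.trans (hv.snd a).symm))
  rw [h3, hv.faceOf]

theorem adj_iff {i j : ℕ} (hi : i < n) (hj : j < n) : G.Adj (v i) (v j) ↔
    i + 1 = j ∨ j + 1 = i ∨ (i = 0 ∧ j + 1 = n) ∨ (j = 0 ∧ i + 1 = n) ∨ D.ChordAt n v i j ∨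
      D.ChordAt n v j i := by
  have hcyc : ∀ i, G.Adj (v i) (v (i + 1)) := fun i => by
    have := (o (v i)).adj
    rwa [hv.fst, hv.snd] at this
  have hlast : ∀ i, i + 1 = n → G.Adj (v i) (v 0) := by
    rintro i rfl
    have := hcyc i
    rwa [hv.apply_period] at this
  constructor
  · intro h
    let d : G.Dart := ⟨(v i, v j), h⟩
    have key : ∀ {i j} (d : G.Dart), i < n → j < n → d.fst = v i → d.snd = v j →
        D.faceOf d = D.outer → i + 1 = j ∨ (j = 0 ∧ i + 1 = n) := by
      intro i j d hi hj h1 h2 hd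
      have h3 := hv.eq_of_faceOf d hd
      rw [h3, h1, hv.snd] at h2
      rcases Nat.lt_or_ge (i + 1) n with h | h
      · exact Or.inl (hv.eq_of_eq _ _ h hj h2)
      · obtain rfl : n = i + 1 := by omega
        rw [hv.apply_period] at h2
        exact Or.inr ⟨(hv.eq_of_eq _ _ (by omega) hj h2).symm, rfl⟩
    by_cases h1 : D.faceOf d = D.outer
    · have := key d hi hj rfl rfl h1
      tauto
    by_cases h2 : D.faceOf d.symm = D.outer
    · have := key d.symm hj hi rfl rfl h2
      tauto
    have hd : D.IsChordDart d := ⟨h1, h2⟩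
    rcases lt_trichotomy i j with h' | h' | h'
    · exact Or.inr (Or.inr (Or.inr (Or.inr (Or.inl ⟨h', hj, d, hd, rfl, rfl⟩))))
    · subst h'
      exact absurd rfl h.ne
    · exact Or.inr (Or.inr (Or.inr (Or.inr (Or.inr ⟨h', hi, d.symm, hd.symm, rfl, rfl⟩))))
  · rintro (rfl | rfl | ⟨rfl, h⟩ | ⟨rfl, h⟩ | ⟨-, -, d, -, h1, h2⟩ | ⟨-, -, d, -, h1, h2⟩)
    · exact hcyc i
    · exact (hcyc j).symm
    · exact (hlast j h).symm
    · exact hlast i h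
    · rw [← h1, ← h2]
      exact d.adj
    · rw [← h1, ← h2]
      exact d.adj.symm

variable [Finite V] (h2 : G.IsTwoConnected) [G.LocallyFinite] (h3 : G.IsSubcubic)
include h2 h3

/-- A chord follows an outer dart around its first vertex, so it has an inner face in common with the
edge of the outer cycle that starts there. -/
theorem faceOf_chordDart {d : G.Dart} (hd : D.IsChordDart d) {i : ℕ} (hi : d.fst = v i) :
    D.faceOf d = D.faceOf (o (v i)).symm := by
  obtain ⟨x, hx⟩ := hv.exists_snd_eq i
  have h := (hv.toIsOuterDart.rot_chordDart h2 h3 hd (hi.trans hx.symm)).2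
  rw [hx] at h
  rw [← h, RotationSystem.faceOf_rot]

theorem matching {a b c d : ℕ} (h : D.ChordAt n v a b) (h' : D.ChordAt n v c d)
    (hc : a = c ∨ a = d ∨ b = c ∨ b = d) : a = c ∧ b = d := by
  obtain ⟨hab, hb, e, he, he1, he2⟩ := h
  obtain ⟨hcd, hd, e', he', he1', he2'⟩ := h'
  have h4 : ∀ {f f' : G.Dart}, D.IsChordDart f → D.IsChordDart f' → f.fst = f'.fst →
      f.snd = f'.snd := fun hf hf' h => by
    rw [hv.toIsOuterDart.chordDart_unique h2 h3 hf hf' h]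
  rcases hc with rfl | rfl | rfl | rfl
  · have h5 := h4 he he' (he1.trans he1'.symm)
    exact ⟨rfl, hv.eq_of_eq _ _ hb hd (by rw [← he2, ← he2', h5])⟩
  · have h5 := h4 he he'.symm (he1.trans he2'.symm)
    have := hv.eq_of_eq b c hb (by omega) (by rw [← he2, ← he1', h5]; rfl)
    omega
  · have h5 := h4 he.symm he' (he2.trans he1'.symm)
    have := hv.eq_of_eq a d (by omega) hd (by rw [← he1, ← he2', ← h5]; rfl)
    omega
  · have h5 := h4 he.symm he'.symm (he2.trans he2'.symm)
    exact ⟨hv.eq_of_eq a c (by omega) (by omega) (by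
      rw [← he1, ← he1']
      exact h5), rfl⟩

omit [G.LocallyFinite] h3 in
/-- A chord from `v a` to `v b` separates the inner faces at the edges of the outer cycle between
`v a` and `v b` from the inner faces at the other edges of the outer cycle: the chord and the path
`v a, …, v b` form a closed curve. -/
theorem exists_separating_coloring {d : G.Dart} (hd : D.IsChordDart d) {a b : ℕ} (ha : d.fst = v a)
    (hb : d.snd = v b) (hab : a < b) (hbn : b < n) : ∃ ψ : D.Face → ZMod 2,
      (∀ i < n, ψ (D.faceOf (o (v i)).symm) = if a ≤ i ∧ i < b then 1 else 0) ∧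
      ∀ d', D.IsChordDart d' → d'.edge ≠ d.edge → ψ (D.faceOf d') = ψ (D.faceOf d'.symm) := by
  have := Classical.decEq V
  have := Fintype.ofFinite V
  have : Finite G.Dart := Finite.of_injective (fun d => d.toProd) Dart.toProd_injective
  have := Fintype.ofFinite G.Dart
  obtain ⟨ψ, hψ⟩ := D.exists_face_coloring (κ := fun e => (if e = d.edge then (1 : ZMod 2) else 0) +
      ∑ i ∈ Finset.Ico a b, if e = (o (v i)).edge then (1 : ZMod 2) else 0) fun w => by
    rw [Finset.sum_add_distrib, Finset.sum_comm, sum_indicator_edge, ha, hb]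
    have htel : ∀ b, a ≤ b → ∑ i ∈ Finset.Ico a b, ∑ d' : G.Dart with d'.fst = w,
        (if d'.edge = (o (v i)).edge then (1 : ZMod 2) else 0) =
        (if v a = w then 1 else 0) + if v b = w then 1 else 0 := by
      intro b hb
      induction b, hb using Nat.le_induction with
      | base => rw [Finset.Ico_self, Finset.sum_empty, CharTwo.add_self_eq_zero]
      | succ b hb ih =>
        rw [Finset.sum_Ico_succ_top hb, ih, sum_indicator_edge, hv.fst, hv.snd]
        have h4 : (if v b = w then (1 : ZMod 2) else 0) + (if v b = w then 1 else 0) = 0 :=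
          CharTwo.add_self_eq_zero _
        linear_combination h4
    rw [htel b hab.le, CharTwo.add_self_eq_zero]
  have hne : ∀ d', D.IsChordDart d' → ∀ x, d'.edge ≠ (o x).edge := by
    intro d' hd' x h
    rcases (dart_edge_eq_iff _ _).1 h with rfl | rfl
    · exact hd'.1 (hv.faceOf x)
    · exact hd'.2 (by rw [Dart.symm_symm, hv.faceOf])
  -- Normalize the colouring so that the outer face has the colour `0`.
  refine ⟨fun f => ψ f - ψ D.outer, fun i hi => ?_, fun d' hd' hdd' => ?_⟩
  · have h1 := hψ (o (v i))
    have h4 : ∀ j ∈ Finset.Ico a b, (if (o (v i)).edge = (o (v j)).edge then (1 : ZMod 2) else 0) =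
        if i = j then 1 else 0 := by
      intro j hj
      rw [Finset.mem_Ico] at hj
      by_cases hij : i = j
      · rw [if_pos hij, if_pos (by rw [hij])]
      · rw [if_neg hij, if_neg fun h => ?_]
        rcases (dart_edge_eq_iff _ _).1 h with h | h
        · refine hij (hv.eq_of_eq i j hi (by omega) ?_)
          rw [← hv.fst (v i), h, hv.fst]
        · refine D.faceOf_ne_faceOf_symm h2 (o (v j)) ?_
          rw [← h, hv.faceOf, hv.faceOf]
    rw [if_neg (hne d hd (v i)).symm, Finset.sum_congr rfl h4, Finset.sum_ite_eq, hv.faceOf,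
      zero_add] at h1
    simp only [Finset.mem_Ico] at h1
    simp only
    rw [← h1, CharTwo.sub_eq_add, add_comm]
  · have h1 := hψ d'
    rw [if_neg hdd', Finset.sum_eq_zero fun i _ => if_neg (hne d' hd' _), add_zero,
      CharTwo.add_eq_zero] at h1
    simp only [h1]

theorem noncrossing {a b c d : ℕ} (h : D.ChordAt n v a b) (h' : D.ChordAt n v c d) (hac : a < c)
    (hcb : c < b) : d < b := by
  have hm := hv.matching h2 h3 h h'
  obtain ⟨hab, hb, e, he, he1, he2⟩ := h
  obtain ⟨hcd, hd, e', he', he1', he2'⟩ := h'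
  obtain ⟨ψ, hψ, hψ'⟩ := hv.exists_separating_coloring h2 he he1 he2 hab hb
  have hedge : e'.edge ≠ e.edge := by
    intro h
    have h4 : ∀ {i}, i < n → e.fst = v i → i = a := fun hi h =>
      hv.eq_of_eq _ _ hi (by omega) (h.symm.trans he1)
    rcases (dart_edge_eq_iff _ _).1 h with rfl | rfl
    · have := h4 (i := c) (by omega) he1'
      omega
    · have := h4 (i := d) (by omega) he2'
      omega
  have h5 := hψ' e' he' hedge
  rw [hv.faceOf_chordDart h2 h3 he' he1', hv.faceOf_chordDart h2 h3 he'.symm he2',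
    hψ c (by omega), hψ d hd, if_pos ⟨hac.le, hcb⟩] at h5
  by_contra hcon
  rw [if_neg (by omega)] at h5
  exact one_ne_zero h5

/-- A chord is determined by its inner face at the side of the path from its first to its last
vertex. -/
theorem eq_of_faceOf_eq {d d' : G.Dart} (hd : D.IsChordDart d) (hd' : D.IsChordDart d')
    {a b a' b' : ℕ} (ha : d.fst = v a) (hb : d.snd = v b) (ha' : d'.fst = v a')
    (hb' : d'.snd = v b') (hab : a < b) (hbn : b < n) (hab' : a' < b') (hbn' : b' < n)
    (h : D.faceOf d = D.faceOf d') : a = a' ∧ b = b' := by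
  have key : ∀ {d d' : G.Dart} {a b a' b' : ℕ}, D.IsChordDart d → D.IsChordDart d' →
      d.fst = v a → d.snd = v b → d'.fst = v a' → a < b → b < n → a' < n →
      D.faceOf d = D.faceOf d' → a ≤ a' := by
    intro d d' a b a' b' hd hd' ha hb ha' hab hbn han' h
    obtain ⟨ψ, hψ, -⟩ := hv.exists_separating_coloring h2 hd ha hb hab hbn
    by_contra hcon
    have h4 := hψ a (by omega)
    rw [← hv.faceOf_chordDart h2 h3 hd ha, h, hv.faceOf_chordDart h2 h3 hd' ha', hψ a' han',
      if_neg (by omega), if_pos ⟨le_rfl, hab⟩] at h4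
    exact zero_ne_one h4
  have h4 := key (b' := b') hd hd' ha hb ha' hab hbn (by omega) h
  have h5 := key (b' := b) hd' hd ha' hb' ha hab' hbn' (by omega) h.symm
  exact hv.matching h2 h3 ⟨hab, hbn, d, hd, ha, hb⟩ ⟨hab', hbn', d', hd', ha', hb'⟩
    (Or.inl (le_antisymm h4 h5))

theorem chordDiagram (hpos : ∀ a b, D.ChordAt n v a b → 0 < a) :
    ChordDiagram n (D.ChordAt n v) where
  three_le := hv.three_le
  bounds := fun h => ⟨hpos _ _ h, hv.succ_lt h, h.2.1⟩
  matching := hv.matching h2 h3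
  noncrossing := hv.noncrossing h2 h3

end IsOuterCycle

end OuterplanarDrawing

end SimpleGraph

/-! ### Branch arcs and internal faces -/

namespace SimpleGraph

namespace OuterplanarDrawing

open OuterplanarPacking

variable {V : Type*} {G : SimpleGraph V} {D : G.OuterplanarDrawing}

/-- The outer cycle can be numbered so that some chord joins `v (n - 1)` to the first vertex that
has a chord: start after a chord that spans as few edges of the cycle as possible. Then the root arc
has at most one child. -/
theorem IsOuterDart.exists_isOuterCycle_root [Finite V] [G.LocallyFinite] {o : V → G.Dart}
    (ho : D.IsOuterDart o) (h2 : G.IsTwoConnected) (h3 : G.IsSubcubic) :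
    ∃ n v, D.IsOuterCycle o n v ∧ (∀ a b, D.ChordAt n v a b → 0 < a) ∧
      ¬ IsBranchArc n (D.ChordAt n v) (0, n) := by
  classical
  by_cases hex : ∃ d, D.IsChordDart d
  · obtain ⟨d₀, hd₀⟩ := hex
    set f : V → V := fun x => (o x).snd with hf
    have hk : ∃ k, ∃ d, D.IsChordDart d ∧ f^[k] d.fst = d.snd := by
      obtain ⟨k, hk⟩ := ho.exists_iterate_eq d₀.fst d₀.snd
      exact ⟨k, d₀, hd₀, hk⟩
    obtain ⟨d, hd, hkd⟩ := Nat.find_spec hk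
    have hmin : ∀ j d, D.IsChordDart d → f^[j] d.fst = d.snd → Nat.find hk ≤ j :=
      fun j d hd h => Nat.find_min' hk ⟨d, hd, h⟩
    generalize Nat.find hk = k at hkd hmin
    obtain ⟨n, hv⟩ := ho.exists_isOuterCycle h2 (f d.fst)
    set v : ℕ → V := fun i => f^[i] (f d.fst) with hvdef
    have hvadd : ∀ i j, f^[j] (v i) = v (j + i) := fun i j =>
      (Function.iterate_add_apply f j i _).symm
    have h3n := hv.three_le
    have hk2 : 2 ≤ k := by
      rcases k with _ | _ | k
      · exact absurd hkd d.adj.ne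
      · refine absurd ?_ hd.1
        have h4 : d = o d.fst := Dart.ext _ _ (Prod.ext (ho.fst _).symm hkd.symm)
        rw [h4, ho.faceOf]
      · omega
    have hsnd : d.snd = v (k - 1) := by
      rw [← hkd, hvdef]
      simp only
      rw [← Function.iterate_succ_apply, Nat.succ_eq_add_one, Nat.sub_add_cancel (by omega)]
    have hfst : d.fst = v (n - 1) := by
      apply ho.snd_injective
      change f d.fst = f (v (n - 1))
      have h4 := hv.snd (n - 1)
      rw [Nat.sub_add_cancel (by omega), hv.apply_period] at h4
      exact h4.symm
    have hkn : k - 1 < n - 1 := by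
      obtain ⟨j, hj, hj'⟩ := hv.exists_eq d.snd
      have h4 := hmin (j + 1) d hd hj'
      rcases Nat.lt_or_ge (k - 1) (n - 1) with h | h
      · exact h
      · have h5 : k - 1 = n - 1 := by omega
        rw [← h5, ← hsnd] at hfst
        exact absurd hfst d.adj.ne
    have hM : D.ChordAt n v (k - 1) (n - 1) := ⟨hkn, by omega, d.symm, hd.symm, hsnd, hfst⟩
    -- A chord that starts before `k - 1` would be shorter or cross the chord `(k - 1, n - 1)`.
    have hle : ∀ a b, D.ChordAt n v a b → k - 1 ≤ a ∧ b ≤ n - 1 := by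
      intro a b hab
      have h4 := hv.noncrossing h2 h3 hab hM
      have h5 := hv.matching h2 h3 hab hM
      obtain ⟨hlt, hb, e, he, he1, he2⟩ := hab
      have h6 := hmin (b - a) e he (by rw [he1, hvadd, Nat.sub_add_cancel hlt.le, he2])
      omega
    refine ⟨n, v, hv, fun a b hab => ?_, ?_⟩
    · have := (hle a b hab).1
      omega
    · rintro ⟨-, γ, δ, hγ | rfl, hδ | rfl, hγn, hδn, -, hno⟩
      · refine hno (k - 1, n - 1) (Or.inl hM) ⟨?_, ?_⟩ ⟨(hle _ _ hγ).1, (hle _ _ hδ).2⟩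
        · simp only
          omega
        · simp only
          omega
      · exact lt_irrefl _ hδn.1
      · exact lt_irrefl _ hγn.1
      · exact lt_irrefl _ hγn.1
  · obtain ⟨x⟩ := h2.connected.nonempty
    obtain ⟨n, hv⟩ := ho.exists_isOuterCycle h2 x
    have hM : ∀ a b, ¬ D.ChordAt n (fun i => (fun x => (o x).snd)^[i] x) a b :=
      fun a b ⟨_, _, d, hd, _⟩ => hex ⟨d, hd⟩
    refine ⟨n, _, hv, fun a b hab => absurd hab (hM a b), ?_⟩
    rintro ⟨-, γ, -, hγ | rfl, -, hγn, -⟩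
    · exact hM _ _ hγ
    · exact lt_irrefl _ hγn.1

namespace IsOuterCycle

variable {o : V → G.Dart} {n : ℕ} {v : ℕ → V} (hv : D.IsOuterCycle o n v)
include hv

theorem edge_ne {d d' : G.Dart} {a b a' b' : ℕ} (ha : d.fst = v a) (hb : d.snd = v b)
    (ha' : d'.fst = v a') (hb' : d'.snd = v b') (hab : a < b) (hbn : b < n) (hab' : a' < b')
    (hbn' : b' < n) (hne : ¬ (a = a' ∧ b = b')) : d.edge ≠ d'.edge := by
  intro h
  rcases (dart_edge_eq_iff _ _).1 h with rfl | rfl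
  · exact hne ⟨hv.eq_of_eq _ _ (by omega) (by omega) (ha.symm.trans ha'),
      hv.eq_of_eq _ _ hbn hbn' (hb.symm.trans hb')⟩
  · have h1 := hv.eq_of_eq a b' (by omega) hbn' (ha.symm.trans hb')
    have h2 := hv.eq_of_eq b a' hbn (by omega) (hb.symm.trans ha')
    omega

variable [Finite V] (h2 : G.IsTwoConnected) [G.LocallyFinite] (h3 : G.IsSubcubic)
include h2 h3

/-- Going around the inner face below a chord `d`, one meets each edge of the outer cycle that is
below `d` but not below a further chord. -/
theorem faceOf_symm_of_not_below {d : G.Dart} (hd : D.IsChordDart d) {a b : ℕ} (ha : d.fst = v a)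
    (hb : d.snd = v b) (hbn : b < n) {x : ℕ} (hax : a ≤ x) (hxb : x < b)
    (hx : ∀ c e, D.ChordAt n v c e → a < c → e < b → c ≤ x → e ≤ x) :
    D.faceOf (o (v x)).symm = D.faceOf d := by
  have hM : D.ChordAt n v a b := ⟨by omega, hbn, d, hd, ha, hb⟩
  induction hm : b - x using Nat.strong_induction_on generalizing x with
  | _ m ih =>
    subst hm
    have hsnd := hv.snd x
    by_cases hxb' : x + 1 = b
    · have h4 := (hv.toIsOuterDart.rot_chordDart h2 h3 hd.symm (x := v x)
        (by rw [hsnd, hxb', ← hb]; rfl)).1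
      rw [← h4, RotationSystem.faceOf_rot, Dart.symm_symm]
    by_cases hch : ∃ d', D.IsChordDart d' ∧ d'.fst = v (x + 1)
    · -- A chord at `v (x + 1)` leads to `v e`; the face continues after `v e`.
      obtain ⟨d', hd', hfst⟩ := hch
      have h4 := (hv.toIsOuterDart.rot_chordDart h2 h3 hd' (hfst.trans hsnd.symm)).1
      rw [← h4, RotationSystem.faceOf_rot]
      obtain ⟨e, he, hsnd'⟩ := hv.exists_eq d'.snd
      have hlt : x + 1 < e ∧ e < b := by
        rcases lt_trichotomy e (x + 1) with h | h | h
        · have hM' : D.ChordAt n v e (x + 1) :=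
            ⟨h, by omega, d'.symm, hd'.symm, hsnd'.symm, hfst⟩
          have h5 := hv.matching h2 h3 hM hM'
          have h6 := hv.noncrossing h2 h3 hM' hM
          have h7 := hx e (x + 1) hM'
          omega
        · subst h
          exact absurd (hfst.trans hsnd') d'.adj.ne
        · have hM' : D.ChordAt n v (x + 1) e := ⟨h, he, d', hd', hfst, hsnd'.symm⟩
          have h6 := hv.noncrossing h2 h3 hM hM'
          omega
      have hM' : D.ChordAt n v (x + 1) e := ⟨hlt.1, he, d', hd', hfst, hsnd'.symm⟩
      rw [hv.faceOf_chordDart h2 h3 hd'.symm (i := e) hsnd'.symm]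
      refine ih (b - e) (by omega) (by omega) hlt.2 (fun c g hcg hac hgb hce => ?_) rfl
      have h5 := hv.matching h2 h3 hM' hcg
      have h6 := hv.noncrossing h2 h3 hM' hcg
      have h7 := hx c g hcg hac hgb
      have h8 := hcg.1
      omega
    · push Not at hch
      have h4 := hv.toIsOuterDart.rot_of_no_chord h2 (x := v x)
        fun d' h hd' => hch d' hd' (h.trans hsnd)
      rw [← h4, RotationSystem.faceOf_rot, hsnd]
      refine ih (b - (x + 1)) (by omega) (by omega) (by omega) (fun c g hcg hac hgb hcx => ?_) rfl
      have h7 := hx c g hcg hac hgb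
      have h8 : c ≠ x + 1 := by
        rintro rfl
        obtain ⟨-, -, d', hd', h9, -⟩ := hcg
        exact hch d' hd' h9
      have h9 := hcg.1
      omega

/-- A child of a chord lies on the face below that chord. -/
theorem faceOf_symm_of_isChildArc (hpos : ∀ a b, D.ChordAt n v a b → 0 < a) {d d' : G.Dart}
    (hd : D.IsChordDart d) (hd' : D.IsChordDart d') {β τ : ℕ × ℕ}
    (ha : d.fst = v β.1) (hb : d.snd = v β.2) (ha' : d'.fst = v τ.1) (hb' : d'.snd = v τ.2)
    (hbn : β.2 < n) (hτ : IsChildArc n (D.ChordAt n v) β τ) :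
    D.faceOf d'.symm = D.faceOf d := by
  have hD := hv.chordDiagram h2 h3 hpos
  have h1 := hD.arc_bounds hτ.1
  have hin := hτ.2.1
  unfold Inside at hin
  have hM : D.ChordAt n v τ.1 τ.2 := ⟨by omega, by omega, d', hd', ha', hb'⟩
  rw [hv.faceOf_chordDart h2 h3 hd'.symm (i := τ.2) hb']
  refine hv.faceOf_symm_of_not_below h2 h3 hd ha hb hbn (by omega) hin.2 fun c e hce hac heb hcx => ?_
  have h4 := hτ.2.2 (c, e) (Or.inl hce) ⟨hac, heb⟩
  have h5 := hv.matching h2 h3 hM hce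
  have h6 := hv.noncrossing h2 h3 hM hce
  have h7 := hce.1
  unfold Inside at h4
  simp only at h4
  omega

/-- The face below a branch arc is internal: the arc and two of its children lie on it. Different
branch arcs have different faces. -/
theorem ncard_branchArcs_le (hpos : ∀ a b, D.ChordAt n v a b → 0 < a)
    (hroot : ¬ IsBranchArc n (D.ChordAt n v) (0, n)) :
    {β | IsBranchArc n (D.ChordAt n v) β}.ncard ≤ D.internalFaces.ncard := by
  have hD := hv.chordDiagram h2 h3 hpos
  have := D.toRotationSystem.finite_face
  have hch : ∀ β, IsBranchArc n (D.ChordAt n v) β → D.ChordAt n v β.1 β.2 := by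
    intro β hβ
    rcases hβ.1 with h | rfl
    · exact h
    · exact absurd hβ hroot
  have hex : ∀ β, ∃ f, IsBranchArc n (D.ChordAt n v) β → ∃ d, D.IsChordDart d ∧ d.fst = v β.1 ∧
      d.snd = v β.2 ∧ f = D.faceOf d := by
    intro β
    by_cases hβ : IsBranchArc n (D.ChordAt n v) β
    · obtain ⟨-, -, d, hd, h1, h2⟩ := hch β hβ
      exact ⟨D.faceOf d, fun _ => ⟨d, hd, h1, h2, rfl⟩⟩
    · exact ⟨D.outer, fun h => absurd h hβ⟩
  choose f hf using hex
  refine Set.ncard_le_ncard_of_injOn f (fun β hβ => ?_) (fun β hβ β' hβ' h => ?_) (Set.toFinite _)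
  · obtain ⟨d, hd, ha, hb, hfd⟩ := hf β hβ
    obtain ⟨hlt, hbn, -⟩ := hch β hβ
    obtain ⟨-, γ, δ, hγ, hδ, hγβ, hδβ, hγδ, hno⟩ := hβ
    obtain ⟨τ, hτ, hγτ⟩ := hD.exists_isChildArc hγ hγβ
    obtain ⟨τ', hτ', hδτ⟩ := hD.exists_isChildArc hδ hδβ
    have hne : ¬ (τ.1 = τ'.1 ∧ τ.2 = τ'.2) := by
      rintro ⟨h4, h5⟩
      refine hno τ hτ.1 hτ.2.1 ⟨hγτ.1, ?_⟩
      rw [h5]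
      exact hδτ.2
    have hchild : ∀ τ, IsChildArc n (D.ChordAt n v) β τ → D.ChordAt n v τ.1 τ.2 := by
      rintro τ ⟨h | rfl, hin, -⟩
      · exact h
      · exact absurd hin.1 (Nat.not_lt_zero _)
    obtain ⟨hlt1, hbn1, d1, hd1, ha1, hb1⟩ := hchild τ hτ
    obtain ⟨hlt2, hbn2, d2, hd2, ha2, hb2⟩ := hchild τ' hτ'
    have hf1 := hv.faceOf_symm_of_isChildArc h2 h3 hpos hd hd1 ha hb ha1 hb1 hbn hτ
    have hf2 := hv.faceOf_symm_of_isChildArc h2 h3 hpos hd hd2 ha hb ha2 hb2 hbn hτ'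
    rw [hfd]
    refine ⟨hd.1, (Set.two_lt_ncard_iff (Set.toFinite _)).2 ⟨d.edge, d1.edge, d2.edge,
      ⟨hd.edge_mem_chords, d, rfl, rfl⟩,
      ⟨hd1.edge_mem_chords, d1.symm, Dart.edge_symm _, hf1⟩,
      ⟨hd2.edge_mem_chords, d2.symm, Dart.edge_symm _, hf2⟩, ?_, ?_, ?_⟩⟩
    · exact hv.edge_ne ha hb ha1 hb1 hlt hbn hlt1 hbn1 fun h => hτ.2.1.1.ne h.1
    · exact hv.edge_ne ha hb ha2 hb2 hlt hbn hlt2 hbn2 fun h => hτ'.2.1.1.ne h.1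
    · exact hv.edge_ne ha1 hb1 ha2 hb2 hlt1 hbn1 hlt2 hbn2 hne
  · obtain ⟨d, hd, ha, hb, hfd⟩ := hf β hβ
    obtain ⟨hlt, hbn, -⟩ := hch β hβ
    obtain ⟨d', hd', ha', hb', hfd'⟩ := hf β' hβ'
    obtain ⟨hlt', hbn', -⟩ := hch β' hβ'
    have h4 := hv.eq_of_faceOf_eq h2 h3 hd hd' ha hb ha' hb' hlt hbn hlt' hbn'
      (by rw [← hfd, ← hfd', h])
    exact Prod.ext h4.1 h4.2

end IsOuterCycle

end OuterplanarDrawing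

/-- A packing colouring can be pulled back along an injective homomorphism. -/
theorem IsPackingColoring.comp_hom {V W : Type*} {G : SimpleGraph V} {H : SimpleGraph W} {k : ℕ}
    {c : W → ℕ} (hc : H.IsPackingColoring k c) (f : G →g H) (hf : Function.Injective f) :
    G.IsPackingColoring k (c ∘ f) where
  color_mem := fun v => hc.color_mem (f v)
  lt_dist := fun u v huv h => (hc.lt_dist (f u) (f v) (hf.ne huv) h).trans_le <|
    le_iInf fun p => (edist_le (p.map f)).trans_eq (by rw [Walk.length_map])

end SimpleGraph

/-! ### The packing chromatic number -/

theorem theorem3p4 {V : Type*} [Fintype V] (G : SimpleGraph V) [DecidableRel G.Adj]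
    (h2 : G.IsTwoConnected) (h3 : G.IsSubcubic)
    (D : G.OuterplanarDrawing) (r : ℕ) (hr : D.internalFaces.ncard = r) :
    G.packingChromaticNumber ≤ ((17 * 6 ^ (3 * r) - 2 : ℕ) : ℕ∞) := by
  obtain ⟨o, ho⟩ := D.exists_isOuterDart h2 h3
  obtain ⟨n, v, hv, hpos, hroot⟩ := ho.exists_isOuterCycle_root h2 h3
  have hG : OuterplanarPacking.IsChordedCycle n (D.ChordAt n v) (G.comap fun i : Fin n => v i) :=
    { hv.chordDiagram h2 h3 hpos with
      adj_iff := fun i j => hv.adj_iff i.2 j.2 }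
  -- The face below a branch arc is internal, so there are at most `r` branch arcs.
  obtain ⟨c, hc⟩ := hG.exists_isPackingColoring hroot
    ((hv.ncard_branchArcs_le h2 h3 hpos hroot).trans hr.le)
  choose p hpn hp using hv.exists_eq
  let f : G →g G.comap fun i : Fin n => v i :=
    { toFun := fun x => ⟨p x, hpn x⟩
      map_rel' := fun {x y} h => by
        change G.Adj (v (p x)) (v (p y))
        rwa [hp, hp] }
  have hf : Function.Injective f := fun x y h => by
    rw [← hp x, ← hp y, show p x = p y from congrArg Fin.val h]
  refine (iInf₂_le (16 * 64 ^ r - 1) ⟨_, hc.comp_hom f hf⟩).trans (Nat.cast_le.2 ?_)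
  -- It remains to compare `16 * 64 ^ r - 1` with `17 * 216 ^ r - 2`.
  have h4 : 64 ^ r ≤ 6 ^ (3 * r) := by
    rw [pow_mul]
    exact Nat.pow_le_pow_left (by norm_num) r
  have h5 : 1 ≤ 64 ^ r := Nat.one_le_pow _ _ (by norm_num)
  omega
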